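/- A non-empty vertex set $S$ of a finite simple graph $G$ is a safe set if there are no connected component $C$ of $G[S]$ and connected component $D$ of $G-S$ such that $C$ and $D$ are joined by an edge and $|C|<|D|$; it is a connected safe set if moreover $G[S]$ is connected. Let $\mathsf{s}(G)$ and $\mathsf{cs}(G)$ be the minimum sizes of a safe set and of a connected safe set of $G$. A $c$-expression is a rooted binary tree built from leaves $\circ_i$ (a single vertex with label $i$), nodes $\cup$ (disjoint union of the two labeled graphs below), nodes $\rho_{i,j}$ (change all labels $i$ to $j$) and nodes $\eta_{i,j}$ (add all edges between vertices with label $i$ and vertices with label $j$), where $i,j\in\{1,\dots,c\}$ and $i\neq j$; it is an expression of $G$ if its leaves are identified with the vertices of $G$ and the graph represented by its root is $G$. It is irredundant if for each edge $\{u,v\}$ of $G$ exactly one $\eta$-node adds the edge between $u$ and $v$. Theorem. There is an algorithm that, given an irredundant $c$-expression $T$ with $O(n)$ nodes of an $n$-vertex graph $G$, computes the values $\mathsf{s}(G)$ and $\mathsf{cs}(G)$, together with a safe set of size $\mathsf{s}(G)$ and a connected safe set of size $\mathsf{cs}(G)$, in time $O(n^{28\cdot 2^c+1})$ on a word RAM.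 Here, for every $c$ and $K$, the constant factor hidden in the time bound depends only on $c$ and $K$, where $T$ has at most $Kn$ nodes, and all numbers used are at most the same bound $O(n^{28\cdot 2^c+1})$, i.e. words have $O(\log n)$ bits for fixed $c$ and $K$. -/

import Mathlib

/-! ## Safe sets -/

namespace SafeSet

/-- A non-empty set `S` of vertices is a safe set if no component `C` of `G[S]` is adjacent to a
strictly larger component `D` of `G - S`. -/
def IsSafeSet {V : Type*} (G : SimpleGraph V) (S : Finset V) : Prop :=
  S.Nonempty ∧
    ∀ (C : (G.induce (S : Set V)).ConnectedComponent)
      (D : (G.induce (S : Set V)ᶜ).ConnectedComponent),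
      (∃ a ∈ C.supp, ∃ b ∈ D.supp, G.Adj (a : V) (b : V)) → ¬ C.supp.ncard < D.supp.ncard

/-- A safe set that induces a connected subgraph. -/
def IsConnectedSafeSet {V : Type*} (G : SimpleGraph V) (S : Finset V) : Prop :=
  IsSafeSet G S ∧ (G.induce (S : Set V)).Connected

/-- The size of a minimum safe set (one exists as soon as `G` is finite with a vertex). -/
noncomputable def safeNumber {V : Type*} (G : SimpleGraph V) : ℕ :=
  sInf {k | ∃ S : Finset V, IsSafeSet G S ∧ S.card = k}

/-- The size of a minimum connected safe set (one exists as soon as `G` is finite with a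
vertex). -/
noncomputable def connectedSafeNumber {V : Type*} (G : SimpleGraph V) : ℕ :=
  sInf {k | ∃ S : Finset V, IsConnectedSafeSet G S ∧ S.card = k}

/-! ## Clique-width expressions -/

/-- `c`-expressions whose leaves are named by elements of `V`; the label set is `Fin c`.
The constructors are the nodes `∘ᵢ` (creating the vertex `v`), `∪`, `ρᵢⱼ` and `ηᵢⱼ`. -/
inductive CExpr (V : Type*) (c : ℕ) : Type _
  | vertex (v : V) (i : Fin c) : CExpr V c
  | union (s t : CExpr V c) : CExpr V c
  | relabel (i j : Fin c) (hij : i ≠ j) (t : CExpr V c) : CExpr V c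
  | join (i j : Fin c) (hij : i ≠ j) (t : CExpr V c) : CExpr V c

namespace CExpr

variable {V : Type*} {c : ℕ}

/-- The number of nodes. -/
def size : CExpr V c → ℕ
  | vertex _ _ => 1
  | union s t => s.size + t.size + 1
  | relabel _ _ _ t => t.size + 1
  | join _ _ _ t => t.size + 1

/-- The vertices created at the leaves, from left to right. -/
def leaves : CExpr V c → List V
  | vertex v _ => [v]
  | union s t => s.leaves ++ t.leaves
  | relabel _ _ _ t => t.leaves
  | join _ _ _ t => t.leaves

/-- The label of the vertex `v` in the labeled graph represented by an expression
(`none` if `v` is not a vertex of it). -/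
def label [DecidableEq V] : CExpr V c → V → Option (Fin c)
  | vertex u i, v => if v = u then some i else none
  | union s t, v => (s.label v).or (t.label v)
  | relabel i j _ t, v => (t.label v).map fun l => if l = i then j else l
  | join _ _ _ t, v => t.label v

/-- One of `u`, `v` is an `i`-vertex and the other one is a `j`-vertex of the labeled graph
represented by `t`, i.e. an `ηᵢⱼ`-node above `t` adds the edge between `u` and `v`. -/
def Joins [DecidableEq V] (t : CExpr V c) (i j : Fin c) (u v : V) : Prop :=
  (t.label u = some i ∧ t.label v = some j) ∨ (t.label u = some j ∧ t.label v = some i)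

instance [DecidableEq V] (t : CExpr V c) (i j : Fin c) (u v : V) : Decidable (t.Joins i j u v) :=
  inferInstanceAs (Decidable (_ ∨ _))

/-- Adjacency in the labeled graph represented by an expression. -/
def Adj [DecidableEq V] : CExpr V c → V → V → Prop
  | vertex _ _, _, _ => False
  | union s t, u, v => s.Adj u v ∨ t.Adj u v
  | relabel _ _ _ t, u, v => t.Adj u v
  | join i j _ t, u, v => t.Adj u v ∨ t.Joins i j u v

/-- The number of `η`-nodes that add the edge between `u` and `v`. -/
def addCount [DecidableEq V] : CExpr V c → V → V → ℕ
  | vertex _ _, _, _ => 0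
  | union s t, u, v => s.addCount u v + t.addCount u v
  | relabel _ _ _ t, u, v => t.addCount u v
  | join i j _ t, u, v => t.addCount u v + if t.Joins i j u v then 1 else 0

/-- The expression represents the graph `G`: every vertex of `G` is created at exactly one leaf
(so that all unions are disjoint), and the adjacency is that of `G`. -/
def Represents [DecidableEq V] (T : CExpr V c) (G : SimpleGraph V) : Prop :=
  T.leaves.Nodup ∧ (∀ v, v ∈ T.leaves) ∧ ∀ u v, G.Adj u v ↔ T.Adj u v

/-- Every edge is added by exactly one `η`-node. -/
def Irredundant [DecidableEq V] (T : CExpr V c) : Prop :=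
  ∀ u v, T.Adj u v → T.addCount u v = 1

/-- The nodes in post-order, three words for each node. -/
def code {n : ℕ} : CExpr (Fin n) c → List ℕ
  | vertex v i => [0, (v : ℕ), (i : ℕ)]
  | union s t => s.code ++ t.code ++ [1, 0, 0]
  | relabel i j _ t => t.code ++ [2, (i : ℕ), (j : ℕ)]
  | join i j _ t => t.code ++ [3, (i : ℕ), (j : ℕ)]

/-- The input words for an expression: the number `n` of vertices, the number `c` of labels,
the number of nodes, and the list of nodes. -/
def input {n : ℕ} (T : CExpr (Fin n) c) : List ℕ :=
  n :: c :: T.size :: T.code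

end CExpr

/-! ## A word RAM with step count -/

namespace RAM

/-- The binary operations of the machine. -/
inductive Op : Type
  | add | sub | mul | div | mod | lt | eq

/-- Meaning of the operations: subtraction is truncated, `a / 0 = 0`, `a % 0 = a`, and
comparisons return `0` or `1`. -/
def Op.eval : Op → ℕ → ℕ → ℕ
  | add, a, b => a + b
  | sub, a, b => a - b
  | mul, a, b => a * b
  | div, a, b => a / b
  | mod, a, b => a % b
  | lt, a, b => if a < b then 1 else 0
  | eq, a, b => if a = b then 1 else 0

/-- Programs. Registers are named by numbers (a program mentions only finitely many of them);
the memory is accessed indirectly, through an address held in a register. -/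
inductive Program : Type
  | skip : Program
  /-- `R[d] := k` -/
  | const (d k : ℕ) : Program
  /-- `R[d] := R[a]` -/
  | copy (d a : ℕ) : Program
  /-- `R[d] := R[a] o R[b]` -/
  | op (o : Op) (d a b : ℕ) : Program
  /-- `R[d] := M[R[a]]` -/
  | load (d a : ℕ) : Program
  /-- `M[R[a]] := R[b]` -/
  | store (a b : ℕ) : Program
  | seq (p q : Program) : Program
  /-- if `R[a] ≠ 0` then `p` else `q` -/
  | ite (a : ℕ) (p q : Program) : Program
  /-- while `R[a] ≠ 0` do `p` -/
  | loop (a : ℕ) (p : Program) : Program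

/-- Contents of the registers and of the memory. -/
structure State : Type where
  reg : ℕ → ℕ
  mem : ℕ → ℕ

/-- Write a register. -/
def State.setReg (s : State) (d x : ℕ) : State := { s with reg := Function.update s.reg d x }

/-- Write a memory cell. -/
def State.setMem (s : State) (d x : ℕ) : State := { s with mem := Function.update s.mem d x }

/-- `Exec W p s t s'`: with words of size `W` (no number larger than `W` may ever be produced),
the program `p` started in `s` terminates after exactly `t` steps in `s'`. Each elementary
instruction and each evaluation of a branching or loop condition is one step. -/
inductive Exec (W : ℕ) : Program → State → ℕ → State → Prop
  | skip (s : State) : Exec W .skip s 1 s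
  | const (s : State) (d k : ℕ) (h : k ≤ W) : Exec W (.const d k) s 1 (s.setReg d k)
  | copy (s : State) (d a : ℕ) : Exec W (.copy d a) s 1 (s.setReg d (s.reg a))
  | op (s : State) (o : Op) (d a b : ℕ) (h : o.eval (s.reg a) (s.reg b) ≤ W) :
      Exec W (.op o d a b) s 1 (s.setReg d (o.eval (s.reg a) (s.reg b)))
  | load (s : State) (d a : ℕ) : Exec W (.load d a) s 1 (s.setReg d (s.mem (s.reg a)))
  | store (s : State) (a b : ℕ) : Exec W (.store a b) s 1 (s.setMem (s.reg a) (s.reg b))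
  | seq {p q : Program} {s s' s'' : State} {t t' : ℕ}
      (hp : Exec W p s t s') (hq : Exec W q s' t' s'') : Exec W (.seq p q) s (t + t') s''
  | ite_true {a : ℕ} {p q : Program} {s s' : State} {t : ℕ}
      (h : s.reg a ≠ 0) (hp : Exec W p s t s') : Exec W (.ite a p q) s (t + 1) s'
  | ite_false {a : ℕ} {p q : Program} {s s' : State} {t : ℕ}
      (h : s.reg a = 0) (hq : Exec W q s t s') : Exec W (.ite a p q) s (t + 1) s'
  | loop_done {a : ℕ} {p : Program} {s : State}
      (h : s.reg a = 0) : Exec W (.loop a p) s 1 s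
  | loop_step {a : ℕ} {p : Program} {s s' s'' : State} {t t' : ℕ}
      (h : s.reg a ≠ 0) (hp : Exec W p s t s') (hl : Exec W (.loop a p) s' t' s'') :
      Exec W (.loop a p) s (t + t' + 1) s''

/-- The initial state: the input words stand in the memory cells `0, 1, 2, …`; everything else
is `0`. -/
def initial (x : List ℕ) : State where
  reg := fun _ => 0
  mem := fun k => x.getD k 0

/-- On the input `x`, with words of size `W`, the program `p` terminates after at most `B` steps
with a memory content that satisfies `Q`. -/
def ComputesWithin (p : Program) (x : List ℕ) (W B : ℕ) (Q : (ℕ → ℕ) → Prop) : Prop :=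
  (∀ k ∈ x, k ≤ W) ∧ ∃ (t : ℕ) (s : State), t ≤ B ∧ Exec W p (initial x) t s ∧ Q s.mem

end RAM

/-- The memory holds the safe number of `G`, the connected safe number of `G`, and the
characteristic vectors of a minimum safe set and of a minimum connected safe set. -/
def HoldsOptima {n : ℕ} (G : SimpleGraph (Fin n)) (mem : ℕ → ℕ) : Prop :=
  mem 0 = safeNumber G ∧ mem 1 = connectedSafeNumber G ∧
    ∃ S S' : Finset (Fin n),
      (IsSafeSet G S ∧ S.card = safeNumber G) ∧
      (IsConnectedSafeSet G S' ∧ S'.card = connectedSafeNumber G) ∧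
      ∀ v : Fin n,
        mem (2 + v) = (if v ∈ S then 1 else 0) ∧
        mem (2 + n + v) = (if v ∈ S' then 1 else 0)

end SafeSet

/-! A vertex set `S` is treated as a colouring: colour 2 inside, colour 1 outside, and colour 0 for
vertices that a subexpression does not yet contain. Components of `G[S]` and `G - S` are then
monochromatic components. In a partial graph the type of a component is its colour together with the
set of labels occurring in it, so there are `2 * 2 ^ c` types. The nodes further up act on a
component only through its type.

Safety compares final sizes, which are not known while the graph is being built. They are therefore
guessed: a state assigns to every type a promised final size (0 meaning that the actual size
counts), a threshold, and a number of vertices. A colouring is admissible (`Ok`) if adjacent inner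
and outer components compare correctly with respect to promised sizes, inner components are at least
as large as the threshold of their type, and outer components are at most as large. The thresholds
suffice because a join connects components according to their types: of all inner components of a
type only the smallest matters, of all outer ones only the largest. The totals suffice because a
join merges all components of one colour that carry one of the two labels as soon as both labels
occur in this colour, so the size of the merged component is a sum of totals.

The exchange argument is `Ok.step`: promises and thresholds above a relabelling or joining node can
be pulled back below it so that any colouring with the same totals that is admissible below is
admissible above. A family of colourings is `Complete` if it contains, for every admissible
colouring and every choice of promises and thresholds, an admissible colouring with the same totals.
A complete family stays complete under relabelling and joining without any change
(`Complete.relabel`, `Complete.join`). At a union, sums of representatives form a complete family,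
which is thinned out to one colouring per state (`Complete.union`, `exists_meets`); there are `(n +
1) ^ (6 * 2 ^ c)` states. At the root, promise 0 and suitable thresholds turn completeness into the
existence of safe and of connected safe sets of every attainable size in the family (`exists_safe`),
so it remains to search the table for the smallest ones.

A union node examines pairs of table entries together with a state, i.e. three nested loops over
states. Together with the loop over the nodes and a naive reachability computation this gives the
exponent `18 * 2 ^ c + 5`, which is at most `28 * 2 ^ c + 1`.

The algorithm is written in a small language with arrays, bounded loops and saturating arithmetic. A
verified compiler (`Cmd.compile_spec`) translates it to the RAM, and both the running time and the
unaffected parts of the store are read off from the syntax. -/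

namespace SafeSet.RAM

/-! ## Composing executions -/

/-- The program `p` leads from `m` to `m'` in at most `B` steps. -/
def Runs (W : ℕ) (p : Program) (m : State) (B : ℕ) (m' : State) : Prop :=
  ∃ t ≤ B, Exec W p m t m'

namespace Runs

variable {W : ℕ}

theorem mono {p : Program} {m m' : State} {B B' : ℕ} (h : Runs W p m B m') (hB : B ≤ B') :
    Runs W p m B' m' := by
  obtain ⟨t, ht, h⟩ := h
  exact ⟨t, ht.trans hB, h⟩

theorem skip (m : State) : Runs W .skip m 1 m := ⟨1, le_rfl, .skip m⟩

theorem const {m : State} {d k : ℕ} (h : k ≤ W) : Runs W (.const d k) m 1 (m.setReg d k) :=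
  ⟨1, le_rfl, .const m d k h⟩

theorem copy {m : State} {d a : ℕ} : Runs W (.copy d a) m 1 (m.setReg d (m.reg a)) :=
  ⟨1, le_rfl, .copy m d a⟩

theorem op {m : State} {o : Op} {d a b : ℕ} (h : o.eval (m.reg a) (m.reg b) ≤ W) :
    Runs W (.op o d a b) m 1 (m.setReg d (o.eval (m.reg a) (m.reg b))) :=
  ⟨1, le_rfl, .op m o d a b h⟩

theorem load {m : State} {d a : ℕ} : Runs W (.load d a) m 1 (m.setReg d (m.mem (m.reg a))) :=
  ⟨1, le_rfl, .load m d a⟩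

theorem store {m : State} {a b : ℕ} :
    Runs W (.store a b) m 1 (m.setMem (m.reg a) (m.reg b)) :=
  ⟨1, le_rfl, .store m a b⟩

theorem seq {p q : Program} {m m' m'' : State} {B B' : ℕ} (hp : Runs W p m B m')
    (hq : Runs W q m' B' m'') : Runs W (.seq p q) m (B + B') m'' := by
  obtain ⟨t, ht, hp⟩ := hp
  obtain ⟨t', ht', hq⟩ := hq
  exact ⟨t + t', by omega, hp.seq hq⟩

theorem ite {a : ℕ} {p q : Program} {m m' : State} {B : ℕ}
    (hp : m.reg a ≠ 0 → Runs W p m B m') (hq : m.reg a = 0 → Runs W q m B m') :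
    Runs W (.ite a p q) m (B + 1) m' := by
  by_cases h : m.reg a = 0
  · obtain ⟨t, ht, hq⟩ := hq h
    exact ⟨t + 1, by omega, .ite_false h hq⟩
  · obtain ⟨t, ht, hp⟩ := hp h
    exact ⟨t + 1, by omega, .ite_true h hp⟩

/-- A loop whose controlling register counts down. -/
theorem loop {r : ℕ} {p : Program} {B : ℕ} (I : ℕ → State → Prop)
    (hr : ∀ k m, I k m → m.reg r = k)
    (hstep : ∀ k m, I (k + 1) m → ∃ m', Runs W p m B m' ∧ I k m') :
    ∀ k m, I k m → ∃ m', Runs W (.loop r p) m (k * (B + 1) + 1) m' ∧ I 0 m' := by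
  intro k
  induction k with
  | zero => exact fun m h => ⟨m, ⟨1, by omega, .loop_done (hr 0 m h)⟩, h⟩
  | succ k ih =>
    intro m h
    obtain ⟨m₁, ⟨t₁, ht₁, h₁⟩, hI⟩ := hstep k m h
    obtain ⟨m₂, ⟨t₂, ht₂, h₂⟩, hI'⟩ := ih m₁ hI
    refine ⟨m₂, ⟨t₁ + t₂ + 1, ?_, .loop_step ?_ h₁ h₂⟩, hI'⟩
    · rw [Nat.succ_mul]; omega
    · rw [hr _ m h]; omega

end Runs

/-! ## A structured language -/

/-- Expressions over registers, parameters and three-dimensional arrays, with bounded sums. -/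
inductive Expr : Type
  | lit (k : Fin 8)
  | var (x : ℕ)
  | par (k : ℕ)
  | op (o : Op) (a b : Expr)
  | get (k : Fin 16) (a b c : Expr)
  | sum (x k : ℕ) (e : Expr)

/-- Commands; loops run over an initial segment of `ℕ` whose length is a parameter. -/
inductive Cmd : Type
  | skip
  | set (x : ℕ) (e : Expr)
  | put (k : Fin 16) (a b c e : Expr)
  | seq (p q : Cmd)
  | ite (e : Expr) (p q : Cmd)
  | forLt (x k : ℕ) (p : Cmd)

/-- Contents of the registers and of the arrays. -/
@[ext] structure Store : Type where
  reg : ℕ → ℕ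
  arr : Fin 16 → ℕ → ℕ → ℕ → ℕ

namespace Store

def setReg (s : Store) (x v : ℕ) : Store :=
  { s with reg := fun y => if y = x then v else s.reg y }

def setArr (s : Store) (k : Fin 16) (i j l v : ℕ) : Store :=
  { s with arr := fun k' i' j' l' =>
      if k' = k ∧ i' = i ∧ j' = j ∧ l' = l then v else s.arr k' i' j' l' }

@[simp] theorem setReg_reg (s : Store) (x v y : ℕ) :
    (s.setReg x v).reg y = if y = x then v else s.reg y := rfl

@[simp] theorem setReg_arr (s : Store) (x v : ℕ) : (s.setReg x v).arr = s.arr := rfl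

@[simp] theorem setArr_reg (s : Store) (k : Fin 16) (i j l v : ℕ) :
    (s.setArr k i j l v).reg = s.reg := rfl

@[simp] theorem setArr_arr (s : Store) (k : Fin 16) (i j l v : ℕ) (k' : Fin 16) (i' j' l' : ℕ) :
    (s.setArr k i j l v).arr k' i' j' l' =
      if k' = k ∧ i' = i ∧ j' = j ∧ l' = l then v else s.arr k' i' j' l' := rfl

end Store

/-- The results of additions and multiplications are cut off at the parameter `0`. -/
def clip (ρ : ℕ → ℕ) : Op → ℕ → ℕ
  | .add, x => min x (ρ 0)
  | .mul, x => min x (ρ 0)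
  | _, x => x

namespace Expr

/-- Saturation makes the semantics total: from a store bounded by `ρ 0` every value is at most `ρ
0`, so overflow never has to be discussed while reasoning about a program. Where exact arithmetic
matters, the bounds in `Sizes` show that the cut-off has no effect. -/
def val (ρ : ℕ → ℕ) : Expr → Store → ℕ
  | lit k, _ => k
  | var x, s => s.reg x
  | par k, _ => ρ k
  | op o a b, s => clip ρ o (o.eval (a.val ρ s) (b.val ρ s))
  | get k a b c, s => s.arr k (a.val ρ s) (b.val ρ s) (c.val ρ s)
  | sum x k e, s => min (∑ t ∈ Finset.range (ρ k), e.val ρ (s.setReg x t)) (ρ 0)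

/-- A bound for the number of steps of the evaluation. -/
def cost (ρ : ℕ → ℕ) : Expr → ℕ
  | lit _ => 1
  | var _ => 1
  | par _ => 1
  | op _ a b => a.cost ρ + b.cost ρ + 4
  | get _ a b c => a.cost ρ + b.cost ρ + c.cost ρ + 10
  | sum _ k e => ρ k * (e.cost ρ + 8) + 5

end Expr

namespace Cmd

/-- `N` rounds of a loop body. -/
def iter (f : ℕ → Store → Store) : ℕ → Store → Store
  | 0, s => s
  | N + 1, s => f N (iter f N s)

/-- The loop variable is set afresh in each round, so a body that overwrites it cannot influence the
number of rounds. The compiled code achieves this with a separate hidden counter. -/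
def eval (ρ : ℕ → ℕ) : Cmd → Store → Store
  | skip, s => s
  | set x e, s => s.setReg x (e.val ρ s)
  | put k a b c e, s => s.setArr k (a.val ρ s) (b.val ρ s) (c.val ρ s) (e.val ρ s)
  | seq p q, s => q.eval ρ (p.eval ρ s)
  | ite e p q, s => if e.val ρ s ≠ 0 then p.eval ρ s else q.eval ρ s
  | .forLt x k p, s => iter (fun t s => p.eval ρ (s.setReg x t)) (ρ k) s

/-- A bound for the number of steps of the execution. -/
def cost (ρ : ℕ → ℕ) : Cmd → ℕ
  | skip => 1
  | set _ e => e.cost ρ + 1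
  | put _ a b c e => a.cost ρ + b.cost ρ + c.cost ρ + e.cost ρ + 10
  | seq p q => p.cost ρ + q.cost ρ
  | ite e p q => e.cost ρ + p.cost ρ + q.cost ρ + 1
  | .forLt _ k p => ρ k * (p.cost ρ + 4) + 2

end Cmd

/-! ## Compilation -/

/-- The machine register of a variable. -/
def vr (x : ℕ) : ℕ := 4 * x
/-- The machine registers for intermediate results. -/
def hd (h : ℕ) : ℕ := 4 * h + 1
/-- The machine register of a parameter. -/
def pr (k : ℕ) : ℕ := 4 * k + 2
/-- Machine registers that are constant during the execution of compiled code. -/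
def sp (i : ℕ) : ℕ := 4 * i + 3

@[simp] theorem vr_inj (x y : ℕ) : vr x = vr y ↔ x = y := by unfold vr; omega
@[simp] theorem hd_inj (x y : ℕ) : hd x = hd y ↔ x = y := by unfold hd; omega
@[simp] theorem pr_inj (x y : ℕ) : pr x = pr y ↔ x = y := by unfold pr; omega
@[simp] theorem sp_inj (x y : ℕ) : sp x = sp y ↔ x = y := by unfold sp; omega
@[simp] theorem vr_ne_hd (x y : ℕ) : vr x ≠ hd y := by unfold vr hd; omega
@[simp] theorem vr_ne_pr (x y : ℕ) : vr x ≠ pr y := by unfold vr pr; omega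
@[simp] theorem vr_ne_sp (x y : ℕ) : vr x ≠ sp y := by unfold vr sp; omega
@[simp] theorem hd_ne_vr (x y : ℕ) : hd x ≠ vr y := by unfold vr hd; omega
@[simp] theorem hd_ne_pr (x y : ℕ) : hd x ≠ pr y := by unfold hd pr; omega
@[simp] theorem hd_ne_sp (x y : ℕ) : hd x ≠ sp y := by unfold hd sp; omega
@[simp] theorem pr_ne_vr (x y : ℕ) : pr x ≠ vr y := by unfold vr pr; omega
@[simp] theorem pr_ne_hd (x y : ℕ) : pr x ≠ hd y := by unfold hd pr; omega
@[simp] theorem pr_ne_sp (x y : ℕ) : pr x ≠ sp y := by unfold pr sp; omega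
@[simp] theorem sp_ne_vr (x y : ℕ) : sp x ≠ vr y := by unfold vr sp; omega
@[simp] theorem sp_ne_hd (x y : ℕ) : sp x ≠ hd y := by unfold hd sp; omega
@[simp] theorem sp_ne_pr (x y : ℕ) : sp x ≠ pr y := by unfold pr sp; omega

@[simp] theorem State.setReg_reg (m : State) (d x r : ℕ) :
    (m.setReg d x).reg r = if r = d then x else m.reg r := by
  simp [State.setReg, Function.update_apply]

@[simp] theorem State.setReg_mem (m : State) (d x : ℕ) : (m.setReg d x).mem = m.mem := rfl

@[simp] theorem State.setMem_mem (m : State) (a x r : ℕ) :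
    (m.setMem a x).mem r = if r = a then x else m.mem r := by
  simp [State.setMem, Function.update_apply]

@[simp] theorem State.setMem_reg (m : State) (a x : ℕ) : (m.setMem a x).reg = m.reg := rfl

/-- The machine address of an array entry. -/
def addr (ρ : ℕ → ℕ) (base : ℕ) (k : Fin 16) (i j l : ℕ) : ℕ :=
  ((l * (ρ 0 + 1) + j) * (ρ 0 + 1) + i) * 16 + k + base

/-- Addresses are numbers in mixed radix with digits `k` (radix 16), `i`, `j` (radix `ρ 0 + 1`) and
leading digit `l`, which needs no bound. -/
theorem addr_inj {ρ : ℕ → ℕ} {base : ℕ} {k k' : Fin 16} {i j l i' j' l' : ℕ} (hi : i ≤ ρ 0)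
    (hj : j ≤ ρ 0) (hi' : i' ≤ ρ 0) (hj' : j' ≤ ρ 0) :
    addr ρ base k i j l = addr ρ base k' i' j' l' ↔ k = k' ∧ i = i' ∧ j = j' ∧ l = l' := by
  refine ⟨fun h => ?_, ?_⟩
  · unfold addr at h
    have digits : ∀ {D x y a b : ℕ}, a < D → b < D → x * D + a = y * D + b → x = y ∧ a = b := by
      intro D x y a b ha hb h
      have h1 : (x * D + a) / D = x := by
        rw [mul_comm, Nat.mul_add_div (by omega), Nat.div_eq_of_lt ha, add_zero]
      have h2 : (y * D + b) / D = y := by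
        rw [mul_comm, Nat.mul_add_div (by omega), Nat.div_eq_of_lt hb, add_zero]
      have : x = y := by rw [← h1, h, h2]
      subst this
      exact ⟨rfl, by omega⟩
    obtain ⟨h1, hk⟩ := digits k.2 k'.2 (Nat.add_right_cancel h)
    obtain ⟨h2, hi⟩ := digits (Nat.lt_succ_of_le hi) (Nat.lt_succ_of_le hi') h1
    obtain ⟨h3, hj⟩ := digits (Nat.lt_succ_of_le hj) (Nat.lt_succ_of_le hj') h2
    exact ⟨Fin.ext hk, hi, hj, h3⟩
  · rintro ⟨rfl, rfl, rfl, rfl⟩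
    rfl

/-- Replaces the hidden register `d + 2` by the address of the array entry whose indices stand in
the hidden registers `d`, `d + 1`, `d + 2`. -/
def addrProg (k : Fin 16) (d : ℕ) : Program :=
  .seq (.op .mul (hd (d + 2)) (hd (d + 2)) (sp 0)) <|
  .seq (.op .add (hd (d + 2)) (hd (d + 2)) (hd (d + 1))) <|
  .seq (.op .mul (hd (d + 2)) (hd (d + 2)) (sp 0)) <|
  .seq (.op .add (hd (d + 2)) (hd (d + 2)) (hd d)) <|
  .seq (.const (hd (d + 1)) 16) <|
  .seq (.op .mul (hd (d + 2)) (hd (d + 2)) (hd (d + 1))) <|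
  .seq (.const (hd (d + 1)) k) <|
  .seq (.op .add (hd (d + 2)) (hd (d + 2)) (hd (d + 1))) <|
  .op .add (hd (d + 2)) (hd (d + 2)) (sp 1)

/-- Cuts off the register `r` at the parameter `0`. -/
def clipProg (r f : ℕ) : Program :=
  .seq (.op .lt f (pr 0) r) (.ite f (.copy r (pr 0)) .skip)

/-- The code that computes an expression into the hidden register `d`. -/
def Expr.compile : Expr → ℕ → Program
  | lit k, d => .const (hd d) k
  | var x, d => .copy (hd d) (vr x)
  | par k, d => .copy (hd d) (pr k)
  | op o a b, d =>
    .seq (a.compile d) <| .seq (b.compile (d + 1)) <|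
    .seq (.op o (hd d) (hd d) (hd (d + 1))) <| clipProg (hd d) (hd (d + 1))
  | get k a b c, d =>
    .seq (a.compile d) <| .seq (b.compile (d + 1)) <| .seq (c.compile (d + 2)) <|
    .seq (addrProg k d) <| .load (hd d) (hd (d + 2))
  | sum x k e, d =>
    .seq (.const (hd d) 0) <| .seq (.copy (hd (d + 1)) (vr x)) <|
    .seq (.copy (hd (d + 2)) (pr k)) <|
    .seq (.loop (hd (d + 2)) (
      .seq (.op .sub (vr x) (pr k) (hd (d + 2))) <| .seq (e.compile (d + 3)) <|
      .seq (.op .add (hd d) (hd d) (hd (d + 3))) <| .seq (clipProg (hd d) (hd (d + 3))) <|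
      .op .sub (hd (d + 2)) (hd (d + 2)) (sp 2))) <|
    .copy (vr x) (hd (d + 1))

/-- The code of a command; the hidden registers below `d` are not used. -/
def Cmd.compile : Cmd → ℕ → Program
  | skip, _ => .skip
  | set x e, d => .seq (e.compile d) (.copy (vr x) (hd d))
  | put k a b c e, d =>
    .seq (a.compile d) <| .seq (b.compile (d + 1)) <| .seq (c.compile (d + 2)) <|
    .seq (e.compile (d + 3)) <| .seq (addrProg k d) <| .store (hd (d + 2)) (hd (d + 3))
  | seq p q, d => .seq (p.compile d) (q.compile d)
  | ite e p q, d => .seq (e.compile d) (.ite (hd d) (p.compile d) (q.compile d))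
  | .forLt x k p, d =>
    .seq (.copy (hd d) (pr k)) <| .loop (hd d) (
      .seq (.op .sub (vr x) (pr k) (hd d)) <| .seq (p.compile (d + 1)) <|
      .op .sub (hd d) (hd d) (sp 2))

/-- The sizes of the parameters and of the memory region for the arrays. -/
structure Fits (W : ℕ) (ρ : ℕ → ℕ) (base : ℕ) : Prop where
  eight_le : 8 ≤ ρ 0
  par_le : ∀ k, ρ k ≤ ρ 0
  le_word : (ρ 0 + 1) ^ 3 * 16 + 16 + base ≤ W

/-- The machine state `m` represents the store `s`. -/
structure Sim (ρ : ℕ → ℕ) (base : ℕ) (s : Store) (m : State) : Prop where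
  var : ∀ x, m.reg (vr x) = s.reg x
  par : ∀ k, m.reg (pr k) = ρ k
  radix : m.reg (sp 0) = ρ 0 + 1
  region : m.reg (sp 1) = base
  one : m.reg (sp 2) = 1
  mem : ∀ k i j l, i ≤ ρ 0 → j ≤ ρ 0 → l ≤ ρ 0 → m.mem (addr ρ base k i j l) = s.arr k i j l
  reg_le : ∀ x, s.reg x ≤ ρ 0
  arr_le : ∀ k i j l, s.arr k i j l ≤ ρ 0

/-- The two machine states differ at most in the hidden registers from `d` on. -/
def Agree (d : ℕ) (m m' : State) : Prop :=
  m'.mem = m.mem ∧ ∀ r, (∀ h, d ≤ h → r ≠ hd h) → m'.reg r = m.reg r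

theorem Agree.refl (d : ℕ) (m : State) : Agree d m m := ⟨rfl, fun _ _ => rfl⟩

theorem Agree.trans {d d' : ℕ} {m m' m'' : State} (h : Agree d m m') (h' : Agree d' m' m'')
    (hd : d ≤ d') : Agree d m m'' :=
  ⟨h'.1.trans h.1, fun r hr => (h'.2 r fun h hh => hr h (hd.trans hh)).trans (h.2 r hr)⟩

theorem Agree.hd_eq {d h : ℕ} {m m' : State} (H : Agree d m m') (hh : h < d) :
    m'.reg (hd h) = m.reg (hd h) := H.2 _ fun h' hh' e => by simp at e; omega

theorem Agree.sim {ρ : ℕ → ℕ} {base d : ℕ} {s : Store} {m m' : State} (H : Agree d m m')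
    (hs : Sim ρ base s m) : Sim ρ base s m' where
  var x := by rw [H.2 _ (by simp), hs.var]
  par x := by rw [H.2 _ (by simp), hs.par]
  radix := by rw [H.2 _ (by simp), hs.radix]
  region := by rw [H.2 _ (by simp), hs.region]
  one := by rw [H.2 _ (by simp), hs.one]
  mem k i j l hi hj hl := by rw [H.1, hs.mem k i j l hi hj hl]
  reg_le := hs.reg_le
  arr_le := hs.arr_le

theorem Agree.setReg {d h x : ℕ} {m m' : State} (H : Agree d m m') (hh : d ≤ h) :
    Agree d m (m'.setReg (hd h) x) :=
  ⟨H.1, fun r hr => by simp [hr h hh, H.2 r hr]⟩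

theorem Sim.setReg {ρ : ℕ → ℕ} {base : ℕ} {s : Store} {m : State} (H : Sim ρ base s m) {x v : ℕ}
    (hv : v ≤ ρ 0) : Sim ρ base (s.setReg x v) (m.setReg (vr x) v) where
  var y := by simp [H.var]
  par y := by simp [H.par]
  radix := by simp [H.radix]
  region := by simp [H.region]
  one := by simp [H.one]
  mem := H.mem
  reg_le y := by
    have := H.reg_le y
    simp only [Store.setReg_reg]
    split_ifs <;> assumption
  arr_le := H.arr_le

/-! ### Correctness of the compiler. -/

section

variable {W : ℕ} {ρ : ℕ → ℕ} {base : ℕ}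

theorem Fits.mul_le (hF : Fits W ρ base) {a b : ℕ} (ha : a ≤ ρ 0 + 1) (hb : b ≤ ρ 0 + 1) :
    a * b ≤ W := by
  have h1 : a * b ≤ (ρ 0 + 1) * (ρ 0 + 1) := Nat.mul_le_mul ha hb
  have h2 : (ρ 0 + 1) * (ρ 0 + 1) ≤ (ρ 0 + 1) ^ 3 := by
    rw [← sq]; exact Nat.pow_le_pow_right (by omega) (by omega)
  have := hF.le_word
  omega

theorem Fits.two_mul_le (hF : Fits W ρ base) : 2 * ρ 0 + 16 ≤ W := by
  have := hF.le_word
  have h : (ρ 0 + 1) ^ 1 ≤ (ρ 0 + 1) ^ 3 := Nat.pow_le_pow_right (by omega) (by omega)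
  rw [pow_one] at h
  omega

theorem Fits.eval_le (hF : Fits W ρ base) (o : Op) {a b : ℕ} (ha : a ≤ ρ 0) (hb : b ≤ ρ 0) :
    o.eval a b ≤ W := by
  have h2 := hF.two_mul_le
  cases o with
  | add => simp only [Op.eval]; omega
  | sub => simp only [Op.eval]; omega
  | mul => exact hF.mul_le (by omega) (by omega)
  | div => exact (Nat.div_le_self a b).trans (by omega)
  | mod => exact (Nat.mod_le a b).trans (by omega)
  | lt => simp only [Op.eval]; split_ifs <;> omega
  | eq => simp only [Op.eval]; split_ifs <;> omega

/-- The machine clips after every operation, whereas `clip` only affects sums and products. The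
other operations never exceed their first operand or return at most 1, so clipping them changes
nothing. -/
theorem clip_eq_min (hF : Fits W ρ base) (o : Op) {a b : ℕ} (ha : a ≤ ρ 0) :
    clip ρ o (o.eval a b) = min (o.eval a b) (ρ 0) := by
  have := hF.eight_le
  cases o with
  | add => rfl
  | mul => rfl
  | sub => simp only [clip, Op.eval]; omega
  | div => exact (min_eq_left ((Nat.div_le_self a b).trans ha)).symm
  | mod => exact (min_eq_left ((Nat.mod_le a b).trans ha)).symm
  | lt => simp only [clip, Op.eval]; split_ifs <;> omega
  | eq => simp only [clip, Op.eval]; split_ifs <;> omega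

theorem Expr.val_le (hF : Fits W ρ base) {m : State} (e : Expr) {s : Store}
    (hs : Sim ρ base s m) : e.val ρ s ≤ ρ 0 := by
  cases e with
  | lit k => have := hF.eight_le; have := k.2; simp only [val]; omega
  | var x => exact hs.reg_le x
  | par k => exact hF.par_le k
  | op o a b => rw [val, clip_eq_min hF o (Expr.val_le hF a hs)]; exact min_le_right _ _
  | get k a b c => exact hs.arr_le _ _ _ _
  | sum x k e => exact min_le_right _ _

theorem Runs.clipProg (hF : Fits W ρ base) {d f : ℕ} {m : State} (hp : m.reg (pr 0) = ρ 0)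
    (hdf : d < f) : ∃ m', Runs W (clipProg (hd d) (hd f)) m 3 m' ∧
      m'.reg (hd d) = min (m.reg (hd d)) (ρ 0) ∧ Agree d m m' ∧
      ∀ h, h ≠ d → h ≠ f → m'.reg (hd h) = m.reg (hd h) := by
  have h8 := hF.eight_le
  have h2 := hF.two_mul_le
  by_cases h : ρ 0 < m.reg (hd d)
  · refine ⟨_, (Runs.op ?_).seq (Runs.ite (fun _ => Runs.copy) fun h0 => ?_), ?_, ?_, ?_⟩
    · simp only [Op.eval]; split_ifs <;> omega
    · simp [Op.eval, hp, h] at h0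
    · simp [hp, h.le]
    · exact ((Agree.refl d m).setReg hdf.le).setReg le_rfl
    · intro h h1 h2; simp [h1, h2]
  · refine ⟨_, (Runs.op ?_).seq (Runs.ite (fun h0 => ?_) fun _ => Runs.skip _), ?_, ?_, ?_⟩
    · simp only [Op.eval]; split_ifs <;> omega
    · simp [Op.eval, hp, h] at h0
    · simp [hdf.ne]; omega
    · exact ((Agree.refl d m).setReg hdf.le)
    · intro h h1 h2; simp [h2]

/-- Three indices up to `ρ 0` fill `(ρ 0 + 1) ^ 3` cells in each of 16 interleaved arrays; this is
where the cube in `Fits.le_word` comes from. -/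
theorem addr_le (hF : Fits W ρ base) (k : Fin 16) {i j l : ℕ} (hi : i ≤ ρ 0) (hj : j ≤ ρ 0)
    (hl : l ≤ ρ 0) : addr ρ base k i j l ≤ W := by
  have h1 : l * (ρ 0 + 1) + j + 1 ≤ (ρ 0 + 1) ^ 2 := by nlinarith
  have h2 : (l * (ρ 0 + 1) + j) * (ρ 0 + 1) + i + 1 ≤ (ρ 0 + 1) ^ 3 := by nlinarith
  have := hF.le_word
  have := k.2
  unfold addr
  omega

theorem Runs.addrProg (hF : Fits W ρ base) {d : ℕ} {k : Fin 16} {m : State}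
    (hD : m.reg (sp 0) = ρ 0 + 1) (hb : m.reg (sp 1) = base) {i j l : ℕ} (hi : i ≤ ρ 0)
    (hj : j ≤ ρ 0) (hl : l ≤ ρ 0) (hmi : m.reg (hd d) = i) (hmj : m.reg (hd (d + 1)) = j)
    (hml : m.reg (hd (d + 2)) = l) :
    ∃ m', Runs W (addrProg k d) m 9 m' ∧ m'.reg (hd (d + 2)) = addr ρ base k i j l ∧
      Agree d m m' ∧ ∀ h, h ≠ d → h ≠ d + 1 → h ≠ d + 2 → m'.reg (hd h) = m.reg (hd h) := by
  have hle := addr_le hF k hi hj hl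
  have hk := k.2
  have hW := hF.two_mul_le
  unfold addr at hle
  have h1 : l * (ρ 0 + 1) ≤ W := by nlinarith
  have h2 : l * (ρ 0 + 1) + j ≤ W := by nlinarith
  have h3 : (l * (ρ 0 + 1) + j) * (ρ 0 + 1) ≤ W := by omega
  refine ⟨_, (Runs.op ?_).seq <| (Runs.op ?_).seq <| (Runs.op ?_).seq <| (Runs.op ?_).seq <|
    (Runs.const ?_).seq <| (Runs.op ?_).seq <| (Runs.const ?_).seq <| (Runs.op ?_).seq <|
    Runs.op ?_, ?_, ?_, ?_⟩
  case refine_11 =>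
    exact ((((((((((Agree.refl d m).setReg (by omega)).setReg (by omega)).setReg
      (by omega)).setReg (by omega)).setReg (by omega)).setReg (by omega)).setReg
      (by omega)).setReg (by omega)).setReg (by omega))
  case refine_12 => intro h h1 h2 h3; simp [h2, h3]
  all_goals try simp [Op.eval, addr, hD, hb, hmi, hmj, hml]
  all_goals omega

/-- Operands are evaluated into increasing hidden registers, so results already obtained survive;
`Agree d` expresses exactly this. The delicate case is a sum: its code overwrites the machine copy
of the summation variable, although the evaluation of an expression must not change the store. The
old value is saved beforehand and restored at the end. -/
theorem Expr.compile_spec (hF : Fits W ρ base) (e : Expr) : ∀ (d : ℕ) (s : Store) (m : State),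
    Sim ρ base s m → ∃ m', Runs W (e.compile d) m (e.cost ρ) m' ∧ Agree d m m' ∧
      m'.reg (hd d) = e.val ρ s := by
  have h2 := hF.two_mul_le
  induction e with
  | lit k =>
    intro d s m _
    refine ⟨_, Runs.const ?_, (Agree.refl d m).setReg le_rfl, by simp [val]⟩
    have := k.2
    omega
  | var x =>
    intro d s m hs
    exact ⟨_, Runs.copy, (Agree.refl d m).setReg le_rfl, by simp [val, hs.var]⟩
  | par x =>
    intro d s m hs
    exact ⟨_, Runs.copy, (Agree.refl d m).setReg le_rfl, by simp [val, hs.par]⟩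
  | op o a b iha ihb =>
    intro d s m hs
    obtain ⟨m₁, r₁, a₁, v₁⟩ := iha d s m hs
    have hs₁ := a₁.sim hs
    obtain ⟨m₂, r₂, a₂, v₂⟩ := ihb (d + 1) s m₁ hs₁
    have hs₂ := a₂.sim hs₁
    have e₁ : m₂.reg (hd d) = a.val ρ s := by rw [a₂.hd_eq (by omega), v₁]
    have r₃ : Runs W (.op o (hd d) (hd d) (hd (d + 1))) m₂ 1
        (m₂.setReg (hd d) (o.eval (m₂.reg (hd d)) (m₂.reg (hd (d + 1))))) := by
      refine Runs.op (m := m₂) ?_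
      rw [e₁, v₂]
      exact hF.eval_le o (a.val_le hF hs) (b.val_le hF hs)
    rw [e₁, v₂] at r₃
    have a₃ := (Agree.refl d m₂).setReg (x := o.eval (a.val ρ s) (b.val ρ s)) le_rfl
    obtain ⟨m₄, r₄, v₄, a₄, -⟩ := Runs.clipProg hF (d := d) (f := d + 1) (a₃.sim hs₂ |>.par 0)
      (by omega)
    refine ⟨m₄, (r₁.seq <| r₂.seq <| r₃.seq r₄).mono (by simp only [cost]; omega), ?_, ?_⟩
    · exact ((a₁.trans a₂ (by omega)).trans a₃ le_rfl).trans a₄ le_rfl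
    · rw [v₄, val, clip_eq_min hF o (a.val_le hF hs)]
      simp
  | get k a b c iha ihb ihc =>
    intro d s m hs
    obtain ⟨m₁, r₁, a₁, v₁⟩ := iha d s m hs
    have hs₁ := a₁.sim hs
    obtain ⟨m₂, r₂, a₂, v₂⟩ := ihb (d + 1) s m₁ hs₁
    have hs₂ := a₂.sim hs₁
    obtain ⟨m₃, r₃, a₃, v₃⟩ := ihc (d + 2) s m₂ hs₂
    have hs₃ := a₃.sim hs₂
    obtain ⟨m₄, r₄, v₄, a₄, -⟩ := Runs.addrProg hF (d := d) (k := k) hs₃.radix hs₃.region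
      (a.val_le hF hs) (b.val_le hF hs) (c.val_le hF hs)
      (by rw [a₃.hd_eq (by omega), a₂.hd_eq (by omega), v₁])
      (by rw [a₃.hd_eq (by omega), v₂]) v₃
    have a₅ := ((a₁.trans a₂ (by omega)).trans a₃ (by omega)).trans a₄ le_rfl
    have hs₄ := a₅.sim hs
    refine ⟨_, (r₁.seq <| r₂.seq <| r₃.seq <| r₄.seq Runs.load).mono (by simp only [cost]; omega),
      a₅.setReg le_rfl, ?_⟩
    simp [v₄, val, hs₄.mem _ _ _ _ (a.val_le hF hs) (b.val_le hF hs) (c.val_le hF hs)]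
  | sum x k e ih =>
    intro d s m hs
    set m₃ := ((m.setReg (hd d) 0).setReg (hd (d + 1)) (s.reg x)).setReg (hd (d + 2)) (ρ k) with hm₃
    have r₃ : Runs W (.const (hd d) 0) m 1 (m.setReg (hd d) 0) := Runs.const (by omega)
    have r₄ : Runs W (.copy (hd (d + 1)) (vr x)) (m.setReg (hd d) 0) 1
      ((m.setReg (hd d) 0).setReg (hd (d + 1)) (s.reg x)) := by
      convert Runs.copy using 2; simp [hs.var]
    have r₅ : Runs W (.copy (hd (d + 2)) (pr k)) ((m.setReg (hd d) 0).setReg (hd (d + 1)) (s.reg x))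
      1 m₃ := by
      rw [hm₃]; convert Runs.copy using 2; simp [hs.par]
    obtain ⟨m₆, r₆, i₆⟩ := Runs.loop (W := W) (r := hd (d + 2)) (B := e.cost ρ + 6)
      (p := .seq (.op .sub (vr x) (pr k) (hd (d + 2))) <| .seq (e.compile (d + 3)) <|
        .seq (.op .add (hd d) (hd d) (hd (d + 3))) <| .seq (clipProg (hd d) (hd (d + 3))) <|
        .op .sub (hd (d + 2)) (hd (d + 2)) (sp 2))
      -- The counter `q` runs down, so `ρ k - q` terms have been added. The summation variable holds
      -- some value `v` left by the previous round, hence the simulation is only claimed for the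
      -- store modified at `x`. Clipping each partial sum yields the clipped total.
      (fun q m' => m'.reg (hd (d + 2)) = q ∧ q ≤ ρ k ∧ (∃ v, v ≤ ρ 0 ∧ Sim ρ base (s.setReg x v) m')
        ∧ m'.reg (hd d) = min (∑ t ∈ Finset.range (ρ k - q), e.val ρ (s.setReg x t)) (ρ 0) ∧
        m'.reg (hd (d + 1)) = s.reg x ∧ m'.mem = m.mem ∧
        ∀ r, r ≠ vr x → (∀ h, d ≤ h → r ≠ hd h) → m'.reg r = m.reg r)
      (fun _ _ h => h.1) (by
        rintro q m' ⟨hq, hqk, ⟨v, hv, hsv⟩, hacc, hsave, hmem, hreg⟩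
        have hk := hF.par_le k
        have s₁ : Sim ρ base (s.setReg x (ρ k - (q + 1))) (m'.setReg (vr x) (ρ k - (q + 1))) := by
          have := hsv.setReg (x := x) (v := ρ k - (q + 1)) (by omega)
          convert this using 1
          ext y
          · simp; split_ifs <;> rfl
          · rfl
        have q₁ : Runs W (.op .sub (vr x) (pr k) (hd (d + 2))) m' 1
            (m'.setReg (vr x) (ρ k - (q + 1))) := by
          convert Runs.op (o := .sub) ?_ using 2
          · simp [Op.eval, hsv.par, hq]
          · simp only [Op.eval, hsv.par]; omega
        obtain ⟨m₂, q₂, a₂, v₂⟩ := ih (d + 3) _ _ s₁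
        have hle := e.val_le hF s₁
        have b₁ : m₂.reg (hd d) =
            min (∑ t ∈ Finset.range (ρ k - (q + 1)), e.val ρ (s.setReg x t)) (ρ 0) := by
          rw [a₂.hd_eq (by omega)]; simp [hacc]
        have q₃ : Runs W (.op .add (hd d) (hd d) (hd (d + 3))) m₂ 1
            (m₂.setReg (hd d) (Op.add.eval (m₂.reg (hd d)) (m₂.reg (hd (d + 3))))) := by
          refine Runs.op (m := m₂) ?_
          rw [b₁, v₂]
          exact hF.eval_le .add (min_le_right _ _) hle
        have a₃ := (Agree.refl d m₂).setReg
          (x := Op.add.eval (m₂.reg (hd d)) (m₂.reg (hd (d + 3)))) le_rfl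
        obtain ⟨m₄, q₄, v₄, a₄, f₄⟩ := Runs.clipProg hF (d := d) (f := d + 3)
          (a₃.sim (a₂.sim s₁) |>.par 0) (by omega)
        have s₄ := a₄.sim (a₃.sim (a₂.sim s₁))
        have c₄ : m₄.reg (hd (d + 2)) = q + 1 := by
          rw [f₄ _ (by omega) (by omega)]
          simp [a₂.hd_eq (show d + 2 < d + 3 by omega), hq]
        have q₅ : Runs W (.op .sub (hd (d + 2)) (hd (d + 2)) (sp 2)) m₄ 1
            (m₄.setReg (hd (d + 2)) q) := by
          convert Runs.op (o := .sub) ?_ using 2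
          · simp [Op.eval, c₄, s₄.one]
          · simp only [Op.eval, c₄]; omega
        have a₅ := (Agree.refl d m₄).setReg (h := d + 2) (x := q) (by omega)
        refine ⟨_, (q₁.seq <| q₂.seq <| q₃.seq <| q₄.seq q₅).mono (by omega), by simp, by omega,
          ⟨_, by omega, a₅.sim s₄⟩, ?_, ?_, ?_, ?_⟩
        · rw [show ρ k - q = (ρ k - (q + 1)) + 1 by omega, Finset.sum_range_succ]
          have : m₄.reg (hd d) = _ := v₄
          simp only [State.setReg_reg, hd_inj, if_true, Op.eval, b₁, v₂] at this ⊢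
          rw [if_neg (by omega), this]
          omega
        · have e₁ : m₄.reg (hd (d + 1)) = _ := f₄ _ (by omega) (by omega)
          simp [e₁, a₂.hd_eq (show d + 1 < d + 3 by omega), hsave]
        · rw [a₅.1, a₄.1, a₃.1, a₂.1]; exact hmem
        · intro r hr hr'
          rw [a₅.2 r hr', a₄.2 r hr', a₃.2 r hr', a₂.2 r fun h hh => hr' h (by omega)]
          simp [hr, hreg r hr hr'])
      (ρ k) m₃ (by
        have a₃ : Agree d m m₃ := (((Agree.refl d m).setReg (by omega)).setReg (by omega)).setReg
          (by omega)
        refine ⟨by simp [hm₃], le_rfl, ⟨s.reg x, hs.reg_le x, ?_⟩, by simp [hm₃], by simp [hm₃],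
          a₃.1, fun r _ hr => a₃.2 r hr⟩
        have : s.setReg x (s.reg x) = s := by
          ext y
          · simp only [Store.setReg_reg]
            split_ifs with h
            · rw [h]
            · rfl
          · rfl
        rw [this]
        exact a₃.sim hs)
    obtain ⟨-, -, -, hacc, hsave, hmem, hreg⟩ := i₆
    refine ⟨_, (r₃.seq <| r₄.seq <| r₅.seq <| r₆.seq Runs.copy).mono ?_, ⟨hmem, ?_⟩, ?_⟩
    · simp only [cost, Nat.mul_add]; omega
    · intro r hr
      simp only [State.setReg_reg]
      split_ifs with h
      · rw [hsave, h, hs.var]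
      · exact hreg r h hr
    · simp [hacc, val]

theorem Sim.setArr {s : Store} {m : State} (H : Sim ρ base s m) {k : Fin 16}
    {i j l v : ℕ} (hi : i ≤ ρ 0) (hj : j ≤ ρ 0) (hv : v ≤ ρ 0) :
    Sim ρ base (s.setArr k i j l v) (m.setMem (addr ρ base k i j l) v) where
  var y := by simp [H.var]
  par y := by simp [H.par]
  radix := by simp [H.radix]
  region := by simp [H.region]
  one := by simp [H.one]
  mem k' i' j' l' hi' hj' hl' := by
    simp only [State.setMem_mem, addr_inj hi' hj' hi hj, Store.setArr_arr,
      H.mem k' i' j' l' hi' hj' hl']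
  reg_le := H.reg_le
  arr_le k' i' j' l' := by
    have := H.arr_le k' i' j' l'
    simp only [Store.setArr_arr]
    split_ifs <;> assumption

/-- The last conjunct protects loop counters: the counter of a loop stands in the hidden register
`d`, and the body is compiled with `d + 1`. -/
theorem Cmd.compile_spec (hF : Fits W ρ base) (p : Cmd) : ∀ (d : ℕ) (s : Store) (m : State),
    Sim ρ base s m → ∃ m', Runs W (p.compile d) m (p.cost ρ) m' ∧ Sim ρ base (p.eval ρ s) m' ∧
      ∀ h < d, m'.reg (hd h) = m.reg (hd h) := by
  have h2 := hF.two_mul_le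
  induction p with
  | skip => exact fun d s m hs => ⟨m, Runs.skip m, hs, fun _ _ => rfl⟩
  | set x e =>
    intro d s m hs
    obtain ⟨m₁, r₁, a₁, v₁⟩ := e.compile_spec hF d s m hs
    refine ⟨_, r₁.seq Runs.copy, ?_, ?_⟩
    · rw [v₁]; exact (a₁.sim hs).setReg (e.val_le hF hs)
    · intro h hh; simp [a₁.hd_eq hh]
  | put k a b c e =>
    intro d s m hs
    obtain ⟨m₁, r₁, a₁, v₁⟩ := a.compile_spec hF d s m hs
    have hs₁ := a₁.sim hs
    obtain ⟨m₂, r₂, a₂, v₂⟩ := b.compile_spec hF (d + 1) s m₁ hs₁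
    have hs₂ := a₂.sim hs₁
    obtain ⟨m₃, r₃, a₃, v₃⟩ := c.compile_spec hF (d + 2) s m₂ hs₂
    have hs₃ := a₃.sim hs₂
    obtain ⟨m₄, r₄, a₄, v₄⟩ := e.compile_spec hF (d + 3) s m₃ hs₃
    have hs₄ := a₄.sim hs₃
    obtain ⟨m₅, r₅, v₅, a₅, f₅⟩ := Runs.addrProg hF (d := d) (k := k) hs₄.radix hs₄.region
      (a.val_le hF hs) (b.val_le hF hs) (c.val_le hF hs)
      (by rw [a₄.hd_eq (by omega), a₃.hd_eq (by omega), a₂.hd_eq (by omega), v₁])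
      (by rw [a₄.hd_eq (by omega), a₃.hd_eq (by omega), v₂]) (by rw [a₄.hd_eq (by omega), v₃])
    have e₅ : m₅.reg (hd (d + 3)) = e.val ρ s := by
      rw [f₅ _ (by omega) (by omega) (by omega), v₄]
    refine ⟨_, (r₁.seq <| r₂.seq <| r₃.seq <| r₄.seq <| r₅.seq Runs.store).mono
      (by simp only [cost]; omega), ?_, ?_⟩
    · rw [v₅, e₅]
      exact (a₅.sim hs₄).setArr (a.val_le hF hs) (b.val_le hF hs) (e.val_le hF hs)
    · intro h hh
      rw [State.setMem_reg, a₅.hd_eq hh, a₄.hd_eq (by omega), a₃.hd_eq (by omega),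
        a₂.hd_eq (by omega), a₁.hd_eq hh]
  | seq p q ihp ihq =>
    intro d s m hs
    obtain ⟨m₁, r₁, s₁, f₁⟩ := ihp d s m hs
    obtain ⟨m₂, r₂, s₂, f₂⟩ := ihq d _ m₁ s₁
    exact ⟨m₂, r₁.seq r₂, s₂, fun h hh => (f₂ h hh).trans (f₁ h hh)⟩
  | ite e p q ihp ihq =>
    intro d s m hs
    obtain ⟨m₁, r₁, a₁, v₁⟩ := e.compile_spec hF d s m hs
    by_cases hv : e.val ρ s = 0
    · obtain ⟨m₂, r₂, s₂, f₂⟩ := ihq d s m₁ (a₁.sim hs)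
      refine ⟨m₂, (r₁.seq (Runs.ite (fun h => absurd (v₁.trans hv) h) fun _ => r₂)).mono ?_, ?_,
        fun h hh => (f₂ h hh).trans (a₁.hd_eq hh)⟩
      · simp only [cost]; omega
      · simpa [eval, hv] using s₂
    · obtain ⟨m₂, r₂, s₂, f₂⟩ := ihp d s m₁ (a₁.sim hs)
      refine ⟨m₂, (r₁.seq (Runs.ite (fun _ => r₂) fun h => absurd (v₁.symm.trans h) hv)).mono ?_,
        ?_, fun h hh => (f₂ h hh).trans (a₁.hd_eq hh)⟩
      · simp only [cost]; omega
      · simpa [eval, hv] using s₂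
  | forLt x k p ih =>
    intro d s m hs
    obtain ⟨m₁, r₁, i₁⟩ := Runs.loop (W := W) (r := hd d) (B := p.cost ρ + 2)
      (p := .seq (.op .sub (vr x) (pr k) (hd d)) <| .seq (p.compile (d + 1)) <|
        .op .sub (hd d) (hd d) (sp 2))
      (fun q m' => m'.reg (hd d) = q ∧ q ≤ ρ k ∧
        Sim ρ base (iter (fun t s => p.eval ρ (s.setReg x t)) (ρ k - q) s) m' ∧
        ∀ h < d, m'.reg (hd h) = m.reg (hd h))
      (fun _ _ h => h.1) (by
        rintro q m' ⟨hq, hqk, hs', hreg⟩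
        have hk := hF.par_le k
        have s₁ := hs'.setReg (x := x) (v := ρ k - (q + 1)) (by omega)
        have q₁ : Runs W (.op .sub (vr x) (pr k) (hd d)) m' 1
            (m'.setReg (vr x) (ρ k - (q + 1))) := by
          convert Runs.op (o := .sub) ?_ using 2
          · simp [Op.eval, hs'.par, hq]
          · simp only [Op.eval, hs'.par]; omega
        obtain ⟨m₂, q₂, s₂, f₂⟩ := ih (d + 1) _ _ s₁
        have c₂ : m₂.reg (hd d) = q + 1 := by rw [f₂ d (by omega)]; simp [hq]
        have q₃ : Runs W (.op .sub (hd d) (hd d) (sp 2)) m₂ 1 (m₂.setReg (hd d) q) := by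
          convert Runs.op (o := .sub) ?_ using 2
          · simp [Op.eval, c₂, s₂.one]
          · simp only [Op.eval, c₂]; omega
        have a₃ := (Agree.refl d m₂).setReg (h := d) (x := q) (by omega)
        refine ⟨_, (q₁.seq <| q₂.seq q₃).mono (by omega), by simp, by omega, ?_, ?_⟩
        · rw [show ρ k - q = (ρ k - (q + 1)) + 1 by omega]
          exact a₃.sim s₂
        · intro h hh
          rw [a₃.hd_eq hh, f₂ h (by omega)]
          simp [hreg h hh])
      (ρ k) (m.setReg (hd d) (ρ k)) ⟨by simp, le_rfl, by
        simpa [iter] using ((Agree.refl d m).setReg (h := d) (x := ρ k) le_rfl).sim hs,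
        fun h hh => by simp [hh.ne]⟩
    obtain ⟨-, -, s₁, f₁⟩ := i₁
    have r₀ : Runs W (.copy (hd d) (pr k)) m 1 (m.setReg (hd d) (ρ k)) := by
      convert Runs.copy using 2; simp [hs.par]
    refine ⟨m₁, (r₀.seq r₁).mono ?_, by simpa [eval] using s₁, f₁⟩
    simp only [cost, Nat.mul_add]; omega

end

end SafeSet.RAM

/-! ### Monochromatic components and their types under relabelling, joining and disjoint union. -/

namespace SafeSet

/-! ## Coloured graphs -/

/-- A labelled graph with vertices of colour `2` (inside of a set), `1` (outside of the set) and
`0` (absent). -/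
structure Colored (V : Type*) where
  col : V → ℕ
  lab : V → ℕ
  adj : V → V → Prop

namespace Colored

variable {V : Type*}

/-- Adjacency of present vertices of the same colour. -/
def Mono (X : Colored V) (u v : V) : Prop := X.adj u v ∧ X.col u = X.col v ∧ X.col u ≠ 0

/-- `v` is in the monochromatic component of `u`. -/
def Reach (X : Colored V) : V → V → Prop := Relation.ReflTransGen X.Mono

theorem Reach.col_eq {X : Colored V} {u v : V} (h : X.Reach u v) : X.col v = X.col u := by
  induction h with
  | refl => rfl
  | tail _ h ih => rw [← h.2.1, ih]

theorem Reach.symm {X : Colored V} (hX : ∀ u v, X.adj u v → X.adj v u) {u v : V}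
    (h : X.Reach u v) : X.Reach v u := by
  induction h with
  | refl => exact .refl
  | tail _ h ih => exact .head ⟨hX _ _ h.1, h.2.1.symm, h.2.1 ▸ h.2.2⟩ ih

/-- The coloured graph after all edges between vertices with labels `i` and `j` have been added. -/
def join (X : Colored V) (i j : ℕ) : Colored V :=
  { X with adj := fun u v => X.adj u v ∨ (X.lab u = i ∧ X.lab v = j) ∨ (X.lab u = j ∧ X.lab v = i) }

theorem reach_join_of_reach {X : Colored V} {i j : ℕ} {u v : V} (h : X.Reach u v) :
    (X.join i j).Reach u v := by
  induction h with
  | refl => exact .refl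
  | tail _ h ih => exact ih.tail ⟨.inl h.1, h.2⟩

/-- The two coloured graphs agree as far as present vertices are concerned. -/
structure Same (X Y : Colored V) : Prop where
  col : X.col = Y.col
  lab : ∀ u, X.col u ≠ 0 → X.lab u = Y.lab u
  adj : ∀ u v, X.col u ≠ 0 → X.col v ≠ 0 → (X.adj u v ↔ Y.adj u v)

theorem Same.symm {X Y : Colored V} (h : Same X Y) : Same Y X where
  col := h.col.symm
  lab u hu := (h.lab u (h.col ▸ hu)).symm
  adj u v hu hv := (h.adj u v (h.col ▸ hu) (h.col ▸ hv)).symm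

/-- `X` is the disjoint union of `X₁` and `X₂`. -/
structure IsUnion (X₁ X₂ X : Colored V) : Prop where
  col : ∀ u, X.col u = X₁.col u + X₂.col u
  disj : ∀ u, X₁.col u = 0 ∨ X₂.col u = 0
  lab₁ : ∀ u, X₁.col u ≠ 0 → X.lab u = X₁.lab u
  lab₂ : ∀ u, X₂.col u ≠ 0 → X.lab u = X₂.lab u
  adj₁ : ∀ u v, X₁.col u ≠ 0 → X₁.col v ≠ 0 → (X.adj u v ↔ X₁.adj u v)
  adj₂ : ∀ u v, X₂.col u ≠ 0 → X₂.col v ≠ 0 → (X.adj u v ↔ X₂.adj u v)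
  not_adj : ∀ u v, X₁.col u ≠ 0 → X₂.col v ≠ 0 → ¬ X.adj u v ∧ ¬ X.adj v u

namespace IsUnion

variable {X₁ X₂ X : Colored V}

theorem swap (h : IsUnion X₁ X₂ X) : IsUnion X₂ X₁ X where
  col u := by rw [h.col, add_comm]
  disj u := (h.disj u).symm
  lab₁ := h.lab₂
  lab₂ := h.lab₁
  adj₁ := h.adj₂
  adj₂ := h.adj₁
  not_adj u v hu hv := (h.not_adj v u hv hu).symm

theorem col_left (h : IsUnion X₁ X₂ X) {u : V} (hu : X₁.col u ≠ 0) : X.col u = X₁.col u := by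
  rw [h.col]
  have := h.disj u
  omega

end IsUnion

variable [Fintype V]

open Classical in
/-- The monochromatic component of a vertex. -/
noncomputable def comp (X : Colored V) (u : V) : Finset V := {v | X.Reach u v}

@[simp] theorem mem_comp {X : Colored V} {u v : V} : v ∈ X.comp u ↔ X.Reach u v := by simp [comp]

theorem comp_eq {X : Colored V} (hX : ∀ u v, X.adj u v → X.adj v u) {u v : V}
    (h : X.Reach u v) : X.comp u = X.comp v := by
  ext w
  rw [mem_comp, mem_comp]
  exact ⟨(h.symm hX).trans, h.trans⟩

/-- The size of the component of a vertex. -/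
noncomputable def size (X : Colored V) (u : V) : ℕ := (X.comp u).card

/-- The labels in the component of a vertex. -/
noncomputable def labels (X : Colored V) (u : V) : Finset ℕ := (X.comp u).image X.lab

theorem mem_labels {X : Colored V} {u : V} {l : ℕ} :
    l ∈ X.labels u ↔ ∃ v, X.Reach u v ∧ X.lab v = l := by simp [labels]

/-- The type of the component of a vertex: its colour and its labels. -/
noncomputable def type (X : Colored V) (u : V) : ℕ × Finset ℕ := (X.col u, X.labels u)

theorem size_le (X : Colored V) (u : V) : X.size u ≤ Fintype.card V := Finset.card_le_univ _

theorem size_pos (X : Colored V) (u : V) : 0 < X.size u :=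
  Finset.card_pos.mpr ⟨u, mem_comp.mpr .refl⟩

theorem type_eq {X : Colored V} (hX : ∀ u v, X.adj u v → X.adj v u) {u v : V}
    (h : X.Reach u v) : X.type u = X.type v := by
  simp only [type, labels, comp_eq hX h, h.col_eq]

/-- The size promised by `φ` for the component of a vertex; the actual size if nothing is
promised. -/
noncomputable def promised (φ : ℕ × Finset ℕ → ℕ) (X : Colored V) (u : V) : ℕ :=
  if φ (X.type u) = 0 then X.size u else φ (X.type u)

theorem promised_eq {X : Colored V} (hX : ∀ u v, X.adj u v → X.adj v u) {u v : V}
    (φ : ℕ × Finset ℕ → ℕ) (h : X.Reach u v) : X.promised φ u = X.promised φ v := by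
  simp only [promised, type_eq hX h, size, comp_eq hX h]

/-- Inner components are at least as large as adjacent outer components, and all components respect
the thresholds `θ`, where sizes are as promised by `φ`. -/
structure Ok (φ θ : ℕ × Finset ℕ → ℕ) (X : Colored V) : Prop where
  cross : ∀ u v, X.adj u v → X.col u = 2 → X.col v = 1 → X.promised φ v ≤ X.promised φ u
  inner : ∀ u, X.col u = 2 → θ (X.type u) ≤ X.promised φ u
  outer : ∀ u, X.col u = 1 → X.promised φ u ≤ θ (X.type u)

open Classical in
/-- The number of present vertices in components of a given type. -/
noncomputable def total (X : Colored V) (τ : ℕ × Finset ℕ) : ℕ :=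
  Finset.card {u | X.col u ≠ 0 ∧ X.type u = τ}

-- Partitioning the present vertices according to types shows that any count depending on types
-- alone is a sum of totals.
open Classical in
theorem card_eq_of_total_eq {X X' : Colored V} (h : ∀ τ, X.total τ = X'.total τ)
    (P : ℕ × Finset ℕ → Prop) :
    Finset.card {u | X.col u ≠ 0 ∧ P (X.type u)} = Finset.card {u | X'.col u ≠ 0 ∧ P (X'.type u)} :=
      by
  have key : ∀ Y : Colored V, ∀ I : Finset (ℕ × Finset ℕ), Finset.univ.image Y.type ⊆ I →
      Finset.card {u | Y.col u ≠ 0 ∧ P (Y.type u)} = ∑ τ ∈ I, if P τ then Y.total τ else 0 := by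
    intro Y I hI
    rw [Finset.card_eq_sum_card_fiberwise (f := Y.type) (t := I)]
    · refine Finset.sum_congr rfl fun τ _ => ?_
      split_ifs with hP
      · rw [total, Finset.filter_filter]
        congr 1
        ext u
        simp only [Finset.mem_filter, Finset.mem_univ, true_and]
        constructor
        · rintro ⟨⟨h1, -⟩, h2⟩; exact ⟨h1, h2⟩
        · rintro ⟨h1, h2⟩; exact ⟨⟨h1, h2 ▸ hP⟩, h2⟩
      · rw [Finset.card_eq_zero, Finset.filter_eq_empty_iff]
        intro u hu h
        exact hP (h ▸ (Finset.mem_filter.mp hu).2.2)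
    · intro u _
      exact hI (Finset.mem_image_of_mem _ (Finset.mem_univ u))
  rw [key X _ Finset.subset_union_left, key X' _ Finset.subset_union_right]
  exact Finset.sum_congr rfl fun τ _ => by rw [h]

/-- A type is realised by a present vertex exactly when its total is positive, so equal totals mean
equal sets of realised types. -/
theorem exists_of_total_eq {X X' : Colored V} (h : ∀ τ, X.total τ = X'.total τ) {u' : V}
    (hu' : X'.col u' ≠ 0) : ∃ u, X.col u ≠ 0 ∧ X.type u = X'.type u' := by
  classical
  have : 0 < X.total (X'.type u') := by
    rw [h, total, Finset.card_pos]
    exact ⟨u', by simp [hu']⟩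
  rw [total, Finset.card_pos] at this
  obtain ⟨u, hu⟩ := this
  exact ⟨u, by simpa using hu⟩

/-- How a node of an expression acts on the components: a component of type `τ` gets the type
`μ τ`, and if `M τ ≠ 0`, it becomes a part of a component of size `M τ`. -/
structure Step (μ : ℕ × Finset ℕ → ℕ × Finset ℕ) (M : ℕ × Finset ℕ → ℕ) (X Y : Colored V) :
    Prop where
  col : Y.col = X.col
  type : ∀ u, X.col u ≠ 0 → Y.type u = μ (X.type u)
  size : ∀ u, X.col u ≠ 0 → Y.size u = if M (X.type u) = 0 then X.size u else M (X.type u)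
  adj : ∀ u v, X.adj u v → Y.adj u v

/-- The promises before a step that correspond to the promises `φ` after it. -/
def pullback (μ : ℕ × Finset ℕ → ℕ × Finset ℕ) (M φ : ℕ × Finset ℕ → ℕ) (τ : ℕ × Finset ℕ) : ℕ :=
  if φ (μ τ) = 0 then M τ else φ (μ τ)

/-- The size that counts after the step is a promise made there, or else the size of the merged
component, or else the unchanged size. `pullback` turns the first two cases into promises for the
time before the step, and the third into the absence of a promise. -/
theorem Step.promised {μ : ℕ × Finset ℕ → ℕ × Finset ℕ} {M : ℕ × Finset ℕ → ℕ} {X Y : Colored V}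
    (h : Step μ M X Y) (φ : ℕ × Finset ℕ → ℕ) {u : V} (hu : X.col u ≠ 0) :
    X.promised (pullback μ M φ) u = Y.promised φ u := by
  unfold Colored.promised pullback
  rw [h.type u hu, h.size u hu]
  split_ifs <;> rfl

theorem promised_le {φ : ℕ × Finset ℕ → ℕ} (hφ : ∀ τ, φ τ ≤ Fintype.card V) (X : Colored V)
    (u : V) : X.promised φ u ≤ Fintype.card V := by
  unfold promised
  split_ifs
  · exact X.size_le u
  · exact hφ _

/-- Sets that agree before a step with respect to suitable promises and thresholds agree after
it. -/
theorem Ok.step {μ : ℕ × Finset ℕ → ℕ × Finset ℕ} {M : ℕ × Finset ℕ → ℕ} {X Y : Colored V}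
    (h : Step μ M X Y) (hX : ∀ u v, X.adj u v → X.adj v u)
    {φ θ : ℕ × Finset ℕ → ℕ} (hφ : ∀ τ, φ τ ≤ Fintype.card V)
    (hM : ∀ τ, M τ ≤ Fintype.card V) (hok : Y.Ok φ θ) :
    ∃ φ' θ' : ℕ × Finset ℕ → ℕ, (∀ τ, φ' τ ≤ Fintype.card V) ∧ (∀ τ, θ' τ ≤ Fintype.card V) ∧
      X.Ok φ' θ' ∧ ∀ X' Y' : Colored V, Step μ M X' Y' → (∀ τ, X.total τ = X'.total τ) →
        (∀ u' v', Y'.adj u' v' → X'.col u' = 2 → X'.col v' = 1 → X'.adj u' v' ∨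
          ∀ u v, X.type u = X'.type u' → X.type v = X'.type v' →
            ∃ u₁ v₁, X.Reach u u₁ ∧ X.Reach v v₁ ∧ Y.adj u₁ v₁) →
        X'.Ok φ' θ' → Y'.Ok φ θ := by
  classical
  set φ' := pullback μ M φ with hφ'
  have hb : ∀ τ, φ' τ ≤ Fintype.card V := fun τ => by
    rw [hφ', pullback]; split_ifs; exacts [hM _, hφ _]
  -- The threshold of an inner type is the smallest promised size among its components, that of any
  -- other type the largest. It is attained at a vertex `w` of `X`, which later stands for the whole
  -- type. Types that are not realised get the irrelevant value 0.
  have hex : ∀ τ, ∃ x ≤ Fintype.card V, (∃ u, X.type u = τ) → ∃ w, X.type w = τ ∧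
      X.promised φ' w = x ∧ ∀ u, X.type u = τ →
        (τ.1 = 2 → x ≤ X.promised φ' u) ∧ (τ.1 = 1 → X.promised φ' u ≤ x) := by
    intro τ
    by_cases hne : (Finset.univ.filter fun u => X.type u = τ).Nonempty
    · by_cases hτ : τ.1 = 2
      · obtain ⟨w, hw, hmin⟩ := Finset.exists_min_image _ (X.promised φ') hne
        exact ⟨_, promised_le hb X w, fun _ => ⟨w, by simpa using hw, rfl,
          fun u hu => ⟨fun _ => hmin u (by simpa using hu), fun h => by omega⟩⟩⟩
      · obtain ⟨w, hw, hmax⟩ := Finset.exists_max_image _ (X.promised φ') hne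
        exact ⟨_, promised_le hb X w, fun _ => ⟨w, by simpa using hw, rfl,
          fun u hu => ⟨fun h => absurd h hτ, fun _ => hmax u (by simpa using hu)⟩⟩⟩
    · exact ⟨0, Nat.zero_le _, fun ⟨u, hu⟩ => absurd ⟨u, by simpa using hu⟩ hne⟩
  choose θ' hθ' hwu using hex
  have hprom : ∀ u, X.col u ≠ 0 → X.promised φ' u = Y.promised φ u := fun u hu => h.promised φ hu
  refine ⟨φ', θ', hb, hθ', ⟨?_, ?_, ?_⟩, ?_⟩
  · intro u v huv hu hv
    rw [hprom u (by omega), hprom v (by omega)]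
    exact hok.cross u v (h.adj u v huv) (by rwa [h.col]) (by rwa [h.col])
  · intro u hu
    obtain ⟨w, -, -, hw⟩ := hwu _ ⟨u, rfl⟩
    exact (hw u rfl).1 hu
  · intro u hu
    obtain ⟨w, -, -, hw⟩ := hwu _ ⟨u, rfl⟩
    exact (hw u rfl).2 hu
  · intro X' Y' h' htot hadj hok'
    have hprom' : ∀ u, X'.col u ≠ 0 → X'.promised φ' u = Y'.promised φ u :=
      fun u hu => h'.promised φ hu
    -- A type present in `X'` is present in `X` because the totals agree, so its threshold is the
    -- size counted in `Y` at some vertex of `X`.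
    have rep : ∀ u', X'.col u' ≠ 0 → ∃ w, X.col w = X'.col u' ∧ X.type w = X'.type u' ∧
        θ' (X'.type u') = Y.promised φ w := fun u' hu' => by
      obtain ⟨u, -, hu⟩ := exists_of_total_eq htot hu'
      obtain ⟨w, hw, hx, -⟩ := hwu _ ⟨u, hu⟩
      have hc : X.col w = X'.col u' := congrArg Prod.fst hw
      exact ⟨w, hc, hw, by rw [← hx, hprom w (by omega)]⟩
    refine ⟨?_, ?_, ?_⟩
    · intro u' v' huv hu hv
      rw [h'.col] at hu hv
      rw [← hprom' u' (by omega), ← hprom' v' (by omega)]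
      rcases hadj u' v' huv hu hv with hx | hx
      · exact hok'.cross u' v' hx hu hv
      -- A new edge also joins the extremal components of the same two types in `Y`. Hence the size
      -- at `u'` is at least the smallest inner size of its type, which is at least the largest
      -- outer size of the type of `v'`, which is at least the size at `v'`.
      · obtain ⟨u, cu, tu, pu⟩ := rep u' (by omega)
        obtain ⟨v, cv, tv, pv⟩ := rep v' (by omega)
        obtain ⟨u₁, v₁, hu₁, hv₁, huv₁⟩ := hx _ _ tu tv
        have h1 := hok'.inner u' hu
        have h2 := hok'.outer v' hv
        rw [pu, ← hprom u (by omega), promised_eq hX φ' hu₁,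
          hprom u₁ (by rw [hu₁.col_eq]; omega)] at h1
        rw [pv, ← hprom v (by omega), promised_eq hX φ' hv₁,
          hprom v₁ (by rw [hv₁.col_eq]; omega)] at h2
        have := hok.cross u₁ v₁ huv₁ (by rw [h.col, hu₁.col_eq]; omega)
          (by rw [h.col, hv₁.col_eq]; omega)
        omega
    · intro u' hu
      rw [h'.col] at hu
      obtain ⟨w, cw, tw, pw⟩ := rep u' (by omega)
      have h1 := hok'.inner u' hu
      have h2 := hok.inner w (by rw [h.col]; omega)
      rw [h.type _ (by omega), tw] at h2
      rw [← hprom' u' (by omega), h'.type _ (by omega)]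
      omega
    · intro u' hu
      rw [h'.col] at hu
      obtain ⟨w, cw, tw, pw⟩ := rep u' (by omega)
      have h1 := hok'.outer u' hu
      have h2 := hok.outer w (by rw [h.col]; omega)
      rw [h.type _ (by omega), tw] at h2
      rw [← hprom' u' (by omega), h'.type _ (by omega)]
      omega

/-! ### Relabelling -/

/-- The coloured graph after all labels `i` have been changed to `j`. -/
def relabel (X : Colored V) (i j : ℕ) : Colored V :=
  { X with lab := fun v => if X.lab v = i then j else X.lab v }

theorem step_relabel (X : Colored V) (i j : ℕ) :
    Step (fun τ => (τ.1, τ.2.image fun l => if l = i then j else l)) (fun _ => 0) X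
      (X.relabel i j) where
  col := rfl
  type u _ := by
    simp only [Colored.type, labels, Finset.image_image]
    rfl
  size u _ := rfl
  adj _ _ h := h

/-- The new totals are the push-forward of the old ones along `μ`. -/
theorem total_of_step {μ : ℕ × Finset ℕ → ℕ × Finset ℕ} {M : ℕ × Finset ℕ → ℕ}
    {X Y X' Y' : Colored V} (h : Step μ M X Y) (h' : Step μ M X' Y')
    (htot : ∀ τ, X.total τ = X'.total τ) (τ : ℕ × Finset ℕ) : Y.total τ = Y'.total τ := by
  classical
  have key : ∀ {X Y : Colored V}, Step μ M X Y →
      Y.total τ = Finset.card {u | X.col u ≠ 0 ∧ μ (X.type u) = τ} := by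
    intro X Y h
    rw [total]
    congr 1
    ext u
    simp only [Finset.mem_filter, Finset.mem_univ, true_and, h.col]
    exact and_congr_right fun hu => by rw [h.type u hu]
  rw [key h, key h']
  convert card_eq_of_total_eq htot (fun σ => μ σ = τ)

/-! ### Joining -/

/-- Joining merges components of the colour `b`. -/
def Merges (X : Colored V) (i j b : ℕ) : Prop :=
  (∃ u, X.col u = b ∧ i ∈ X.labels u) ∧ ∃ v, X.col v = b ∧ j ∈ X.labels v

/-- Joining merges the components of this type. -/
def Merged (X : Colored V) (i j : ℕ) (τ : ℕ × Finset ℕ) : Prop :=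
  X.Merges i j τ.1 ∧ (i ∈ τ.2 ∨ j ∈ τ.2)

/-- Two vertices `a'` and `b'` of this colour with labels `i` and `j` act as hubs. A component with
label `j` is joined to `a'` directly, and a component with label `i` reaches it by way of `b'`. -/
theorem reach_join_of_merged {X : Colored V} (hX : ∀ u v, X.adj u v → X.adj v u) {i j : ℕ} {u v : V}
    (hu0 : X.col u ≠ 0) (huv : X.col v = X.col u) (hu : X.Merged i j (X.type u))
    (hv : X.Merged i j (X.type v)) : (X.join i j).Reach u v := by
  have hY : ∀ u v, (X.join i j).adj u v → (X.join i j).adj v u := by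
    rintro u v (h | h | h)
    · exact .inl (hX _ _ h)
    · exact .inr (.inr ⟨h.2, h.1⟩)
    · exact .inr (.inl ⟨h.2, h.1⟩)
  have up : ∀ {u v}, X.Reach u v → (X.join i j).Reach u v := reach_join_of_reach
  obtain ⟨⟨⟨a, ha, hai⟩, b, hb, hbj⟩, hu'⟩ := hu
  obtain ⟨a', haa, hai⟩ := mem_labels.mp hai
  obtain ⟨b', hbb, hbj⟩ := mem_labels.mp hbj
  have ca := haa.col_eq
  have cb := hbb.col_eq
  have e : ∀ {x y}, X.col x = X.col u → X.col y = X.col u → X.lab x = i → X.lab y = j →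
      (X.join i j).Reach x y := fun hx hy hxi hyj => .single ⟨.inr (.inl ⟨hxi, hyj⟩),
        show X.col _ = X.col _ by omega, show X.col _ ≠ 0 by omega⟩
  have toA : ∀ {x}, X.col x = X.col u → (i ∈ X.labels x ∨ j ∈ X.labels x) →
      (X.join i j).Reach x a' := by
    rintro x hx (h | h)
    · obtain ⟨y, hy, hyl⟩ := mem_labels.mp h
      have := hy.col_eq
      exact (up hy).trans ((e (y := b') (by omega) (by simp_all [type]) hyl hbj).trans
        ((e (by simp_all [type]) (by simp_all [type]) hai hbj).symm hY))
    · obtain ⟨y, hy, hyl⟩ := mem_labels.mp h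
      have := hy.col_eq
      exact (up hy).trans ((e (by simp_all [type]) (by omega) hai hyl).symm hY)
  exact (toA rfl hu').trans ((toA huv hv.2).symm hY)

-- Conversely, a new monochromatic edge has ends with the labels `i` and `j` in the same colour. It
-- thus witnesses that merging takes place and that both ends belong to merged components, so no
-- path can leave an unmerged component.
open Classical in
theorem reach_join {X : Colored V} (hX : ∀ u v, X.adj u v → X.adj v u) {i j : ℕ} {u v : V}
    (hu0 : X.col u ≠ 0) : (X.join i j).Reach u v ↔
      if X.Merged i j (X.type u) then X.col v = X.col u ∧ X.Merged i j (X.type v)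
      else X.Reach u v := by
  classical
  constructor
  · intro h
    induction h with
    | refl => split_ifs with hm; exacts [⟨rfl, hm⟩, .refl]
    | @tail v w huv hvw ih =>
      obtain ⟨hadj, hc, hv0⟩ := hvw
      change X.col v = X.col w at hc
      change X.col v ≠ 0 at hv0
      have hv : X.col v = X.col u := Reach.col_eq (X := X.join i j) huv
      rcases hadj with h | h
      · have hr : X.Reach v w := .single ⟨h, hc, hv0⟩
        split_ifs at ih ⊢
        · exact ⟨by omega, type_eq hX hr ▸ ih.2⟩
        · exact ih.trans hr
      · have hmg : X.Merges i j (X.col u) := by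
          rcases h with ⟨h1, h2⟩ | ⟨h1, h2⟩
          · exact ⟨⟨v, by omega, mem_labels.mpr ⟨v, .refl, h1⟩⟩,
              w, by omega, mem_labels.mpr ⟨w, .refl, h2⟩⟩
          · exact ⟨⟨w, by omega, mem_labels.mpr ⟨w, .refl, h2⟩⟩,
              v, by omega, mem_labels.mpr ⟨v, .refl, h1⟩⟩
        have hmv : X.Merged i j (X.type v) := by
          refine ⟨show X.Merges i j (X.col v) from hv ▸ hmg, ?_⟩
          rcases h with ⟨h1, h2⟩ | ⟨h1, h2⟩
          · exact .inl (mem_labels.mpr ⟨v, .refl, h1⟩)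
          · exact .inr (mem_labels.mpr ⟨v, .refl, h1⟩)
        have hmw : X.Merged i j (X.type w) := by
          refine ⟨show X.Merges i j (X.col w) from hc ▸ hv ▸ hmg, ?_⟩
          rcases h with ⟨h1, h2⟩ | ⟨h1, h2⟩
          · exact .inr (mem_labels.mpr ⟨w, .refl, h2⟩)
          · exact .inl (mem_labels.mpr ⟨w, .refl, h2⟩)
        split_ifs at ih ⊢ with hm
        · exact ⟨by omega, hmw⟩
        · exact absurd (type_eq hX ih ▸ hmv) hm
  · intro h
    split_ifs at h with hm
    · exact reach_join_of_merged hX hu0 h.1 hm h.2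
    · exact reach_join_of_reach h

open Classical in
/-- The new type of a component. -/
noncomputable def joinType (X : Colored V) (i j : ℕ) (τ : ℕ × Finset ℕ) : ℕ × Finset ℕ :=
  (τ.1, if X.Merged i j τ then
    (Finset.univ.filter fun u => X.col u = τ.1 ∧ X.Merged i j (X.type u)).biUnion X.labels else τ.2)

open Classical in
/-- The size of the component created by merging (`0` if there is no merging). -/
noncomputable def joinSize (X : Colored V) (i j : ℕ) (τ : ℕ × Finset ℕ) : ℕ :=
  if τ.1 ≠ 0 ∧ X.Merged i j τ then
    Finset.card {u | X.col u ≠ 0 ∧ (X.type u).1 = τ.1 ∧ X.Merged i j (X.type u)} else 0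

theorem joinSize_le (X : Colored V) (i j : ℕ) (τ : ℕ × Finset ℕ) :
    X.joinSize i j τ ≤ Fintype.card V := by
  unfold joinSize
  split_ifs
  · exact Finset.card_le_univ _
  · exact Nat.zero_le _

-- By `reach_join` the component of a merged vertex is the union of all merged components of its
-- colour, and the other components are untouched; types and sizes follow.
open Classical in
theorem step_join {X : Colored V} (hX : ∀ u v, X.adj u v → X.adj v u) (i j : ℕ) :
    Step (X.joinType i j) (X.joinSize i j) X (X.join i j) where
  col := rfl
  type u hu := by
    classical
    refine Prod.ext rfl ?_
    ext l
    change l ∈ (X.join i j).labels u ↔ l ∈ (X.joinType i j (X.type u)).2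
    rw [mem_labels, joinType]
    simp only [reach_join hX hu]
    split_ifs with hm
    · simp only [Finset.mem_biUnion, Finset.mem_filter, Finset.mem_univ, true_and]
      constructor
      · rintro ⟨v, hv, hl⟩
        exact ⟨v, hv, mem_labels.mpr ⟨v, .refl, hl⟩⟩
      · rintro ⟨v, hv, hl⟩
        obtain ⟨w, hw, hl⟩ := mem_labels.mp hl
        exact ⟨w, ⟨hw.col_eq.trans hv.1, type_eq hX hw ▸ hv.2⟩, hl⟩
    · exact mem_labels.symm
  size u hu := by
    by_cases hm : X.Merged i j (X.type u)
    · have hcard : (X.join i j).size u =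
          Finset.card {v | X.col v ≠ 0 ∧ (X.type v).1 = (X.type u).1 ∧ X.Merged i j (X.type v)} :=
            by
        rw [size]
        congr 1
        ext v
        simp only [mem_comp, reach_join hX hu, if_pos hm, Finset.mem_filter, Finset.mem_univ,
          true_and]
        constructor
        · rintro ⟨h1, h2⟩; exact ⟨by omega, h1, h2⟩
        · rintro ⟨-, h1, h2⟩; exact ⟨h1, h2⟩
      -- Components are non-empty, so the value 0 of `joinSize` is free to mean that nothing is
      -- merged.
      have := (X.join i j).size_pos u
      have hJ : X.joinSize i j (X.type u) = (X.join i j).size u := by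
        rw [joinSize, if_pos ⟨hu, hm⟩, hcard]
      rw [hJ, if_neg (by omega)]
    · have hJ : X.joinSize i j (X.type u) = 0 := by rw [joinSize, if_neg fun h => hm h.2]
      rw [if_pos hJ, size, size]
      congr 1
      ext v
      simp only [mem_comp, reach_join hX hu, if_neg hm]
  adj _ _ h := .inl h

/-- The effect of a join is defined from the whole coloured graph. This lemma and the next two show
that it depends on the totals only, so that one description of the step serves for a colouring and
its representative. Colour 0 is excluded because totals do not see absent vertices. -/
theorem merges_congr {X X' : Colored V} (h : ∀ τ, X.total τ = X'.total τ) {i j b : ℕ} (hb : b ≠ 0) :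
    X.Merges i j b ↔ X'.Merges i j b := by
  have key : ∀ {X X' : Colored V}, (∀ τ, X.total τ = X'.total τ) → ∀ l,
      (∃ u, X.col u = b ∧ l ∈ X.labels u) → ∃ u, X'.col u = b ∧ l ∈ X'.labels u := by
    rintro X X' h l ⟨u, hu, hl⟩
    obtain ⟨u', -, hu'⟩ := exists_of_total_eq (fun τ => (h τ).symm) (u' := u) (by omega)
    simp only [type, Prod.mk.injEq] at hu'
    exact ⟨u', by omega, hu'.2 ▸ hl⟩
  exact ⟨fun H => ⟨key h _ H.1, key h _ H.2⟩,
    fun H => ⟨key (fun τ => (h τ).symm) _ H.1, key (fun τ => (h τ).symm) _ H.2⟩⟩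

theorem joinType_congr {X X' : Colored V} (h : ∀ τ, X.total τ = X'.total τ) {i j : ℕ}
    {τ : ℕ × Finset ℕ} (hτ : τ.1 ≠ 0) : X.joinType i j τ = X'.joinType i j τ := by
  classical
  have hm : ∀ σ : ℕ × Finset ℕ, σ.1 ≠ 0 → (X.Merged i j σ ↔ X'.Merged i j σ) := fun σ hσ =>
    and_congr_left fun _ => merges_congr h hσ
  unfold joinType
  rw [if_congr (hm τ hτ) ?_ rfl]
  ext l
  simp only [Finset.mem_biUnion, Finset.mem_filter, Finset.mem_univ, true_and]
  constructor
  · rintro ⟨u, ⟨hu, hmu⟩, hl⟩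
    obtain ⟨u', hu0, hu'⟩ := exists_of_total_eq (fun τ => (h τ).symm) (u' := u) (by omega)
    refine ⟨u', ⟨?_, ?_⟩, ?_⟩
    · rw [← hu]; exact congrArg Prod.fst hu'
    · rw [hu', ← hm _ (show X.col u ≠ 0 by omega)]; exact hmu
    · have h2 : X'.labels u' = X.labels u := congrArg Prod.snd hu'
      rw [h2]; exact hl
  · rintro ⟨u, ⟨hu, hmu⟩, hl⟩
    obtain ⟨u', hu0, hu'⟩ := exists_of_total_eq h (u' := u) (by omega)
    refine ⟨u', ⟨?_, ?_⟩, ?_⟩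
    · rw [← hu]; exact congrArg Prod.fst hu'
    · rw [hu', hm _ (show X'.col u ≠ 0 by omega)]; exact hmu
    · have h2 : X.labels u' = X'.labels u := congrArg Prod.snd hu'
      rw [h2]; exact hl

theorem joinSize_congr {X X' : Colored V} (h : ∀ τ, X.total τ = X'.total τ) (i j : ℕ)
    (τ : ℕ × Finset ℕ) : X.joinSize i j τ = X'.joinSize i j τ := by
  classical
  have hm : ∀ σ : ℕ × Finset ℕ, σ.1 ≠ 0 → (X.Merged i j σ ↔ X'.Merged i j σ) := fun σ hσ =>
    and_congr_left fun _ => merges_congr h hσ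
  unfold joinSize
  rw [if_congr (and_congr_right fun hτ => hm τ hτ) ?_ rfl]
  refine (Eq.trans (by congr) (card_eq_of_total_eq h fun σ => σ.1 = τ.1 ∧ X.Merged i j σ)).trans ?_
  congr 1
  ext u
  simp only [Finset.mem_filter, Finset.mem_univ, true_and]
  exact and_congr_right fun hu => and_congr_right fun _ => hm _ hu

theorem Step.congr {μ μ' : ℕ × Finset ℕ → ℕ × Finset ℕ} {M : ℕ × Finset ℕ → ℕ} {X Y : Colored V}
    (h : Step μ M X Y) (hμ : ∀ τ, τ.1 ≠ 0 → μ τ = μ' τ) : Step μ' M X Y where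
  col := h.col
  type u hu := by rw [h.type u hu, hμ _ hu]
  size := h.size
  adj := h.adj

/-- Whether a join connects two components is decided by their label sets, which belong to their
types. This is the adjacency condition required by `Ok.step`. -/
theorem join_new_adj {X X' : Colored V} {i j : ℕ} {u' v' : V} (h : (X'.join i j).adj u' v') :
    X'.adj u' v' ∨ ∀ u v, X.type u = X'.type u' → X.type v = X'.type v' →
      ∃ u₁ v₁, X.Reach u u₁ ∧ X.Reach v v₁ ∧ (X.join i j).adj u₁ v₁ := by
  refine h.imp_right fun h u v hu hv => ?_
  have key : ∀ {u u' : V} {l : ℕ}, X.type u = X'.type u' → X'.lab u' = l →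
      ∃ u₁, X.Reach u u₁ ∧ X.lab u₁ = l := by
    intro u u' l hu hl
    rw [← mem_labels]
    have : X.labels u = X'.labels u' := congrArg Prod.snd hu
    rw [this, mem_labels]
    exact ⟨u', .refl, hl⟩
  rcases h with ⟨h1, h2⟩ | ⟨h1, h2⟩
  · obtain ⟨u₁, hu₁, hl₁⟩ := key hu h1
    obtain ⟨v₁, hv₁, hl₂⟩ := key hv h2
    exact ⟨u₁, v₁, hu₁, hv₁, .inr (.inl ⟨hl₁, hl₂⟩)⟩
  · obtain ⟨u₁, hu₁, hl₁⟩ := key hu h1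
    obtain ⟨v₁, hv₁, hl₂⟩ := key hv h2
    exact ⟨u₁, v₁, hu₁, hv₁, .inr (.inr ⟨hl₁, hl₂⟩)⟩

/-! ### Independence of absent vertices -/

/-- On the vertices with property `P` the component sizes and types of `X` are those of `Y`. -/
theorem local_eq {X Y : Colored V} (P : V → Prop)
    (hP : ∀ u v, P u → X.Mono u v → P v) (hP' : ∀ u v, P u → Y.Mono u v → P v)
    (hm : ∀ u v, P u → P v → (X.Mono u v ↔ Y.Mono u v)) (hlab : ∀ u, P u → X.lab u = Y.lab u)
    (hcol : ∀ u, P u → X.col u = Y.col u) {u : V} (hu : P u) :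
    X.size u = Y.size u ∧ X.type u = Y.type u := by
  have key : ∀ {X Y : Colored V}, (∀ u v, P u → X.Mono u v → P v) →
      (∀ u v, P u → P v → (X.Mono u v ↔ Y.Mono u v)) → ∀ {v}, X.Reach u v → P v ∧ Y.Reach u v := by
    intro X Y h1 h2 v h
    induction h with
    | refl => exact ⟨hu, .refl⟩
    | tail _ h ih =>
      have := h1 _ _ ih.1 h
      exact ⟨this, ih.2.tail ((h2 _ _ ih.1 this).mp h)⟩
  have hreach : ∀ v, X.Reach u v ↔ Y.Reach u v := fun v =>
    ⟨fun h => (key hP hm h).2, fun h => (key hP' (fun u v hu hv => (hm u v hu hv).symm) h).2⟩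
  have hcomp : X.comp u = Y.comp u := by ext v; simp [hreach]
  refine ⟨by rw [size, size, hcomp], Prod.ext (hcol u hu) ?_⟩
  change X.labels u = Y.labels u
  rw [labels, labels, ← hcomp]
  refine Finset.image_congr fun v hv => hlab v ?_
  exact (key hP hm (mem_comp.mp hv)).1

theorem Same.local_eq {X Y : Colored V} (h : Same X Y) {u : V} (hu : X.col u ≠ 0) :
    X.size u = Y.size u ∧ X.type u = Y.type u := by
  refine Colored.local_eq (fun u => X.col u ≠ 0) (fun u v hu hv => hv.2.1 ▸ hu)
    (fun u v hu hv => ?_) (fun u v hu hv => ?_) h.lab (fun u _ => by rw [h.col]) hu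
  · rw [h.col] at hu ⊢
    exact hv.2.1 ▸ hu
  · simp only [Mono, h.adj u v hu hv, h.col]

theorem Same.promised {X Y : Colored V} (h : Same X Y) (φ : ℕ × Finset ℕ → ℕ) {u : V}
    (hu : X.col u ≠ 0) : X.promised φ u = Y.promised φ u := by
  rw [Colored.promised, Colored.promised, (h.local_eq hu).1, (h.local_eq hu).2]

theorem Same.total {X Y : Colored V} (h : Same X Y) (τ : ℕ × Finset ℕ) :
    X.total τ = Y.total τ := by
  classical
  rw [Colored.total, Colored.total]
  congr 1
  ext u
  simp only [Finset.mem_filter, Finset.mem_univ, true_and, ← h.col]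
  exact and_congr_right fun hu => by rw [(h.local_eq hu).2]

theorem Same.ok {X Y : Colored V} (h : Same X Y) {φ θ : ℕ × Finset ℕ → ℕ} (hX : X.Ok φ θ) :
    Y.Ok φ θ where
  cross u v huv hu hv := by
    rw [← h.col] at hu hv
    rw [← h.promised φ (by omega), ← h.promised φ (by omega)]
    exact hX.cross u v ((h.adj u v (by omega) (by omega)).mpr huv) hu hv
  inner u hu := by
    rw [← h.col] at hu
    rw [← h.promised φ (by omega), ← (h.local_eq (by omega)).2]
    exact hX.inner u hu
  outer u hu := by
    rw [← h.col] at hu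
    rw [← h.promised φ (by omega), ← (h.local_eq (by omega)).2]
    exact hX.outer u hu

namespace IsUnion

variable {X₁ X₂ X : Colored V}

/-- No edge runs between the two sides, so each component lies in one of them. Therefore
admissibility can be checked on the sides separately and totals are additive. -/
theorem local_eq (h : IsUnion X₁ X₂ X) {u : V} (hu : X₁.col u ≠ 0) :
    X.size u = X₁.size u ∧ X.type u = X₁.type u := by
  refine Colored.local_eq (fun u => X₁.col u ≠ 0) (fun u v hu hv => ?_)
    (fun u v hu hv => hv.2.1 ▸ hu) (fun u v hu hv => ?_) h.lab₁ (fun u hu => h.col_left hu) hu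
  · intro hv0
    have h1 := hv.2.1
    rw [h.col_left hu, h.col v, hv0, zero_add] at h1
    exact (h.not_adj u v hu (by omega)).1 hv.1
  · simp only [Mono, h.adj₁ u v hu hv, h.col_left hu, h.col_left hv]

theorem promised (h : IsUnion X₁ X₂ X) (φ : ℕ × Finset ℕ → ℕ) {u : V} (hu : X₁.col u ≠ 0) :
    X.promised φ u = X₁.promised φ u := by
  rw [Colored.promised, Colored.promised, (h.local_eq hu).1, (h.local_eq hu).2]

theorem ok_left (h : IsUnion X₁ X₂ X) {φ θ : ℕ × Finset ℕ → ℕ} (hX : X.Ok φ θ) : X₁.Ok φ θ where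
  cross u v huv hu hv := by
    rw [← h.promised φ (by omega), ← h.promised φ (by omega)]
    exact hX.cross u v ((h.adj₁ u v (by omega) (by omega)).mpr huv)
      ((h.col_left (by omega)).trans hu) ((h.col_left (by omega)).trans hv)
  inner u hu := by
    rw [← h.promised φ (by omega), ← (h.local_eq (by omega)).2]
    exact hX.inner u ((h.col_left (by omega)).trans hu)
  outer u hu := by
    rw [← h.promised φ (by omega), ← (h.local_eq (by omega)).2]
    exact hX.outer u ((h.col_left (by omega)).trans hu)

theorem ok (h : IsUnion X₁ X₂ X) {φ θ : ℕ × Finset ℕ → ℕ} (h₁ : X₁.Ok φ θ) (h₂ : X₂.Ok φ θ) :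
    X.Ok φ θ where
  cross u v huv hu hv := by
    have hcu := h.col u
    have hcv := h.col v
    rcases h.disj u with hu' | hu' <;> rcases h.disj v with hv' | hv'
    · rw [h.swap.promised φ (by omega), h.swap.promised φ (by omega)]
      exact h₂.cross u v ((h.adj₂ u v (by omega) (by omega)).mp huv) (by omega) (by omega)
    · exact absurd huv (h.not_adj v u (by omega) (by omega)).2
    · exact absurd huv (h.not_adj u v (by omega) (by omega)).1
    · rw [h.promised φ (by omega), h.promised φ (by omega)]
      exact h₁.cross u v ((h.adj₁ u v (by omega) (by omega)).mp huv) (by omega) (by omega)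
  inner u hu := by
    have hcu := h.col u
    rcases h.disj u with hu' | hu'
    · rw [h.swap.promised φ (by omega), (h.swap.local_eq (by omega)).2]
      exact h₂.inner u (by omega)
    · rw [h.promised φ (by omega), (h.local_eq (by omega)).2]
      exact h₁.inner u (by omega)
  outer u hu := by
    have hcu := h.col u
    rcases h.disj u with hu' | hu'
    · rw [h.swap.promised φ (by omega), (h.swap.local_eq (by omega)).2]
      exact h₂.outer u (by omega)
    · rw [h.promised φ (by omega), (h.local_eq (by omega)).2]
      exact h₁.outer u (by omega)

theorem total (h : IsUnion X₁ X₂ X) (τ : ℕ × Finset ℕ) : X.total τ = X₁.total τ + X₂.total τ := by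
  classical
  rw [Colored.total, Colored.total, Colored.total, ← Finset.card_union_of_disjoint]
  · congr 1
    ext u
    have hcu := h.col u
    simp only [Finset.mem_filter, Finset.mem_univ, true_and, Finset.mem_union]
    rcases h.disj u with hu' | hu'
    · by_cases h2 : X₂.col u = 0
      · simp [hcu, hu', h2]
      · rw [(h.swap.local_eq h2).2]
        simp [hcu, hu', h2]
    · by_cases h2 : X₁.col u = 0
      · simp [hcu, hu', h2]
      · rw [(h.local_eq h2).2]
        simp [hcu, hu', h2]
  · rw [Finset.disjoint_left]
    intro u hu hv
    simp only [Finset.mem_filter, Finset.mem_univ, true_and] at hu hv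
    have := h.disj u
    omega

end IsUnion

end Colored

/-! ### Families of representative colourings along an expression. -/

namespace CExpr

variable {V : Type*} [DecidableEq V] {c : ℕ}

theorem label_eq_none {t : CExpr V c} {v : V} : t.label v = none ↔ v ∉ t.leaves := by
  induction t with
  | vertex u i => simp [label, leaves]
  | union s t hs ht => simp [label, leaves, hs, ht]
  | relabel i j h t ht => simp [label, leaves, ht]
  | join i j h t ht => simp [label, leaves, ht]

theorem mem_leaves_of_label {t : CExpr V c} {v : V} {i : Fin c} (h : t.label v = some i) :
    v ∈ t.leaves := by
  by_contra hv
  rw [label_eq_none.mpr hv] at h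
  exact absurd h (by simp)

theorem Adj.mem {t : CExpr V c} {u v : V} (h : t.Adj u v) : u ∈ t.leaves ∧ v ∈ t.leaves := by
  induction t with
  | vertex u i => exact h.elim
  | union s t hs ht =>
    simp only [leaves, List.mem_append]
    exact h.elim (fun h => ⟨.inl (hs h).1, .inl (hs h).2⟩) fun h => ⟨.inr (ht h).1, .inr (ht h).2⟩
  | relabel i j _ t ht => exact ht h
  | join i j _ t ht =>
    rcases h with h | ⟨h1, h2⟩ | ⟨h1, h2⟩
    · exact ht h
    · exact ⟨mem_leaves_of_label h1, mem_leaves_of_label h2⟩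
    · exact ⟨mem_leaves_of_label h1, mem_leaves_of_label h2⟩

theorem Adj.symm {t : CExpr V c} {u v : V} (h : t.Adj u v) : t.Adj v u := by
  induction t with
  | vertex u i => exact h.elim
  | union s t hs ht => exact h.imp hs ht
  | relabel i j _ t ht => exact ht h
  | join i j _ t ht => exact h.imp ht fun h => h.elim (fun h => .inr h.symm) fun h => .inl h.symm

/-- The label of a vertex as a number, `0` for absent vertices. -/
def labelNum (t : CExpr V c) (v : V) : ℕ := ((t.label v).map Fin.val).getD 0

/-- The labelled graph represented by an expression, with a colouring of its vertices. -/
def colored (t : CExpr V c) (χ : V → ℕ) : Colored V := ⟨χ, t.labelNum, t.Adj⟩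

/-- Exactly the vertices of the represented graph are coloured. -/
def IsColoring (t : CExpr V c) (χ : V → ℕ) : Prop := ∀ v, χ v ≤ 2 ∧ (χ v ≠ 0 ↔ v ∈ t.leaves)

/-- Only `Same` holds, not equality: absent vertices carry the number of a genuine label, which
`Colored.relabel` may change. -/
theorem same_relabel (t : CExpr V c) (i j : Fin c) (hij : i ≠ j) {χ : V → ℕ}
    (hχ : t.IsColoring χ) :
    Colored.Same ((t.colored χ).relabel i j) ((relabel i j hij t).colored χ) where
  col := rfl
  lab v hv := by
    obtain ⟨l, hl⟩ := Option.ne_none_iff_exists'.mp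
      (fun h => label_eq_none.mp h ((hχ v).2.mp hv) : t.label v ≠ none)
    simp only [colored, Colored.relabel, labelNum, label, hl, Option.map_some, Option.getD_some,
      Fin.val_inj]
    split_ifs <;> rfl
  adj _ _ _ _ := Iff.rfl

theorem label_eq_some_iff {t : CExpr V c} {v : V} (hv : v ∈ t.leaves) (i : Fin c) :
    t.label v = some i ↔ t.labelNum v = i := by
  obtain ⟨l, hl⟩ := Option.ne_none_iff_exists'.mp
    (fun h => label_eq_none.mp h hv : t.label v ≠ none)
  simp [labelNum, hl, Fin.val_inj]

theorem isUnion {s t : CExpr V c} (hd : (union s t).leaves.Nodup) {χ₁ χ₂ : V → ℕ}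
    (h₁ : s.IsColoring χ₁) (h₂ : t.IsColoring χ₂) :
    Colored.IsUnion (s.colored χ₁) (t.colored χ₂) ((union s t).colored fun v => χ₁ v + χ₂ v) := by
  have hd : ∀ v, v ∈ s.leaves → v ∈ t.leaves → False := fun v h h' =>
    (List.disjoint_of_nodup_append hd) h h'
  refine ⟨fun _ => rfl, ?_, ?_, ?_, ?_, ?_, ?_⟩
  · intro u
    by_contra! h
    exact hd u ((h₁ u).2.mp h.1) ((h₂ u).2.mp h.2)
  · intro u hu
    have hl : t.label u = none := label_eq_none.mpr fun h => hd u ((h₁ u).2.mp hu) h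
    simp [colored, labelNum, label, hl]
  · intro u hu
    have hl : s.label u = none := label_eq_none.mpr fun h => hd u h ((h₂ u).2.mp hu)
    simp [colored, labelNum, label, hl]
  · intro u v hu _
    exact or_iff_left fun h => hd u ((h₁ u).2.mp hu) (Adj.mem h).1
  · intro u v hu _
    exact or_iff_right fun h => hd u (Adj.mem h).1 ((h₂ u).2.mp hu)
  · intro u v hu hv
    have hu := (h₁ u).2.mp hu
    have hv := (h₂ v).2.mp hv
    exact ⟨fun h => h.elim (fun h => hd v (Adj.mem h).2 hv) fun h => hd u hu (Adj.mem h).1,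
      fun h => h.elim (fun h => hd v (Adj.mem h).1 hv) fun h => hd u hu (Adj.mem h).2⟩

theorem same_join (t : CExpr V c) (i j : Fin c) (hij : i ≠ j) {χ : V → ℕ}
    (hχ : t.IsColoring χ) :
    Colored.Same ((t.colored χ).join i j) ((join i j hij t).colored χ) where
  col := rfl
  lab _ _ := rfl
  adj u v hu hv := by
    have hu := (hχ u).2.mp hu
    have hv := (hχ v).2.mp hv
    simp only [colored, Colored.join, Adj, Joins, label_eq_some_iff hu, label_eq_some_iff hv]

variable [Fintype V]

/-- For all promises and thresholds, the colourings with property `I` contain representatives of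
all admissible colourings. -/
structure Complete (t : CExpr V c) (I : (V → ℕ) → Prop) : Prop where
  coloring : ∀ χ, I χ → t.IsColoring χ
  exists_rep : ∀ χ φ θ, t.IsColoring χ → (∀ τ, φ τ ≤ Fintype.card V) → (∀ τ, θ τ ≤ Fintype.card V) →
    (t.colored χ).Ok φ θ → ∃ χ', I χ' ∧ (t.colored χ').Ok φ θ ∧
      ∀ τ, (t.colored χ').total τ = (t.colored χ).total τ

theorem complete_vertex (v : V) (i : Fin c) {I : (V → ℕ) → Prop}
    (hI : ∀ χ, I χ ↔ χ = (fun u => if u = v then 1 else 0) ∨ χ = fun u => if u = v then 2 else 0) :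
    (vertex v i : CExpr V c).Complete I where
  coloring χ hχ u := by
    rcases (hI χ).mp hχ with rfl | rfl <;> by_cases h : u = v <;> simp [leaves, h]
  exists_rep χ φ θ hχ _ _ hok := by
    refine ⟨χ, (hI χ).mpr ?_, hok, fun _ => rfl⟩
    have h0 := hχ v
    simp only [leaves, List.mem_singleton] at h0
    have hv : χ v = 1 ∨ χ v = 2 := by
      have := h0.2.mpr trivial
      omega
    refine hv.imp (fun h => ?_) fun h => ?_ <;>
    · ext u
      split_ifs with hu
      · rw [hu, h]
      · by_contra h1
        exact hu (by simpa [leaves] using (hχ u).2.mp h1)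

/-- Pull the promises and thresholds back through the node, take a representative there, and push
its admissibility and its totals forward. The family itself does not change, so the algorithm leaves
its table alone at such nodes. -/
theorem Complete.relabel {t : CExpr V c} {I : (V → ℕ) → Prop} (h : t.Complete I) (i j : Fin c)
    (hij : i ≠ j) : (relabel i j hij t).Complete I where
  coloring := h.coloring
  exists_rep χ φ θ hχ hφ hθ hok := by
    have hχ : t.IsColoring χ := hχ
    obtain ⟨φ', θ', hφ', hθ', hok', hrep⟩ := Colored.Ok.step
      (Colored.step_relabel (t.colored χ) i j) (fun _ _ h => h.symm) hφ (fun _ => Nat.zero_le _)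
      ((same_relabel t i j hij hχ).symm.ok hok)
    obtain ⟨χ', hI, hχok, htot⟩ := h.exists_rep χ φ' θ' hχ hφ' hθ' hok'
    have hsame := same_relabel t i j hij (h.coloring χ' hI)
    have hstep := Colored.step_relabel (t.colored χ') i j
    refine ⟨χ', hI, hsame.ok (hrep _ _ hstep (fun τ => (htot τ).symm) ?_ hχok), fun τ => ?_⟩
    · exact fun _ _ h _ _ => .inl h
    · rw [← hsame.total, ← (same_relabel t i j hij hχ).total]
      exact Colored.total_of_step hstep (Colored.step_relabel (t.colored χ) i j) htot τ

/-- As for relabelling, with one addition: the types and sizes produced by merging must be the same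
for the colouring and its representative, which holds since they are functions of the common totals.
-/
theorem Complete.join {t : CExpr V c} {I : (V → ℕ) → Prop} (h : t.Complete I) (i j : Fin c)
    (hij : i ≠ j) : (join i j hij t).Complete I where
  coloring := h.coloring
  exists_rep χ φ θ hχ hφ hθ hok := by
    have hχ : t.IsColoring χ := hχ
    have hsymm : ∀ χ : V → ℕ, ∀ u v, (t.colored χ).adj u v → (t.colored χ).adj v u :=
      fun _ _ _ h => Adj.symm h
    have hstep := Colored.step_join (hsymm χ) i j
    obtain ⟨φ', θ', hφ', hθ', hok', hrep⟩ := Colored.Ok.step hstep (hsymm χ) hφ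
      (Colored.joinSize_le _ i j) ((same_join t i j hij hχ).symm.ok hok)
    obtain ⟨χ', hI, hχok, htot⟩ := h.exists_rep χ φ' θ' hχ hφ' hθ' hok'
    have hsame := same_join t i j hij (h.coloring χ' hI)
    have hstep' : Colored.Step ((t.colored χ).joinType i j) ((t.colored χ).joinSize i j)
        (t.colored χ') ((t.colored χ').join i j) := by
      rw [funext (Colored.joinSize_congr (fun τ => (htot τ).symm) i j)]
      exact (Colored.step_join (hsymm χ') i j).congr fun τ hτ => Colored.joinType_congr htot hτ
    refine ⟨χ', hI, hsame.ok (hrep _ _ hstep' (fun τ => (htot τ).symm) ?_ hχok), fun τ => ?_⟩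
    · exact fun _ _ h _ _ => Colored.join_new_adj h
    · rw [← hsame.total, ← (same_join t i j hij hχ).total]
      exact Colored.total_of_step hstep' hstep htot τ

/-- An admissible colouring is restricted to both sides, each restriction is replaced by a
representative for the same promises and thresholds, and the sum is admissible with the right
totals. The hypothesis `hrep` allows `I` to be a selection of such sums, which is what keeps the
tables of polynomial size. -/
theorem Complete.union {s t : CExpr V c} (hd : (union s t).leaves.Nodup)
    {I₁ I₂ I : (V → ℕ) → Prop} (h₁ : s.Complete I₁) (h₂ : t.Complete I₂)
    (hI : ∀ χ, I χ → ∃ χ₁ χ₂, I₁ χ₁ ∧ I₂ χ₂ ∧ χ = fun v => χ₁ v + χ₂ v)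
    (hrep : ∀ χ₁ χ₂ φ θ, I₁ χ₁ → I₂ χ₂ → (∀ τ, φ τ ≤ Fintype.card V) →
      (∀ τ, θ τ ≤ Fintype.card V) → ((union s t).colored fun v => χ₁ v + χ₂ v).Ok φ θ →
      ∃ χ', I χ' ∧ ((union s t).colored χ').Ok φ θ ∧ ∀ τ, ((union s t).colored χ').total τ =
        ((union s t).colored fun v => χ₁ v + χ₂ v).total τ) :
    (union s t).Complete I where
  coloring χ hχ v := by
    obtain ⟨χ₁, χ₂, hI₁, hI₂, rfl⟩ := hI χ hχ
    have hc₁ := h₁.coloring χ₁ hI₁ v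
    have hc₂ := h₂.coloring χ₂ hI₂ v
    have := (isUnion hd (h₁.coloring χ₁ hI₁) (h₂.coloring χ₂ hI₂)).disj v
    simp only [colored] at this
    simp only [leaves, List.mem_append, ← hc₁.2, ← hc₂.2]
    omega
  exists_rep χ φ θ hχ hφ hθ hok := by
    have hcol : ∀ r : CExpr V c, (∀ v, v ∈ r.leaves → v ∈ (CExpr.union s t).leaves) →
        r.IsColoring fun v => if v ∈ r.leaves then χ v else 0 := by
      intro r hr v
      have := hχ v
      dsimp only
      split_ifs with hv
      · exact ⟨this.1, by simp [hv, this.2, hr v hv]⟩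
      · simp [hv]
    have hc₁ := hcol s fun v hv => List.mem_append_left _ hv
    have hc₂ := hcol t fun v hv => List.mem_append_right _ hv
    have hU := isUnion hd hc₁ hc₂
    have hsum : (fun v => (if v ∈ s.leaves then χ v else 0) + if v ∈ t.leaves then χ v else 0) =
        χ := by
      ext v
      have hdv : v ∈ s.leaves → v ∈ t.leaves → False := fun h h' =>
        (List.disjoint_of_nodup_append hd) h h'
      have := hχ v
      simp only [leaves, List.mem_append] at this
      split_ifs with h h' h'
      · exact (hdv h h').elim
      · rfl
      · exact zero_add _
      · simp only [h, h', or_self, iff_false, not_not] at this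
        rw [this.2]
    rw [hsum] at hU
    obtain ⟨χ₁, hI₁, ok₁, tot₁⟩ := h₁.exists_rep _ φ θ hc₁ hφ hθ (hU.ok_left hok)
    obtain ⟨χ₂, hI₂, ok₂, tot₂⟩ := h₂.exists_rep _ φ θ hc₂ hφ hθ (hU.swap.ok_left hok)
    have hU' := isUnion hd (h₁.coloring χ₁ hI₁) (h₂.coloring χ₂ hI₂)
    obtain ⟨χ', hI', ok', tot'⟩ := hrep χ₁ χ₂ φ θ hI₁ hI₂ hφ hθ (hU'.ok ok₁ ok₂)
    exact ⟨χ', hI', ok', fun τ => by rw [tot', hU'.total, hU.total, tot₁, tot₂]⟩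

end CExpr

/-! ## Safe sets in terms of colourings -/

namespace Colored

variable {V : Type*}

theorem reach_iff_reachable {X : Colored V} {G : SimpleGraph V} {A : Set V}
    (hA : ∀ u v, X.Mono u v → u ∈ A → v ∈ A)
    (hadj : ∀ u v, u ∈ A → v ∈ A → (X.Mono u v ↔ G.Adj u v)) (u : A) (v : V) :
    X.Reach u v ↔ ∃ hv : v ∈ A, (G.induce A).Reachable u ⟨v, hv⟩ := by
  constructor
  · intro h
    induction h with
    | refl => exact ⟨u.2, .refl _⟩
    | tail _ h ih =>
      obtain ⟨hv, hr⟩ := ih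
      have hw := hA _ _ h hv
      refine ⟨hw, hr.trans (SimpleGraph.Adj.reachable ?_)⟩
      simpa using (hadj _ _ hv hw).mp h
  · rintro ⟨hv, hr⟩
    rw [SimpleGraph.reachable_iff_reflTransGen] at hr
    have : ∀ w : A, Relation.ReflTransGen (G.induce A).Adj u w → X.Reach u w := by
      intro w h
      induction h with
      | refl => exact .refl
      | tail _ h ih => exact ih.tail ((hadj _ _ (Subtype.prop _) (Subtype.prop _)).mpr
        (by simpa using h))
    exact this _ hr

theorem mono_iff [DecidableEq V] {G : SimpleGraph V} {X : Colored V} {S : Finset V}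
    (hG : ∀ u v, X.adj u v ↔ G.Adj u v) (hS : ∀ v, X.col v = if v ∈ S then 2 else 1)
    (u v : V) : X.Mono u v ↔ G.Adj u v ∧ (u ∈ S ↔ v ∈ S) := by
  simp only [Mono, hG, hS]
  by_cases hu : u ∈ S <;> by_cases hv : v ∈ S <;> simp [hu, hv]

variable [Fintype V]

/-- The number of inner vertices. -/
def innerCard (X : Colored V) : ℕ := Finset.card {u | X.col u = 2}

/-- The inner vertices form a safe set. -/
structure Safe (X : Colored V) : Prop where
  pos : 0 < X.innerCard
  cross : ∀ u v, X.adj u v → X.col u = 2 → X.col v = 1 → X.size v ≤ X.size u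

/-- There is at most one inner component. -/
def InnerConnected (X : Colored V) : Prop := ∀ u, X.col u = 2 → X.innerCard ≤ X.size u

theorem ncard_supp {X : Colored V} {G : SimpleGraph V} {A : Set V}
    (hA : ∀ u v, X.Mono u v → u ∈ A → v ∈ A)
    (hadj : ∀ u v, u ∈ A → v ∈ A → (X.Mono u v ↔ G.Adj u v)) (u : A)
    {C : (G.induce A).ConnectedComponent} (hu : u ∈ C.supp) : C.supp.ncard = X.size u := by
  have : ((↑) : A → V) '' C.supp = (X.comp u : Set V) := by
    ext v
    simp only [Set.mem_image, Finset.mem_coe, mem_comp, reach_iff_reachable hA hadj]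
    have key : ∀ w : A, w ∈ C.supp ↔ (G.induce A).Reachable u w := by
      intro w
      rw [SimpleGraph.ConnectedComponent.mem_supp_iff] at hu ⊢
      rw [← hu, SimpleGraph.ConnectedComponent.eq]
      exact ⟨fun h => h.symm, fun h => h.symm⟩
    constructor
    · rintro ⟨w, hw, rfl⟩
      exact ⟨w.2, (key w).mp hw⟩
    · rintro ⟨hv, hr⟩
      exact ⟨⟨v, hv⟩, (key _).mpr hr, rfl⟩
  rw [← Set.ncard_image_of_injective _ Subtype.val_injective, this, Set.ncard_coe_finset, size]

/-- The colour is a part of the type, so the size of the set is a sum of totals. -/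
theorem innerCard_of_total_eq {X X' : Colored V} (h : ∀ τ, X.total τ = X'.total τ) :
    X.innerCard = X'.innerCard := by
  classical
  have key : ∀ Y : Colored V, Y.innerCard = Finset.card {u | Y.col u ≠ 0 ∧ (Y.type u).1 = 2} := by
    intro Y
    rw [innerCard]
    congr 1
    ext u
    simp only [Finset.mem_filter, Finset.mem_univ, true_and]
    exact ⟨fun h => ⟨by omega, h⟩, fun h => h.2⟩
  rw [key, key]
  convert card_eq_of_total_eq h fun τ => τ.1 = 2

variable [DecidableEq V] {G : SimpleGraph V} {X : Colored V} {S : Finset V}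

theorem innerCard_eq (hS : ∀ v, X.col v = if v ∈ S then 2 else 1) : X.innerCard = S.card := by
  rw [innerCard]
  congr 1
  ext v
  simp [hS]

theorem isSafeSet_iff (hG : ∀ u v, X.adj u v ↔ G.Adj u v)
    (hS : ∀ v, X.col v = if v ∈ S then 2 else 1) : IsSafeSet G S ↔ X.Safe := by
  have hm := mono_iff hG hS
  have size_in : ∀ (u : (S : Set V)) {C : (G.induce (S : Set V)).ConnectedComponent},
      u ∈ C.supp → C.supp.ncard = X.size u := fun u C hu =>
    ncard_supp (fun a b h ha => ((hm a b).mp h).2.mp ha)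
      (fun a b ha hb => by rw [hm]; exact and_iff_left (iff_of_true ha hb)) u hu
  have size_out : ∀ (u : ((S : Set V)ᶜ : Set V)) {D : (G.induce (S : Set V)ᶜ).ConnectedComponent},
      u ∈ D.supp → D.supp.ncard = X.size u := fun u D hu =>
    ncard_supp (A := (S : Set V)ᶜ) (fun a b h (ha : a ∉ S) (hb : b ∈ S) =>
      ha (((hm a b).mp h).2.mpr hb))
      (fun a b ha hb => by rw [hm]; exact and_iff_left (iff_of_false ha hb)) u hu
  constructor
  · rintro ⟨hne, h⟩
    refine ⟨by rw [innerCard_eq hS]; exact hne.card_pos, fun u v huv hu hv => ?_⟩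
    have hu : u ∈ S := by simpa [hS] using hu
    have hv : v ∉ S := by simpa [hS] using hv
    have := h ((G.induce (S : Set V)).connectedComponentMk ⟨u, hu⟩)
      ((G.induce (S : Set V)ᶜ).connectedComponentMk ⟨v, hv⟩)
      ⟨_, rfl, _, rfl, (hG u v).mp huv⟩
    rw [size_in ⟨u, hu⟩ rfl, size_out ⟨v, hv⟩ rfl] at this
    exact not_lt.mp this
  · rintro ⟨hpos, h⟩
    refine ⟨by rw [innerCard_eq hS] at hpos; exact Finset.card_pos.mp hpos, ?_⟩
    rintro C D ⟨a, ha, b, hb, hab⟩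
    rw [size_in a ha, size_out b hb, not_lt]
    exact h a b ((hG _ _).mpr hab) (by simp [hS]) (by rw [hS]; exact if_neg b.2)

/-- The component of an inner vertex is contained in `S`; it is all of `S` as soon as it has at
least as many vertices. Connectedness thus becomes a lower bound for sizes of inner components, a
condition that thresholds can express. -/
theorem isConnectedSafeSet_iff (hG : ∀ u v, X.adj u v ↔ G.Adj u v)
    (hS : ∀ v, X.col v = if v ∈ S then 2 else 1) :
    IsConnectedSafeSet G S ↔ X.Safe ∧ X.InnerConnected := by
  have hm := mono_iff hG hS
  rw [IsConnectedSafeSet, isSafeSet_iff hG hS]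
  refine and_congr_right fun hsafe => ?_
  have hne : S.Nonempty := by
    have := hsafe.pos
    rw [innerCard_eq hS] at this
    exact Finset.card_pos.mp this
  have hreach : ∀ (u : (S : Set V)) (v : V), X.Reach u v ↔
      ∃ hv : v ∈ (S : Set V), (G.induce (S : Set V)).Reachable u ⟨v, hv⟩ := fun u v =>
    reach_iff_reachable (fun a b h ha => ((hm a b).mp h).2.mp ha)
      (fun a b ha hb => by rw [hm]; exact and_iff_left (iff_of_true ha hb)) u v
  have hsub : ∀ u : (S : Set V), X.comp u ⊆ S := fun u v hv => by
    rw [mem_comp, hreach] at hv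
    exact hv.1
  constructor
  · intro hc u hu
    have hu : u ∈ S := by simpa [hS] using hu
    rw [innerCard_eq hS, size]
    refine Finset.card_le_card fun v hv => ?_
    rw [mem_comp]
    exact (hreach ⟨u, hu⟩ v).mpr ⟨hv, hc.preconnected _ _⟩
  · intro h
    have : Nonempty (S : Set V) := hne.to_subtype
    refine ⟨fun u v => ?_⟩
    have h1 := h u (by simp [hS])
    rw [innerCard_eq hS, size] at h1
    have h2 := Finset.eq_of_subset_of_card_le (hsub u) h1
    have h3 : (v : V) ∈ X.comp u := by rw [h2]; exact v.2
    rw [mem_comp, hreach] at h3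
    exact h3.2

end Colored

/-- At the root all sizes are final, so the promises are 0. The threshold of inner types is the
number of inner vertices if connectedness has to be kept and 0 otherwise; the threshold of outer
types is the vacuous bound `Fintype.card V`. -/
theorem CExpr.Complete.exists_safe {V : Type*} [DecidableEq V] [Fintype V] {c : ℕ} {t : CExpr V c}
    {I : (V → ℕ) → Prop} (h : t.Complete I) {χ : V → ℕ} (hχ : t.IsColoring χ)
    (hs : (t.colored χ).Safe) : ∃ χ', I χ' ∧ (t.colored χ').Safe ∧
      (t.colored χ').innerCard = (t.colored χ).innerCard ∧
      ((t.colored χ).InnerConnected → (t.colored χ').InnerConnected) := by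
  classical
  have hprom : ∀ (X : Colored V) (u : V), X.promised (fun _ => 0) u = X.size u :=
    fun X u => if_pos rfl
  obtain ⟨χ', hI, hok, htot⟩ := h.exists_rep χ (fun _ => 0)
    (fun τ => if τ.1 = 2 then if (t.colored χ).InnerConnected then (t.colored χ).innerCard else 0
      else Fintype.card V) hχ (fun _ => Nat.zero_le _) (fun τ => by
        split_ifs
        · exact Finset.card_le_univ _
        · exact Nat.zero_le _
        · exact le_rfl) (by
        refine ⟨fun u v huv hu hv => ?_, fun u hu => ?_, fun u hu => ?_⟩
        · rw [hprom, hprom]; exact hs.cross u v huv hu hv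
        · rw [hprom, if_pos (show ((t.colored χ).type u).1 = 2 from hu)]
          split_ifs with hc
          · exact hc u hu
          · exact Nat.zero_le _
        · have : ((t.colored χ).type u).1 = 1 := hu
          rw [hprom, if_neg (by omega)]
          exact Colored.size_le _ _)
  have hcard := Colored.innerCard_of_total_eq htot
  refine ⟨χ', hI, ⟨?_, fun u v huv hu hv => ?_⟩, hcard, fun hc u hu => ?_⟩
  · rw [hcard]; exact hs.pos
  · have := hok.cross u v huv hu hv
    rwa [hprom, hprom] at this
  · have := hok.inner u hu
    rw [hprom, if_pos (show ((t.colored χ').type u).1 = 2 from hu), if_pos hc] at this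
    rwa [hcard]

end SafeSet

/-! ### Syntactic cost bounds and reasoning about programs. -/

namespace SafeSet.RAM

/-! ## Cost -/

/-- The largest number of nested loops over parameters in `P`. -/
def Expr.depth (P : ℕ → Bool) : Expr → ℕ
  | op _ a b => max (a.depth P) (b.depth P)
  | get _ a b c => max (a.depth P) (max (b.depth P) (c.depth P))
  | sum _ k e => e.depth P + (P k).toNat
  | _ => 0

/-- The constant factor of the cost, where the parameter `k` contributes a factor `κ k`. -/
def Expr.coef (κ : ℕ → ℕ) : Expr → ℕ
  | op _ a b => a.coef κ + b.coef κ + 4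
  | get _ a b c => a.coef κ + b.coef κ + c.coef κ + 10
  | sum _ k e => κ k * (e.coef κ + 8) + 5
  | _ => 1

/-- The largest number of nested loops over parameters in `P`. -/
def Cmd.depth (P : ℕ → Bool) : Cmd → ℕ
  | skip => 0
  | set _ e => e.depth P
  | put _ a b c e => max (max (a.depth P) (b.depth P)) (max (c.depth P) (e.depth P))
  | seq p q => max (p.depth P) (q.depth P)
  | ite e p q => max (e.depth P) (max (p.depth P) (q.depth P))
  | .forLt _ k p => p.depth P + (P k).toNat

/-- The constant factor of the cost, where the parameter `k` contributes a factor `κ k`. -/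
def Cmd.coef (κ : ℕ → ℕ) : Cmd → ℕ
  | skip => 1
  | set _ e => e.coef κ + 1
  | put _ a b c e => a.coef κ + b.coef κ + c.coef κ + e.coef κ + 10
  | seq p q => p.coef κ + q.coef κ
  | ite e p q => e.coef κ + p.coef κ + q.coef κ + 1
  | .forLt _ k p => κ k * (p.coef κ + 4) + 2

section

variable {ρ κ : ℕ → ℕ} {P Q : ℕ → Bool} {x y : ℕ}

theorem pow_mul_pow_mono (hx : 1 ≤ x) (hy : 1 ≤ y) {a b a' b' : ℕ} (ha : a ≤ a') (hb : b ≤ b') :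
    x ^ a * y ^ b ≤ x ^ a' * y ^ b' :=
  Nat.mul_le_mul (Nat.pow_le_pow_right hx ha) (Nat.pow_le_pow_right hy hb)

/-- A loop multiplies the cost of its body by a parameter of order 1, `x`, `y` or `x * y`, so the
exponents of the two variables count nested loops of the two kinds. The variable `x` will be the
order of the number of states and `y` the number of vertices. -/
theorem loop_cost_le (hx : 1 ≤ x) (hy : 1 ≤ y)
    (hρ : ∀ k, ρ k ≤ κ k * (x ^ (P k).toNat * y ^ (Q k).toNat)) {k C K a b r s : ℕ}
    (h : C ≤ K * (x ^ a * y ^ b)) : ρ k * (C + r) + s ≤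
      (κ k * (K + r) + s) * (x ^ (a + (P k).toNat) * y ^ (b + (Q k).toNat)) := by
  have h1 : 1 ≤ x ^ a * y ^ b := Nat.mul_pos (Nat.pow_pos hx) (Nat.pow_pos hy)
  have h2 : C + r ≤ (K + r) * (x ^ a * y ^ b) := by nlinarith
  have h3 := Nat.mul_le_mul (hρ k) h2
  have h4 : 1 ≤ x ^ (a + (P k).toNat) * y ^ (b + (Q k).toNat) :=
    Nat.mul_pos (Nat.pow_pos hx) (Nat.pow_pos hy)
  have h5 : κ k * (x ^ (P k).toNat * y ^ (Q k).toNat) * ((K + r) * (x ^ a * y ^ b)) =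
      κ k * (K + r) * (x ^ (a + (P k).toNat) * y ^ (b + (Q k).toNat)) := by
    rw [pow_add, pow_add]; ring
  rw [h5] at h3
  nlinarith

theorem Expr.cost_le (hx : 1 ≤ x) (hy : 1 ≤ y)
    (hρ : ∀ k, ρ k ≤ κ k * (x ^ (P k).toNat * y ^ (Q k).toNat)) (e : Expr) :
    e.cost ρ ≤ e.coef κ * (x ^ e.depth P * y ^ e.depth Q) := by
  have up : ∀ {C K a b a' b' : ℕ}, C ≤ K * (x ^ a * y ^ b) → a ≤ a' → b ≤ b' →
      C ≤ K * (x ^ a' * y ^ b') := fun h ha hb =>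
    h.trans (Nat.mul_le_mul_left _ (pow_mul_pow_mono hx hy ha hb))
  induction e with
  | lit k => simp [cost, coef, depth]
  | var k => simp [cost, coef, depth]
  | par k => simp [cost, coef, depth]
  | op o a b iha ihb =>
    simp only [cost, coef, depth]
    have h1 := up iha (le_max_left (a.depth P) (b.depth P)) (le_max_left (a.depth Q) (b.depth Q))
    have h2 := up ihb (le_max_right (a.depth P) (b.depth P)) (le_max_right (a.depth Q) (b.depth Q))
    have h3 : 1 ≤ x ^ max (a.depth P) (b.depth P) * y ^ max (a.depth Q) (b.depth Q) :=
      Nat.mul_pos (Nat.pow_pos hx) (Nat.pow_pos hy)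
    nlinarith
  | get k a b c iha ihb ihc =>
    simp only [cost, coef, depth]
    set p := max (a.depth P) (max (b.depth P) (c.depth P))
    set q := max (a.depth Q) (max (b.depth Q) (c.depth Q))
    have h1 := up iha (a' := p) (b' := q) (by omega) (by omega)
    have h2 := up ihb (a' := p) (b' := q) (by omega) (by omega)
    have h3 := up ihc (a' := p) (b' := q) (by omega) (by omega)
    have h4 : 1 ≤ x ^ p * y ^ q := Nat.mul_pos (Nat.pow_pos hx) (Nat.pow_pos hy)
    nlinarith
  | sum z k e ih => exact loop_cost_le hx hy hρ ih

theorem Cmd.cost_le (hx : 1 ≤ x) (hy : 1 ≤ y)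
    (hρ : ∀ k, ρ k ≤ κ k * (x ^ (P k).toNat * y ^ (Q k).toNat)) (p : Cmd) :
    p.cost ρ ≤ p.coef κ * (x ^ p.depth P * y ^ p.depth Q) := by
  have up : ∀ {C K a b a' b' : ℕ}, C ≤ K * (x ^ a * y ^ b) → a ≤ a' → b ≤ b' →
      C ≤ K * (x ^ a' * y ^ b') := fun h ha hb =>
    h.trans (Nat.mul_le_mul_left _ (pow_mul_pow_mono hx hy ha hb))
  have ec := fun e : Expr => e.cost_le hx hy hρ
  induction p with
  | skip => simp [cost, coef, depth]
  | set z e =>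
    simp only [cost, coef, depth]
    have h1 := ec e
    have h3 : 1 ≤ x ^ e.depth P * y ^ e.depth Q := Nat.mul_pos (Nat.pow_pos hx) (Nat.pow_pos hy)
    nlinarith
  | put k a b c e =>
    simp only [cost, coef, depth]
    set p := max (max (a.depth P) (b.depth P)) (max (c.depth P) (e.depth P))
    set q := max (max (a.depth Q) (b.depth Q)) (max (c.depth Q) (e.depth Q))
    have h1 := up (ec a) (a' := p) (b' := q) (by omega) (by omega)
    have h2 := up (ec b) (a' := p) (b' := q) (by omega) (by omega)
    have h3 := up (ec c) (a' := p) (b' := q) (by omega) (by omega)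
    have h4 := up (ec e) (a' := p) (b' := q) (by omega) (by omega)
    have h5 : 1 ≤ x ^ p * y ^ q := Nat.mul_pos (Nat.pow_pos hx) (Nat.pow_pos hy)
    nlinarith
  | seq p q ihp ihq =>
    simp only [cost, coef, depth]
    have h1 := up ihp (le_max_left (p.depth P) (q.depth P)) (le_max_left (p.depth Q) (q.depth Q))
    have h2 := up ihq (le_max_right (p.depth P) (q.depth P)) (le_max_right (p.depth Q) (q.depth Q))
    nlinarith
  | ite e p q ihp ihq =>
    simp only [cost, coef, depth]
    set r := max (e.depth P) (max (p.depth P) (q.depth P))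
    set r' := max (e.depth Q) (max (p.depth Q) (q.depth Q))
    have h1 := up (ec e) (a' := r) (b' := r') (by omega) (by omega)
    have h2 := up ihp (a' := r) (b' := r') (by omega) (by omega)
    have h3 := up ihq (a' := r) (b' := r') (by omega) (by omega)
    have h4 : 1 ≤ x ^ r * y ^ r' := Nat.mul_pos (Nat.pow_pos hx) (Nat.pow_pos hy)
    nlinarith
  | forLt z k p ih => exact loop_cost_le hx hy hρ ih

end

/-! ## Frames and loop invariants -/

namespace Cmd

/-- The registers that a command may change. -/
def regs : Cmd → List ℕ
  | skip => []
  | set x _ => [x]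
  | put _ _ _ _ _ => []
  | seq p q => p.regs ++ q.regs
  | ite _ p q => p.regs ++ q.regs
  | .forLt x _ p => x :: p.regs

/-- The arrays that a command may change. -/
def arrs : Cmd → List (Fin 16)
  | skip => []
  | set _ _ => []
  | put k _ _ _ _ => [k]
  | seq p q => p.arrs ++ q.arrs
  | ite _ p q => p.arrs ++ q.arrs
  | .forLt _ _ p => p.arrs

variable {ρ : ℕ → ℕ}

theorem eval_for (x k : ℕ) (p : Cmd) (s : Store) (I : ℕ → Store → Prop) (h0 : I 0 s)
    (hstep : ∀ t s', t < ρ k → I t s' → I (t + 1) (p.eval ρ (s'.setReg x t))) :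
    I (ρ k) ((Cmd.forLt x k p).eval ρ s) := by
  have : ∀ N ≤ ρ k, I N (iter (fun t s => p.eval ρ (s.setReg x t)) N s) := by
    intro N
    induction N with
    | zero => exact fun _ => h0
    | succ N ih => exact fun hN => hstep N _ hN (ih (by omega))
  exact this _ le_rfl

/-- The lists `regs` and `arrs` are computed from the syntax, so for a concrete program `decide`
finds what is left unchanged. -/
theorem frame (p : Cmd) (s : Store) : (∀ r, r ∉ p.regs → (p.eval ρ s).reg r = s.reg r) ∧
    ∀ A, A ∉ p.arrs → (p.eval ρ s).arr A = s.arr A := by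
  induction p generalizing s with
  | skip => exact ⟨fun _ _ => rfl, fun _ _ => rfl⟩
  | set x e => exact ⟨fun r hr => by simp_all [regs, eval], fun _ _ => rfl⟩
  | put k a b c e =>
    refine ⟨fun _ _ => rfl, fun A hA => ?_⟩
    ext i j l
    simp_all [arrs, eval]
  | seq p q ihp ihq =>
    simp only [regs, arrs, List.mem_append, not_or, eval]
    exact ⟨fun r hr => ((ihq _).1 r hr.2).trans ((ihp _).1 r hr.1),
      fun r hr => ((ihq _).2 r hr.2).trans ((ihp _).2 r hr.1)⟩
  | ite e p q ihp ihq =>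
    simp only [regs, arrs, List.mem_append, not_or, eval]
    split_ifs
    · exact ⟨fun r hr => (ihp _).1 r hr.1, fun r hr => (ihp _).2 r hr.1⟩
    · exact ⟨fun r hr => (ihq _).1 r hr.2, fun r hr => (ihq _).2 r hr.2⟩
  | forLt x k p ih =>
    refine eval_for (ρ := ρ) x k p s (fun _ s' => (∀ r,
      r ∉ (Cmd.forLt x k p).regs → s'.reg r = s.reg r) ∧
      ∀ A, A ∉ (Cmd.forLt x k p).arrs → s'.arr A = s.arr A) ⟨fun _ _ => rfl, fun _ _ => rfl⟩ ?_
    intro t s' _ hs'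
    simp only [regs, arrs, List.mem_cons, not_or] at hs' ⊢
    refine ⟨fun r hr => ?_, fun A hA => ?_⟩
    · rw [(ih _).1 r hr.2, Store.setReg_reg, if_neg hr.1]
      exact hs'.1 r hr
    · rw [(ih _).2 A hA]
      exact hs'.2 A hA

theorem frame_reg {p : Cmd} {s : Store} {r : ℕ} (h : r ∉ p.regs) : (p.eval ρ s).reg r = s.reg r :=
  (frame p s).1 r h

theorem frame_arr {p : Cmd} {s : Store} {A : Fin 16} (h : A ∉ p.arrs) :
    (p.eval ρ s).arr A = s.arr A := (frame p s).2 A h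

/-- A loop invariant for which the frame of the loop is available. -/
theorem eval_for_frame (x k : ℕ) (p : Cmd) (s : Store) (I : ℕ → Store → Prop) (h0 : I 0 s)
    (hstep : ∀ t s', t < ρ k → (∀ r, r ∉ (Cmd.forLt x k p).regs → s'.reg r = s.reg r) →
      (∀ A, A ∉ (Cmd.forLt x k p).arrs → s'.arr A = s.arr A) → I t s' →
      I (t + 1) (p.eval ρ (s'.setReg x t))) :
    I (ρ k) ((Cmd.forLt x k p).eval ρ s) := by
  refine (eval_for (ρ := ρ) x k p s (fun t s' => I t s' ∧
    (∀ r, r ∉ (Cmd.forLt x k p).regs → s'.reg r = s.reg r) ∧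
      ∀ A, A ∉ (Cmd.forLt x k p).arrs → s'.arr A = s.arr A)
    ⟨h0, fun _ _ => rfl, fun _ _ => rfl⟩ fun t s' ht hs' =>
      ⟨hstep t s' ht hs'.2.1 hs'.2.2 hs'.1, ?_⟩).1
  simp only [regs, arrs, List.mem_cons, not_or] at hs' ⊢
  refine ⟨fun r hr => ?_, fun A hA => ?_⟩
  · rw [frame_reg hr.2, Store.setReg_reg, if_neg hr.1]
    exact hs'.2.1 r hr
  · rw [frame_arr hA]
    exact hs'.2.2 A hA

/-- A loop that fills a row of an array. -/
theorem eval_for_put (x k : ℕ) (A : Fin 16) (ei ej el e : Expr) (s : Store) (o j l : ℕ) (f : ℕ → ℕ)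
    (h : ∀ t (s' : Store), t < ρ k → (∀ r, r ≠ x → s'.reg r = s.reg r) →
      (∀ B, B ≠ A → s'.arr B = s.arr B) →
      (∀ i' j' l', s'.arr A i' j' l' =
        if (o ≤ i' ∧ i' < o + t) ∧ j' = j ∧ l' = l then f (i' - o) else s.arr A i' j' l') →
      ei.val ρ (s'.setReg x t) = o + t ∧ ej.val ρ (s'.setReg x t) = j ∧
      el.val ρ (s'.setReg x t) = l ∧ e.val ρ (s'.setReg x t) = f t) (i' j' l' : ℕ) :
    ((Cmd.forLt x k (put A ei ej el e)).eval ρ s).arr A i' j' l' =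
      if (o ≤ i' ∧ i' < o + ρ k) ∧ j' = j ∧ l' = l then f (i' - o) else s.arr A i' j' l' := by
  refine eval_for_frame (ρ := ρ) x k _ s (fun t s' => ∀ i' j' l', s'.arr A i' j' l' =
    if (o ≤ i' ∧ i' < o + t) ∧ j' = j ∧ l' = l then f (i' - o) else s.arr A i' j' l') ?_ ?_ i' j' l'
  · intro i' j' l'
    rw [if_neg (by omega)]
  · intro t s' ht hr hA hs' i' j' l'
    obtain ⟨h1, h2, h3, h4⟩ := h t s' ht (fun r hr' => hr r (by simp [regs, hr']))
      (fun B hB => hA B (by simp [arrs, hB])) hs'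
    simp only [eval, Store.setArr_arr, Store.setReg_arr, h1, h2, h3, h4, hs' i' j' l', true_and]
    by_cases hi : i' = o + t
    · subst hi
      by_cases hj : j' = j ∧ l' = l
      · rw [if_pos ⟨rfl, hj⟩, if_pos (by omega), Nat.add_sub_cancel_left]
      · rw [if_neg (fun h => hj h.2), if_neg (fun h => hj h.2), if_neg (fun h => hj h.2)]
    · rw [if_neg (fun h => hi h.1)]
      exact if_congr (and_congr_left fun _ => by omega) rfl rfl

/-- Two nested loops that fill a layer of an array. -/
theorem eval_for_for_put (x y k k' : ℕ) (A : Fin 16) (el e : Expr) (s : Store) (l : ℕ)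
    (f : ℕ → ℕ → ℕ) (hxy : x ≠ y)
    (h : ∀ t u (s' : Store), t < ρ k → u < ρ k' → (∀ r, r ≠ x → r ≠ y → s'.reg r = s.reg r) →
      s'.reg x = t →
      s'.reg y = u → (∀ B, B ≠ A → s'.arr B = s.arr B) →
      (∀ i' j' l', ((i' = t ∧ j' = u) ∨ l' ≠ l) → s'.arr A i' j' l' = s.arr A i' j' l') →
      el.val ρ s' = l ∧ e.val ρ s' = f t u) (i' j' l' : ℕ) :
    ((Cmd.forLt x k (Cmd.forLt y k' (put A (.var x) (.var y) el e))).eval ρ s).arr A i' j' l' =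
      if i' < ρ k ∧ j' < ρ k' ∧ l' = l then f i' j' else s.arr A i' j' l' := by
  refine eval_for_frame (ρ := ρ) x k _ s (fun t s' => ∀ i' j' l', s'.arr A i' j' l' =
    if i' < t ∧ j' < ρ k' ∧ l' = l then f i' j' else s.arr A i' j' l') ?_ ?_ i' j' l'
  · intro i' j' l'
    rw [if_neg (by omega)]
  · intro t s₁ ht hr hA hs₁ i' j' l'
    have key := eval_for_frame (ρ := ρ) y k' (put A (.var x) (.var y) el e) (s₁.setReg x t)
      (fun u s' => ∀ i' j' l', s'.arr A i' j' l' =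
        if i' = t ∧ j' < u ∧ l' = l then f i' j' else s₁.arr A i' j' l') ?_ ?_ i' j' l'
    · rw [key, hs₁]
      by_cases hi : i' = t
      · subst hi
        by_cases hj : j' < ρ k' ∧ l' = l
        · rw [if_pos ⟨rfl, hj⟩, if_pos ⟨by omega, hj⟩]
        · rw [if_neg (fun h => hj h.2), if_neg (fun h => hj h.2), if_neg (fun h => hj h.2)]
      · rw [if_neg (fun h => hi h.1)]
        exact if_congr (and_congr_left fun _ => by omega) rfl rfl
    · intro i' j' l'
      rw [if_neg (by omega)]; rfl
    · intro u s' hu hr' hA' hs' i' j' l'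
      have hx : s'.reg x = t := by rw [hr' x (by simp [regs, hxy])]; simp
      obtain ⟨h1, h2⟩ := h t u (s'.setReg y u) ht hu
        (fun r hrx hry => by
          simp only [Store.setReg_reg, if_neg hry]
          rw [hr' r (by simp [regs, hry]), Store.setReg_reg, if_neg hrx,
            hr r (by simp [regs, hrx, hry])])
        (by simp [hxy, hx]) (by simp)
        (fun B hB => by
          rw [Store.setReg_arr, hA' B (by simp [arrs, hB]), Store.setReg_arr,
            hA B (by simp [arrs, hB])])
        (fun i' j' l' hij => by rw [Store.setReg_arr, hs', hs₁, if_neg (by omega),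
          if_neg (by omega)])
      simp only [eval, Store.setArr_arr, Store.setReg_arr, h1, h2, hs' i' j' l', true_and, Expr.val,
        Store.setReg_reg, if_neg hxy, hx, if_true]
      by_cases hj : j' = u
      · subst hj
        by_cases hi : i' = t ∧ l' = l
        · obtain ⟨rfl, rfl⟩ := hi
          rw [if_pos ⟨rfl, rfl, rfl⟩, if_pos ⟨rfl, by omega, rfl⟩]
        · rw [if_neg (by tauto), if_neg (by tauto), if_neg (by tauto)]
      · rw [if_neg (by tauto)]
        exact if_congr (by constructor <;> (rintro ⟨h1, h2, h3⟩; exact ⟨h1, by omega, h3⟩)) rfl rfl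

end Cmd

/-! ## Truth values of expressions -/

namespace Expr

instance : Add Expr := ⟨op .add⟩
instance : Sub Expr := ⟨op .sub⟩
instance : Mul Expr := ⟨op .mul⟩
instance : Div Expr := ⟨op .div⟩
instance : Mod Expr := ⟨op .mod⟩

/-- The truth value of `a = b`. -/
def eq (a b : Expr) : Expr := op .eq a b
/-- The truth value of `a < b`. -/
def lt (a b : Expr) : Expr := op .lt a b

variable (ρ : ℕ → ℕ) (s : Store) (a b : Expr)

@[simp] theorem val_lit (k : Fin 8) : (lit k).val ρ s = k := rfl
@[simp] theorem val_var (x : ℕ) : (var x).val ρ s = s.reg x := rfl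
@[simp] theorem val_par (k : ℕ) : (par k).val ρ s = ρ k := rfl
@[simp] theorem val_get (k : Fin 16) (c : Expr) :
    (get k a b c).val ρ s = s.arr k (a.val ρ s) (b.val ρ s) (c.val ρ s) := rfl
@[simp] theorem val_add : (a + b).val ρ s = min (a.val ρ s + b.val ρ s) (ρ 0) := rfl
@[simp] theorem val_sub : (a - b).val ρ s = a.val ρ s - b.val ρ s := rfl
@[simp] theorem val_mul : (a * b).val ρ s = min (a.val ρ s * b.val ρ s) (ρ 0) := rfl
@[simp] theorem val_div : (a / b).val ρ s = a.val ρ s / b.val ρ s := rfl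
@[simp] theorem val_mod : (a % b).val ρ s = a.val ρ s % b.val ρ s := rfl
@[simp] theorem val_eq : (eq a b).val ρ s = if a.val ρ s = b.val ρ s then 1 else 0 := rfl
@[simp] theorem val_lt : (lt a b).val ρ s = if a.val ρ s < b.val ρ s then 1 else 0 := rfl

theorem val_sum (x k : ℕ) : (sum x k a).val ρ s =
    min (∑ t ∈ Finset.range (ρ k), a.val ρ (s.setReg x t)) (ρ 0) := rfl

/-- The value of the expression, read as a truth value. -/
def Holds : Prop := a.val ρ s ≠ 0

variable {ρ s a b}

theorem holds_eq : (eq a b).Holds ρ s ↔ a.val ρ s = b.val ρ s := by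
  simp [Holds]

theorem holds_lt : (lt a b).Holds ρ s ↔ a.val ρ s < b.val ρ s := by
  simp [Holds]

/-- Cutting off at a positive number never turns a non-zero value into 0. Hence products, sums and
bounded sums act as conjunction, disjunction and bounded existential quantifier despite saturation.
-/
theorem holds_mul (h : 0 < ρ 0) : (a * b).Holds ρ s ↔ a.Holds ρ s ∧ b.Holds ρ s := by
  simp only [Holds, val_mul]
  rw [← Nat.pos_iff_ne_zero, lt_min_iff, Nat.pos_iff_ne_zero, Nat.mul_ne_zero_iff]
  exact and_iff_left h

theorem holds_add (h : 0 < ρ 0) : (a + b).Holds ρ s ↔ a.Holds ρ s ∨ b.Holds ρ s := by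
  simp only [Holds, val_add]
  omega

theorem holds_sum (h : 0 < ρ 0) {x k : ℕ} :
    (sum x k a).Holds ρ s ↔ ∃ t < ρ k, a.Holds ρ (s.setReg x t) := by
  simp only [Holds, val_sum]
  rw [← Nat.pos_iff_ne_zero, lt_min_iff, and_iff_left h, Nat.pos_iff_ne_zero, ne_eq,
    Finset.sum_eq_zero_iff]
  simp

/-- The truth value of the negation. -/
def not (a : Expr) : Expr := eq a (lit 0)

theorem holds_not : (not a).Holds ρ s ↔ ¬ a.Holds ρ s := by
  rw [not, holds_eq]
  simp [Holds]

end Expr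

end SafeSet.RAM

/-! ### Bounded reachability and the encoding of types and states by numbers. -/

namespace SafeSet

/-! ## Reachability in a bounded number of steps -/

/-- `w` is reached from `u` in at most `k` steps. -/
def Within {V : Type*} (r : V → V → Prop) : ℕ → V → V → Prop
  | 0, u, w => u = w
  | k + 1, u, w => Within r k u w ∨ ∃ v, Within r k u v ∧ r v w

theorem Within.reflTransGen {V : Type*} {r : V → V → Prop} {k : ℕ} {u w : V}
    (h : Within r k u w) : Relation.ReflTransGen r u w := by
  induction k generalizing w with
  | zero => exact h ▸ .refl
  | succ k ih =>
    rcases h with h | ⟨v, h, hr⟩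
    · exact ih h
    · exact (ih h).tail hr

/-- The set of vertices reached in at most `k` steps grows strictly with `k` until it is closed
under `r`, so it is closed after `Fintype.card V` rounds at the latest. -/
theorem within_card_iff {V : Type*} [Fintype V] {r : V → V → Prop} {u w : V} :
    Within r (Fintype.card V) u w ↔ Relation.ReflTransGen r u w := by
  classical
  refine ⟨Within.reflTransGen, fun h => ?_⟩
  -- After `k` rounds the set is closed or has at least `k + 1` elements; the latter is impossible
  -- for `k = Fintype.card V`.
  have key : ∀ k, (∀ v w, Within r k u v → r v w → Within r k u w) ∨
      k + 1 ≤ (Finset.univ.filter (Within r k u)).card := by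
    intro k
    induction k with
    | zero => exact .inr (Finset.card_pos.mpr ⟨u, Finset.mem_filter.mpr ⟨Finset.mem_univ _, rfl⟩⟩)
    | succ k ih =>
      rcases ih with ih | ih
      · have hk : ∀ w, Within r (k + 1) u w → Within r k u w := fun w h =>
          h.elim id fun ⟨v, h1, h2⟩ => ih v w h1 h2
        exact .inl fun v w h1 h2 => .inl (ih v w (hk v h1) h2)
      · by_cases hc : ∀ v w, Within r k u v → r v w → Within r k u w
        · have hk : ∀ w, Within r (k + 1) u w → Within r k u w := fun w h =>
            h.elim id fun ⟨v, h1, h2⟩ => hc v w h1 h2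
          exact .inl fun v w h1 h2 => .inl (hc v w (hk v h1) h2)
        · push Not at hc
          obtain ⟨v, w, h1, h2, h3⟩ := hc
          refine .inr (Nat.lt_of_le_of_lt ih (Finset.card_lt_card ?_))
          rw [Finset.ssubset_iff_of_subset]
          · exact ⟨w, Finset.mem_filter.mpr ⟨Finset.mem_univ _, .inr ⟨v, h1, h2⟩⟩,
                by simpa using h3⟩
          · intro x hx
            simp only [Finset.mem_filter, Finset.mem_univ, true_and] at hx ⊢
            exact .inl hx
  have hclosed := (key (Fintype.card V)).resolve_right fun h =>
    absurd (h.trans (Finset.card_le_univ _)) (by omega)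
  have h0 : ∀ k, Within r k u u := fun k => by
    induction k with
    | zero => rfl
    | succ k ih => exact .inl ih
  induction h with
  | refl => exact h0 _
  | tail _ h ih => exact hclosed _ _ ih h

/-! ## Numbering types and states -/

/-- The number of a component type. -/
def encode (c : ℕ) (τ : ℕ × Finset ℕ) : ℕ := (τ.1 - 1) * 2 ^ c + ∑ i ∈ τ.2, 2 ^ i

/-- The types that occur for coloured graphs with labels below `c`. -/
def ProperType (c : ℕ) : Set (ℕ × Finset ℕ) := {τ | 1 ≤ τ.1 ∧ τ.1 ≤ 2 ∧ ∀ i ∈ τ.2, i < c}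

theorem sum_two_pow_lt {c : ℕ} {L : Finset ℕ} (h : ∀ i ∈ L, i < c) : ∑ i ∈ L, 2 ^ i < 2 ^ c :=
  Nat.geomSum_lt le_rfl h

theorem encode_lt {c : ℕ} {τ : ℕ × Finset ℕ} (h : τ ∈ ProperType c) : encode c τ < 2 * 2 ^ c := by
  have h1 := sum_two_pow_lt h.2.2
  have h2 : (τ.1 - 1) * 2 ^ c ≤ 1 * 2 ^ c := Nat.mul_le_mul_right _ (by have := h.2.1; omega)
  unfold encode
  omega

/-- The label set is read as a binary number below `2 ^ c`, and the colour minus 1 is the bit above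
it. -/
theorem encode_injOn (c : ℕ) : Set.InjOn (encode c) (ProperType c) := by
  rintro ⟨a, L⟩ ⟨ha1, ha2, hL⟩ ⟨b, M⟩ ⟨hb1, hb2, hM⟩ h
  have h1 := sum_two_pow_lt hL
  have h2 := sum_two_pow_lt hM
  simp only [encode] at *
  have hab : a = b := by
    rcases (by omega : a = 1 ∨ a = 2) with rfl | rfl <;>
      rcases (by omega : b = 1 ∨ b = 2) with rfl | rfl <;> simp at h ⊢ <;> omega
  subst hab
  exact Prod.ext rfl (Finset.geomSum_injective le_rfl (Nat.add_left_cancel h))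

/-- The digit at position `e` of `q` in base `b`. -/
def digit (b q e : ℕ) : ℕ := q / b ^ e % b

theorem exists_digits {b k : ℕ} (f : ℕ → ℕ) (hf : ∀ e < k, f e < b) :
    ∃ q < b ^ k, ∀ e < k, digit b q e = f e := by
  refine ⟨finFunctionFinEquiv fun e : Fin k => (⟨f e, hf e e.2⟩ : Fin b), Fin.is_lt _, ?_⟩
  intro e he
  have h := congrFun (finFunctionFinEquiv.symm_apply_apply
    fun e : Fin k => (⟨f e, hf e e.2⟩ : Fin b)) ⟨e, he⟩
  exact congrArg Fin.val h

namespace Colored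

variable {V : Type*} [Fintype V]

/-- Colours are at most `2` and labels are below `c`. -/
structure Proper (c : ℕ) (X : Colored V) : Prop where
  col : ∀ u, X.col u ≤ 2
  lab : ∀ u, X.col u ≠ 0 → X.lab u < c

theorem Proper.labels {c : ℕ} {X : Colored V} (h : X.Proper c) {u : V} (hu : X.col u ≠ 0) :
    ∀ i ∈ X.labels u, i < c := by
  intro i hi
  obtain ⟨v, hv, rfl⟩ := mem_labels.mp hi
  exact h.lab v (hv.col_eq ▸ hu)

theorem Proper.type {c : ℕ} {X : Colored V} (h : X.Proper c) {u : V} (hu : X.col u ≠ 0) :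
    X.type u ∈ ProperType c := ⟨Nat.pos_of_ne_zero hu, h.col u, h.labels hu⟩

open Classical in
/-- The coloured graph conforms to the promises, thresholds and numbers of vertices that are
encoded by the digits of `q` in base `b`. -/
structure Meets (c b q : ℕ) (X : Colored V) : Prop where
  ok : X.Ok (fun τ => digit b q (encode c τ)) (fun τ => digit b q (encode c τ + 2 * 2 ^ c))
  total : ∀ e < 2 * 2 ^ c, Finset.card {u | X.col u ≠ 0 ∧ encode c (X.type u) = e} =
    digit b q (e + 2 * 2 ^ c + 2 * 2 ^ c)

theorem Ok.congr {c : ℕ} {X : Colored V} (hX : X.Proper c) {φ θ φ' θ' : ℕ × Finset ℕ → ℕ}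
    (h : X.Ok φ θ) (hφ : ∀ τ ∈ ProperType c, φ τ = φ' τ) (hθ : ∀ τ ∈ ProperType c, θ τ = θ' τ) :
    X.Ok φ' θ' := by
  have hp : ∀ u, X.col u ≠ 0 → X.promised φ u = X.promised φ' u := fun u hu => by
    rw [promised, promised, hφ _ (hX.type hu)]
  refine ⟨fun u v huv hu hv => ?_, fun u hu => ?_, fun u hu => ?_⟩
  · rw [← hp u (by omega), ← hp v (by omega)]
    exact h.cross u v huv hu hv
  · rw [← hp u (by omega), ← hθ _ (hX.type (by omega))]
    exact h.inner u hu
  · rw [← hp u (by omega), ← hθ _ (hX.type (by omega))]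
    exact h.outer u hu

/-- Promises, thresholds and totals are numbers below `b`, one of each for every type. Hence they
fit into the `3 * (2 * 2 ^ c)` base-`b` digits of one number `q`, and meeting `q` gives back
everything a representative has to satisfy. -/
theorem exists_meets {c b : ℕ} (hb : Fintype.card V < b) {X : Colored V} (hX : X.Proper c)
    {φ θ : ℕ × Finset ℕ → ℕ} (hφ : ∀ τ, φ τ ≤ Fintype.card V) (hθ : ∀ τ, θ τ ≤ Fintype.card V)
    (h : X.Ok φ θ) : ∃ q < b ^ (3 * (2 * 2 ^ c)), X.Meets c b q ∧ ∀ X' : Colored V, X'.Proper c →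
      X'.Meets c b q → X'.Ok φ θ ∧ ∀ τ, X'.total τ = X.total τ := by
  classical
  set Λ := 2 * 2 ^ c with hΛ
  have hne : Nonempty (ℕ × Finset ℕ) := ⟨(0, ∅)⟩
  -- A digit position is translated back into a type; positions that encode no proper type yield
  -- arbitrary but harmless values.
  set dec := Function.invFunOn (encode c) (ProperType c)
  have hdec : ∀ τ ∈ ProperType c, dec (encode c τ) = τ := fun τ hτ =>
    (encode_injOn c).leftInvOn_invFunOn hτ
  set cnt : ℕ → ℕ := fun e => Finset.card {u | X.col u ≠ 0 ∧ encode c (X.type u) = e}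
  obtain ⟨q, hq, hd⟩ := exists_digits (b := b) (k := 3 * Λ)
    (fun e => if e < Λ then φ (dec e) else if e < 2 * Λ then θ (dec (e - Λ)) else cnt (e - 2 * Λ))
    (fun e _ => by
      split_ifs
      · exact (hφ _).trans_lt hb
      · exact (hθ _).trans_lt hb
      · exact (Finset.card_le_univ _).trans_lt hb)
  have dφ : ∀ τ ∈ ProperType c, φ τ = digit b q (encode c τ) := fun τ hτ => by
    have := encode_lt hτ
    rw [hd _ (by omega), if_pos (by omega), hdec τ hτ]
  have dθ : ∀ τ ∈ ProperType c, θ τ = digit b q (encode c τ + Λ) := fun τ hτ => by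
    have := encode_lt hτ
    rw [hd _ (by omega), if_neg (by omega), if_pos (by omega), Nat.add_sub_cancel, hdec τ hτ]
  have dt : ∀ e < Λ, cnt e = digit b q (e + Λ + Λ) := fun e he => by
    rw [hd _ (by omega), if_neg (by omega), if_neg (by omega)]
    congr 1; omega
  refine ⟨q, hq, ⟨h.congr hX dφ dθ, dt⟩, fun X' hX' hm => ⟨?_, fun τ => ?_⟩⟩
  · exact hm.ok.congr hX' (fun τ hτ => (dφ τ hτ).symm) fun τ hτ => (dθ τ hτ).symm
  · by_cases hτ : τ ∈ ProperType c
    · have key : ∀ Y : Colored V, Y.Proper c → Y.total τ =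
          Finset.card {u | Y.col u ≠ 0 ∧ encode c (Y.type u) = encode c τ} := by
        intro Y hY
        rw [Colored.total]
        congr 1
        ext u
        simp only [Finset.mem_filter, Finset.mem_univ, true_and]
        exact and_congr_right fun hu => ((encode_injOn c).eq_iff (hY.type hu) hτ).symm
      rw [key X' hX', key X hX, hm.total _ (encode_lt hτ)]
      exact (dt _ (encode_lt hτ)).symm
    -- Types that are not proper have no digit, but they are not realised by present vertices
    -- either, so both totals vanish.
    · have key : ∀ Y : Colored V, Y.Proper c → Y.total τ = 0 := by
        intro Y hY
        rw [Colored.total, Finset.card_eq_zero, Finset.filter_eq_empty_iff]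
        exact fun u _ hu => hτ (hu.2 ▸ hY.type hu.1)
      rw [key X' hX', key X hX]

end Colored

end SafeSet

/-! ### The state test as an expression, and its correctness. -/

namespace SafeSet.RAM

/-! ## The tests of the algorithm

Parameters: `0` the largest number, `1` the number of vertices, `2` the number of labels, `3` the
number of nodes, `4` the number of component types, `5` the number of digits, `6` the number of
table entries.

Arrays: `0` input, `1` stack, `2` table of colourings, `3` valid table entries, `4` vertex sets of
the subexpressions, `5` labels, `6` adjacency, `7` reachability, `8` powers of the base, `9` powers
of two, `10` current colouring, `11` output.

Registers: `0` current node, `1`, `2`, `3` its code, `4`, `5` tables, `6` stack height, `7`, `8`,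
`9` table entries; those from `10` on are loop variables and intermediate results. -/

namespace Code

open RAM.Expr

def zero : Expr := lit 0
def one : Expr := lit 1
def two : Expr := lit 2

/-- The colour of the vertex in the register `x`. -/
def col (x : ℕ) : Expr := get 10 (var x) zero zero
def lab (x : ℕ) : Expr := get 5 (var x) zero zero
def adj (x y : ℕ) : Expr := get 6 (var x) (var y) zero
/-- Reachability within the component. -/
def reach (x y : ℕ) : Expr := get 7 (var x) (var y) (par 1)

def mono (x y : ℕ) : Expr := adj x y * (eq (col x) (col y) * lt zero (col x))

/-- Computes the components of the current colouring. -/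
def closure : Cmd :=
  .seq (.forLt 20 1 (.forLt 21 1 (.put 7 (var 20) (var 21) zero (eq (var 20) (var 21))))) <|
  .forLt 19 1 (.forLt 20 1 (.forLt 21 1 (.put 7 (var 20) (var 21) (var 19 + one)
    (lt zero (get 7 (var 20) (var 21) (var 19) +
      sum 22 1 (get 7 (var 20) (var 22) (var 19) * mono 22 21))))))

/-- The size of the component of a vertex. -/
def size (x : ℕ) : Expr := sum 25 1 (reach x 25)

/-- Whether the label in the register `y` occurs in the component of `x`. -/
def hasLabel (x y : ℕ) : Expr := lt zero (sum 23 1 (reach x 23 * eq (lab 23) (var y)))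

/-- The number of the type of the component of `x`. -/
def type (x : ℕ) : Expr :=
  (col x - one) * get 9 (par 2) zero zero + sum 22 2 (hasLabel x 22 * get 9 (var 22) zero zero)

/-- A digit of the number in the register `9`. -/
def digit (e : Expr) : Expr := (var 9 / get 8 e zero zero) % (par 1 + one)

/-- The promised size of the component of `x`. -/
def promised (x : ℕ) : Expr := digit (type x) + eq (digit (type x)) zero * size x

def badInner : Expr :=
  sum 20 1 (eq (col 20) two * lt (promised 20) (digit (type 20 + par 4)))

def badOuter : Expr :=
  sum 20 1 (eq (col 20) one * lt (digit (type 20 + par 4)) (promised 20))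

/-- An edge from an inner component of smaller size, as computed by `f`, to an outer component. -/
def badCross (f : ℕ → Expr) : Expr :=
  sum 20 1 (sum 21 1 (adj 20 21 * (eq (col 20) two * (eq (col 21) one * lt (f 20) (f 21)))))

/-- The factor `lt zero (col 20)` is essential: for an absent vertex truncated subtraction makes its
colour look like colour 1, and it must not be counted. -/
def badTotal : Expr :=
  sum 24 4 (Expr.not (eq (sum 20 1 (lt zero (col 20) * eq (type 20) (var 24)))
    (digit (var 24 + par 4 + par 4))))

/-- Whether the current colouring conforms to the state in the register `9`. -/
def meets : Expr := Expr.not (badInner + (badOuter + (badCross promised + badTotal)))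

end Code

/-- The values of the parameters. -/
structure Sizes (ρ : ℕ → ℕ) (n c : ℕ) : Prop where
  pos : 0 < n
  par1 : ρ 1 = n
  par2 : ρ 2 = c
  par4 : ρ 4 = 2 * 2 ^ c
  par5 : ρ 5 = 3 * (2 * 2 ^ c)
  par6 : ρ 6 = (n + 1) ^ (3 * (2 * 2 ^ c))
  vertices_le : 2 * n + 4 ≤ ρ 0
  nodes_le : 3 * ρ 3 + 8 ≤ ρ 0
  digits_le : 3 * (2 * 2 ^ c) ≤ ρ 0
  states_le : ρ 6 ≤ ρ 0

/-- The tables of powers. -/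
structure Powers (n c : ℕ) (s : Store) : Prop where
  base : ∀ e < 3 * (2 * 2 ^ c), s.arr 8 e 0 0 = (n + 1) ^ e
  two : ∀ i ≤ c, s.arr 9 i 0 0 = 2 ^ i

/-- The coloured graph in the memory. -/
def view (n : ℕ) (s : Store) : Colored (Fin n) where
  col v := s.arr 10 v 0 0
  lab v := s.arr 5 v 0 0
  adj u v := s.arr 6 u v 0 ≠ 0

open Classical in
/-- The array `7` holds the reachability relation. -/
def HasReach (n : ℕ) (s : Store) : Prop :=
  ∀ u v : Fin n, s.arr 7 u v n = if (view n s).Reach u v then 1 else 0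

theorem view_congr {n : ℕ} {s s' : Store} (h10 : s'.arr 10 = s.arr 10) (h5 : s'.arr 5 = s.arr 5)
    (h6 : s'.arr 6 = s.arr 6) : view n s' = view n s := by
  simp only [view, h10, h5, h6]

section

variable {ρ : ℕ → ℕ} {n c : ℕ} {s : Store}

open Code RAM.Expr

theorem Sizes.cap_pos (h : Sizes ρ n c) : 0 < ρ 0 := by have := h.vertices_le; omega

theorem holds_mono (h : Sizes ρ n c) {x y : ℕ} {u v : Fin n} (hx : s.reg x = u)
    (hy : s.reg y = v) : (Code.mono x y).Holds ρ s ↔ (view n s).Mono u v := by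
  rw [Code.mono, holds_mul h.cap_pos, holds_mul h.cap_pos, holds_eq, holds_lt]
  simp [Code.adj, Code.col, Code.zero, Holds, view, Colored.Mono, hx, hy, Nat.pos_iff_ne_zero]

theorem closure_arrs : Code.closure.arrs = [7, 7] := rfl

/-- Layer `k` of the array `7` holds reachability in at most `k` steps, and layer `n` is complete by
`within_card_iff`. The four nested loops over vertices, including the inner sum, dominate the
polynomial part of the running time. -/
theorem closure_spec (h : Sizes ρ n c) (s : Store) : HasReach n (Code.closure.eval ρ s) := by
  classical
  have hn := h.par1
  have hcap := h.vertices_le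
  have hview : view n (Code.closure.eval ρ s) = view n s :=
    view_congr (Cmd.frame_arr (by decide)) (Cmd.frame_arr (by decide)) (Cmd.frame_arr (by decide))
  intro u w
  rw [hview, Colored.Reach, ← within_card_iff, Fintype.card_fin]
  rw [Code.closure, Cmd.eval]
  set s₁ := Cmd.eval ρ (.forLt 20 1 (.forLt 21 1 (.put 7 (var 20) (var 21) zero
    (eq (var 20) (var 21))))) s
    with hs₁
  have hinit : ∀ u w : Fin n, s₁.arr 7 u w 0 = if Within (view n s).Mono 0 u w then 1 else 0 := by
    intro u w
    rw [hs₁, Cmd.eval_for_for_put (ρ := ρ) 20 21 1 1 7 zero (eq (var 20) (var 21)) s 0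
      (fun i j => if i = j then 1 else 0) (by decide)]
    · rw [if_pos ⟨by rw [hn]; exact u.2, by rw [hn]; exact w.2, rfl⟩]
      simp only [Within, Fin.ext_iff]
    · intro t u s' _ _ _ hx hy _ _
      simp [zero, hx, hy]
  have hview₁ : view n s₁ = view n s :=
    view_congr (Cmd.frame_arr (by decide)) (Cmd.frame_arr (by decide)) (Cmd.frame_arr (by decide))
  have := Cmd.eval_for_frame (ρ := ρ) 19 1 (.forLt 20 1
      (.forLt 21 1 (.put 7 (var 20) (var 21) (var 19 + one)
    (lt zero (get 7 (var 20) (var 21) (var 19) +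
      sum 22 1 (get 7 (var 20) (var 22) (var 19) * Code.mono 22 21)))))) s₁
    (fun k s' => ∀ u w : Fin n, s'.arr 7 u w k = if Within (view n s).Mono k u w then 1 else 0)
    hinit ?_
  · rw [hn] at this
    exact this u w
  · intro k s' hk _ hA hs' u w
    have hv' : view n s' = view n s := (view_congr (hA 10 (by decide)) (hA 5 (by decide))
      (hA 6 (by decide))).trans hview₁
    rw [Cmd.eval_for_for_put (ρ := ρ) 20 21 1 1 7 (var 19 + one) _ _ (k + 1)
      (fun i j => if ∃ (hi : i < n) (hj : j < n), Within (view n s).Mono (k + 1) ⟨i, hi⟩ ⟨j, hj⟩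
        then 1 else 0) (by decide)]
    · rw [if_pos ⟨by rw [hn]; exact u.2, by rw [hn]; exact w.2, rfl⟩]
      simp
    · intro a b s₂ ha hb hr hx hy hB hC
      rw [hn] at hk ha hb
      have h19 : s₂.reg 19 = k := by rw [hr 19 (by decide) (by decide)]; simp
      refine ⟨by simp [h19, one]; omega, ?_⟩
      have hv₂ : view n s₂ = view n s := (view_congr (hB 10 (by decide)) (hB 5 (by decide))
        (hB 6 (by decide))).trans hv'
      have h7 : ∀ i j : Fin n, s₂.arr 7 i j k = if Within (view n s).Mono k i j then 1 else 0 :=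
        fun i j => by rw [hC _ _ _ (.inr (by omega))]; exact hs' i j
      have hW : ∀ v : Fin n, ∀ s₃ : Store, s₃.reg 20 = a → s₃.reg 22 = v → s₃.reg 19 = k →
          s₃.arr = s₂.arr → ((get 7 (var 20) (var 22) (var 19)).Holds ρ s₃ ↔
            Within (view n s).Mono k ⟨a, ha⟩ v) := by
        intro v s₃ h20 h22 h19 harr
        have := h7 ⟨a, ha⟩ v
        simp only [Holds, val_get, val_var, h20, h22, h19, harr, this]
        split_ifs with hif <;> simp [hif]
      have h0 : (get 7 (var 20) (var 21) (var 19)).Holds ρ s₂ ↔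
          Within (view n s).Mono k ⟨a, ha⟩ ⟨b, hb⟩ := by
        have := h7 ⟨a, ha⟩ ⟨b, hb⟩
        simp only [Holds, val_get, val_var, hx, hy, h19, this]
        split_ifs with hif <;> simp [hif]
      have key : (get 7 (var 20) (var 21) (var 19) +
          sum 22 1 (get 7 (var 20) (var 22) (var 19) * Code.mono 22 21)).Holds ρ s₂ ↔
          ∃ (hi : a < n) (hj : b < n), Within (view n s).Mono (k + 1) ⟨a, hi⟩ ⟨b, hj⟩ := by
        rw [holds_add h.cap_pos, holds_sum h.cap_pos, h0]
        simp only [ha, hb, exists_true_left, Within]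
        refine or_congr_right ?_
        rw [hn]
        constructor
        · rintro ⟨t, ht, h1⟩
          rw [holds_mul h.cap_pos, hW ⟨t, ht⟩ (s₂.setReg 22 t) (by simp [hx]) (by simp)
            (by simp [h19]) rfl,
            holds_mono h (u := ⟨t, ht⟩) (v := ⟨b, hb⟩) (by simp) (by simp [hy])] at h1
          exact ⟨_, h1.1, by rw [← hv₂]; exact h1.2⟩
        · rintro ⟨v, h1, h2⟩
          refine ⟨v, v.2, ?_⟩
          rw [holds_mul h.cap_pos, hW v (s₂.setReg 22 v) (by simp [hx]) (by simp) (by simp [h19])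
            rfl,
            holds_mono h (u := v) (v := ⟨b, hb⟩) (by simp) (by simp [hy])]
          exact ⟨h1, by rw [← hv₂] at h2; exact h2⟩
      rw [val_lt]
      refine if_congr ?_ rfl rfl
      rw [← key, Holds, Nat.pos_iff_ne_zero.symm]
      rfl

/-! ### Values of the tests -/

/-- A count of vertices is at most `n`, which lies below the cut-off, so the bounded sum is exact.
-/
theorem val_count (h : Sizes ρ n c) {x : ℕ} {e : Expr} (p : Fin n → Prop) [DecidablePred p]
    (he : ∀ t : Fin n, e.val ρ (s.setReg x t) = if p t then 1 else 0) :
    (sum x 1 e).val ρ s = Finset.card {t | p t} := by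
  have hle : Finset.card {t | p t} ≤ n := by
    simpa using Finset.card_le_univ (Finset.univ.filter p)
  have := h.vertices_le
  rw [val_sum, h.par1, Finset.sum_range, Finset.sum_congr rfl fun t _ => he t,
    Finset.sum_boole]
  simp only [Nat.cast_id]
  omega

theorem val_reach (hR : HasReach n s) (h : Sizes ρ n c) {x y : ℕ} {u v : Fin n} (hx : s.reg x = u)
    (hy : s.reg y = v) [Decidable ((view n s).Reach u v)] :
    (Code.reach x y).val ρ s = if (view n s).Reach u v then 1 else 0 := by
  have := hR u v
  simp only [Code.reach, val_get, val_var, val_par, h.par1, hx, hy, this]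
  congr

theorem HasReach.setReg (hR : HasReach n s) (x v : ℕ) : HasReach n (s.setReg x v) := hR

@[simp] theorem view_setReg (x v : ℕ) : view n (s.setReg x v) = view n s := rfl

theorem val_size (hR : HasReach n s) (h : Sizes ρ n c) {x : ℕ} {u : Fin n} (hx : s.reg x = u)
    (hx' : x ≠ 25) : (Code.size x).val ρ s = (view n s).size u := by
  classical
  rw [Code.size, val_count h (fun v => (view n s).Reach u v)]
  · rfl
  · intro t
    rw [val_reach (hR.setReg 25 t) h (u := u) (v := t) (by simp [hx', hx]) (by simp)]
    rfl

theorem holds_hasLabel (hR : HasReach n s) (h : Sizes ρ n c) {x y i : ℕ} {u : Fin n}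
    (hx : s.reg x = u) (hx' : x ≠ 23) (hy : s.reg y = i) (hy' : y ≠ 23) :
    (Code.hasLabel x y).Holds ρ s ↔ i ∈ (view n s).labels u := by
  classical
  have e : (Code.hasLabel x y).Holds ρ s ↔
      (sum 23 1 (Code.reach x 23 * eq (Code.lab 23) (var y))).Holds ρ s := by
    rw [Code.hasLabel, holds_lt, Holds, ← Nat.pos_iff_ne_zero]
    rfl
  rw [e, holds_sum h.cap_pos, Colored.mem_labels, h.par1]
  have key : ∀ t : Fin n, (Code.reach x 23 * eq (Code.lab 23) (var y)).Holds ρ (s.setReg 23 t) ↔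
      (view n s).Reach u t ∧ (view n s).lab t = i := by
    intro t
    rw [holds_mul h.cap_pos, holds_eq, Holds,
      val_reach (hR.setReg 23 t) h (u := u) (v := t) (by simp [hx', hx]) (by simp), view_setReg]
    refine and_congr ?_ ?_
    · split_ifs with hif <;> simp [hif]
    · simp [Code.lab, Code.zero, view, hy', hy]
  constructor
  · rintro ⟨t, ht, hh⟩
    exact ⟨_, (key ⟨t, ht⟩).mp hh⟩
  · rintro ⟨t, ht⟩
    exact ⟨t, t.2, (key t).mpr ht⟩

theorem val_type (hR : HasReach n s) (h : Sizes ρ n c) (hP : Powers n c s)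
    (hX : (view n s).Proper c) {x : ℕ} {u : Fin n} (hx : s.reg x = u) (hx' : x < 22)
    (hu : (view n s).col u ≠ 0) : (Code.type x).val ρ s = encode c ((view n s).type u) := by
  classical
  have hd := h.digits_le
  have htwo : 1 ≤ 2 ^ c := Nat.one_le_two_pow
  have hsum : ∑ t ∈ Finset.range c, (Code.hasLabel x 22 * get 9 (var 22) zero zero).val ρ
      (s.setReg 22 t) = ∑ i ∈ (view n s).labels u, 2 ^ i := by
    have hsub : (Finset.range c).filter (· ∈ (view n s).labels u) = (view n s).labels u := by
      ext i
      simp only [Finset.mem_filter, Finset.mem_range, and_iff_right_iff_imp]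
      exact hX.labels hu i
    rw [← hsub, Finset.sum_filter]
    refine Finset.sum_congr rfl fun i hi => ?_
    have hic := Finset.mem_range.mp hi
    have hl := holds_hasLabel (ρ := ρ) (hR.setReg 22 i) h (x := x) (y := 22) (i := i) (u := u)
      (by simp [hx, show x ≠ 22 by omega]) (by omega) (by simp) (by decide)
    rw [view_setReg] at hl
    have h01 : (Code.hasLabel x 22).val ρ (s.setReg 22 i) =
        if i ∈ (view n s).labels u then 1 else 0 := by
      rw [← if_congr hl rfl rfl, Holds, Code.hasLabel, val_lt]
      split_ifs <;> simp_all
    have hp : 2 ^ i ≤ 2 ^ c := Nat.pow_le_pow_right (by omega) hic.le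
    rw [val_mul, h01]
    simp only [val_get, val_var, Code.zero, val_lit, Store.setReg_reg, Store.setReg_arr, if_true,
      Fin.isValue, Fin.val_zero]
    rw [hP.two i hic.le]
    split_ifs
    · rw [one_mul]; omega
    · simp
  have hlt := sum_two_pow_lt (hX.labels hu)
  have hcol := hX.col u
  have hcv : (Code.col x).val ρ s = (view n s).col u := by
    simp [Code.col, Code.zero, view, hx]
  have hmul : ((view n s).col u - 1) * 2 ^ c ≤ 1 * 2 ^ c := Nat.mul_le_mul_right _ (by omega)
  rw [Code.type, val_add, val_mul, val_sub, hcv, val_sum, h.par2, hsum]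
  simp only [Code.one, Code.zero, val_lit, val_get, val_par, h.par2, Fin.isValue, Fin.val_zero,
    Fin.val_one, hP.two c le_rfl]
  change _ = ((view n s).col u - 1) * 2 ^ c + ∑ i ∈ (view n s).labels u, 2 ^ i
  omega

theorem val_digit (h : Sizes ρ n c) (hP : Powers n c s) {e : Expr}
    (he : e.val ρ s < 3 * (2 * 2 ^ c)) :
    (Code.digit e).val ρ s = SafeSet.digit (n + 1) (s.reg 9) (e.val ρ s) := by
  have := h.vertices_le
  simp only [Code.digit, val_mod, val_div, val_var, val_get, Code.zero, Code.one, val_lit, val_add,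
    val_par, h.par1, Fin.isValue, Fin.val_zero, Fin.val_one, hP.base _ he, SafeSet.digit]
  rw [min_eq_left (by omega)]

theorem digit_le {b q e : ℕ} : SafeSet.digit (b + 1) q e ≤ b :=
  Nat.lt_succ_iff.mp (Nat.mod_lt _ (Nat.succ_pos b))

theorem val_promised (hR : HasReach n s) (h : Sizes ρ n c) (hP : Powers n c s)
    (hX : (view n s).Proper c) {x : ℕ} {u : Fin n} (hx : s.reg x = u) (hx' : x < 22)
    (hu : (view n s).col u ≠ 0) : (Code.promised x).val ρ s =
      (view n s).promised (fun τ => SafeSet.digit (n + 1) (s.reg 9) (encode c τ)) u := by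
  have ht := val_type (ρ := ρ) hR h hP hX hx hx' hu
  have hlt := encode_lt (hX.type hu)
  have hd := val_digit h hP (e := Code.type x) (by rw [ht]; omega)
  have hs := val_size (ρ := ρ) hR h hx (by omega)
  have hle := (view n s).size_le u
  rw [Fintype.card_fin] at hle
  have hcap := h.vertices_le
  have hdle := @digit_le n (s.reg 9) (encode c ((view n s).type u))
  have hz : Code.zero.val ρ s = 0 := rfl
  rw [Code.promised, val_add, val_mul, val_eq, hd, hs, ht, hz, Colored.promised]
  by_cases h0 : SafeSet.digit (n + 1) (s.reg 9) (encode c ((view n s).type u)) = 0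
  · rw [if_pos h0, if_pos h0, one_mul]; omega
  · rw [if_neg h0, if_neg h0, zero_mul]; omega

/-- The size function is kept abstract because the test is used twice: with promised sizes in the
state test and with actual sizes in the final selection. -/
theorem holds_badCross (h : Sizes ρ n c) {f : ℕ → Expr} {g : Fin n → ℕ}
    (hf : ∀ (s' : Store) (x : ℕ) (u : Fin n), s'.arr = s.arr → s'.reg 9 = s.reg 9 → s'.reg x = u →
      x < 22 → (view n s).col u ≠ 0 → (f x).val ρ s' = g u) :
    (Code.badCross f).Holds ρ s ↔ ∃ u v, (view n s).adj u v ∧ (view n s).col u = 2 ∧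
      (view n s).col v = 1 ∧ g u < g v := by
  have key : ∀ u v : Fin n, (Code.adj 20 21 * (eq (Code.col 20) two * (eq (Code.col 21) one *
      lt (f 20) (f 21)))).Holds ρ ((s.setReg 20 u).setReg 21 v) ↔ (view n s).adj u v ∧
      (view n s).col u = 2 ∧ (view n s).col v = 1 ∧ g u < g v := by
    intro u v
    rw [holds_mul h.cap_pos, holds_mul h.cap_pos, holds_mul h.cap_pos, holds_eq, holds_eq, holds_lt]
    have h1 : (Code.col 20).val ρ ((s.setReg 20 u).setReg 21 v) = (view n s).col u := by
      simp [Code.col, Code.zero, view]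
    have h2 : (Code.col 21).val ρ ((s.setReg 20 u).setReg 21 v) = (view n s).col v := by
      simp [Code.col, Code.zero, view]
    have h3 : (Code.adj 20 21).Holds ρ ((s.setReg 20 u).setReg 21 v) ↔ (view n s).adj u v := by
      simp [Code.adj, Code.zero, view, Holds]
    rw [h1, h2, h3]
    simp only [one, two, val_lit, Fin.isValue]
    change _ ∧ (view n s).col u = 2 ∧ (view n s).col v = 1 ∧ _ ↔ _
    refine and_congr_right fun _ => and_congr_right fun hu => and_congr_right fun hv => ?_
    rw [hf ((s.setReg 20 u).setReg 21 v) 20 u rfl (by simp) (by simp) (by decide) (by omega),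
      hf ((s.setReg 20 u).setReg 21 v) 21 v rfl (by simp) (by simp) (by decide) (by omega)]
  rw [Code.badCross, holds_sum h.cap_pos, h.par1]
  constructor
  · rintro ⟨t, ht, h1⟩
    rw [holds_sum h.cap_pos, h.par1] at h1
    obtain ⟨t', ht', h1⟩ := h1
    exact ⟨⟨t, ht⟩, ⟨t', ht'⟩, (key ⟨t, ht⟩ ⟨t', ht'⟩).mp h1⟩
  · rintro ⟨u, v, huv⟩
    refine ⟨u, u.2, ?_⟩
    rw [holds_sum h.cap_pos, h.par1]
    exact ⟨v, v.2, (key u v).mpr huv⟩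

theorem holds_meets (hR : HasReach n s) (h : Sizes ρ n c) (hP : Powers n c s)
    (hX : (view n s).Proper c) :
    Code.meets.Holds ρ s ↔ (view n s).Meets c (n + 1) (s.reg 9) := by
  classical
  set X := view n s with hXdef
  set q := s.reg 9
  have hd := h.digits_le
  have htype : ∀ {s' : Store} {x : ℕ} {u : Fin n}, s'.arr = s.arr → s'.reg x = u → x < 22 →
      X.col u ≠ 0 → (Code.type x).val ρ s' = encode c (X.type u) := by
    intro s' x u harr hx hx' hu
    have hv : view n s' = X := view_congr (by rw [harr]) (by rw [harr]) (by rw [harr])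
    have hR' : HasReach n s' := fun u v => by rw [hv, harr]; exact hR u v
    rw [val_type hR' h ⟨fun e he => by rw [harr, hP.base e he], fun i hi => by
      rw [harr, hP.two i hi]⟩ (by rwa [hv]) hx hx' (by rwa [hv]), hv]
  have hprom : ∀ (s' : Store) (x : ℕ) (u : Fin n), s'.arr = s.arr → s'.reg 9 = q → s'.reg x = u →
      x < 22 → X.col u ≠ 0 → (Code.promised x).val ρ s' =
        X.promised (fun τ => SafeSet.digit (n + 1) q (encode c τ)) u := by
    intro s' x u harr h9 hx hx' hu
    have hv : view n s' = X := view_congr (by rw [harr]) (by rw [harr]) (by rw [harr])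
    have hR' : HasReach n s' := fun u v => by rw [hv, harr]; exact hR u v
    rw [val_promised hR' h ⟨fun e he => by rw [harr, hP.base e he], fun i hi => by
      rw [harr, hP.two i hi]⟩ (by rwa [hv]) hx hx' (by rwa [hv]), hv, h9]
  have hcol : ∀ u : Fin n, (Code.col 20).val ρ (s.setReg 20 u) = X.col u := by
    intro u; simp [Code.col, Code.zero, view, hXdef]
  have hthr : ∀ u : Fin n, X.col u ≠ 0 → (Code.digit (Code.type 20 + par 4)).val ρ (s.setReg 20 u) =
      SafeSet.digit (n + 1) q (encode c (X.type u) + 2 * 2 ^ c) := by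
    intro u hu
    have hlt := encode_lt (hX.type hu)
    have ht := htype (s' := s.setReg 20 u) (x := 20) (u := u) rfl (by simp) (by decide) hu
    have hv : (Code.type 20 + par 4).val ρ (s.setReg 20 u) = encode c (X.type u) + 2 * 2 ^ c := by
      rw [val_add, ht, val_par, h.par4]; omega
    rw [val_digit (s := s.setReg 20 u) h ⟨hP.base, hP.two⟩ (by rw [hv]; omega), hv]
    rfl
  have hin : Code.badInner.Holds ρ s ↔ ∃ u, X.col u = 2 ∧
      X.promised (fun τ => SafeSet.digit (n + 1) q (encode c τ)) u <
        SafeSet.digit (n + 1) q (encode c (X.type u) + 2 * 2 ^ c) := by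
    rw [Code.badInner, holds_sum h.cap_pos, h.par1]
    have key : ∀ u : Fin n, (eq (Code.col 20) two * lt (Code.promised 20)
        (Code.digit (Code.type 20 + par 4))).Holds ρ (s.setReg 20 u) ↔ X.col u = 2 ∧
        X.promised (fun τ => SafeSet.digit (n + 1) q (encode c τ)) u <
          SafeSet.digit (n + 1) q (encode c (X.type u) + 2 * 2 ^ c) := by
      intro u
      rw [holds_mul h.cap_pos, holds_eq, holds_lt, hcol]
      refine and_congr_right fun hu => ?_
      have hu : X.col u = 2 := hu
      rw [hthr u (by omega), hprom (s.setReg 20 u) 20 u rfl rfl (by simp) (by decide) (by omega)]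
    exact ⟨fun ⟨t, ht, h1⟩ => ⟨⟨t, ht⟩, (key ⟨t, ht⟩).mp h1⟩, fun ⟨u, hu⟩ =>
      ⟨u, u.2, (key u).mpr hu⟩⟩
  have hout : Code.badOuter.Holds ρ s ↔ ∃ u, X.col u = 1 ∧
      SafeSet.digit (n + 1) q (encode c (X.type u) + 2 * 2 ^ c) <
        X.promised (fun τ => SafeSet.digit (n + 1) q (encode c τ)) u := by
    rw [Code.badOuter, holds_sum h.cap_pos, h.par1]
    have key : ∀ u : Fin n, (eq (Code.col 20) one * lt (Code.digit (Code.type 20 + par 4))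
        (Code.promised 20)).Holds ρ (s.setReg 20 u) ↔ X.col u = 1 ∧
        SafeSet.digit (n + 1) q (encode c (X.type u) + 2 * 2 ^ c) <
          X.promised (fun τ => SafeSet.digit (n + 1) q (encode c τ)) u := by
      intro u
      rw [holds_mul h.cap_pos, holds_eq, holds_lt, hcol]
      refine and_congr_right fun hu => ?_
      have hu : X.col u = 1 := hu
      rw [hthr u (by omega), hprom (s.setReg 20 u) 20 u rfl rfl (by simp) (by decide) (by omega)]
    exact ⟨fun ⟨t, ht, h1⟩ => ⟨⟨t, ht⟩, (key ⟨t, ht⟩).mp h1⟩, fun ⟨u, hu⟩ =>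
      ⟨u, u.2, (key u).mpr hu⟩⟩
  have hcr := holds_badCross (ρ := ρ) (s := s) h (f := Code.promised) hprom
  have htot : Code.badTotal.Holds ρ s ↔ ∃ e < 2 * 2 ^ c,
      Finset.card {u | X.col u ≠ 0 ∧ encode c (X.type u) = e} ≠
        SafeSet.digit (n + 1) q (e + 2 * 2 ^ c + 2 * 2 ^ c) := by
    rw [Code.badTotal, holds_sum h.cap_pos, h.par4]
    refine exists_congr fun e => and_congr_right fun he => ?_
    rw [holds_not, holds_eq, val_count h (fun u => X.col u ≠ 0 ∧ encode c (X.type u) = e)]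
    · have hv : (var 24 + par 4 + par 4).val ρ (s.setReg 24 e) = e + 2 * 2 ^ c + 2 * 2 ^ c := by
        rw [val_add, val_add, val_var, val_par, h.par4]
        simp only [Store.setReg_reg, if_true]
        omega
      rw [val_digit (s := s.setReg 24 e) h ⟨hP.base, hP.two⟩ (by rw [hv]; omega), hv]
      rfl
    · intro u
      have hc : (Code.col 20).val ρ ((s.setReg 24 e).setReg 20 u) = X.col u := by
        simp [Code.col, Code.zero, view, hXdef]
      have := h.cap_pos
      by_cases hu : X.col u = 0
      · rw [val_mul, val_lt, hc, hu]
        simp [Code.zero]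
      · have ht := htype (s' := (s.setReg 24 e).setReg 20 u) (x := 20) (u := u) rfl (by simp)
          (by decide) hu
        rw [val_mul, val_lt, hc, val_eq, ht]
        simp only [Code.zero, val_lit, Fin.isValue, Fin.val_zero, val_var, Store.setReg_reg,
          Nat.pos_of_ne_zero hu, if_true]
        simp only [hu, ne_eq, not_false_eq_true, true_and]
        split_ifs <;> omega
  rw [Code.meets, holds_not, holds_add h.cap_pos, holds_add h.cap_pos, holds_add h.cap_pos, hin,
    hout,
    hcr, htot]
  constructor
  · intro hh
    push Not at hh
    obtain ⟨h1, h2, h3, h4⟩ := hh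
    exact ⟨⟨h3, h1, h2⟩, h4⟩
  · rintro ⟨⟨h3, h1, h2⟩, h4⟩
    push Not
    exact ⟨h1, h2, h3, h4⟩

end

/-! ## The tables of colourings -/

theorem Cmd.eval_ite_pos {ρ : ℕ → ℕ} {s : Store} {e : Expr} {p q : Cmd} (h : e.Holds ρ s) :
    (ite e p q).eval ρ s = p.eval ρ s := if_pos h

theorem Cmd.eval_ite_neg {ρ : ℕ → ℕ} {s : Store} {e : Expr} {p q : Cmd} (h : ¬ e.Holds ρ s) :
    (ite e p q).eval ρ s = q.eval ρ s := if_neg h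

namespace Code

open RAM.Expr

/-- Adds the union of two table entries to the table of the current node. -/
def pair : Cmd :=
  .seq (.forLt 10 1 (.put 10 (var 10) zero zero
    (get 2 (var 10) (var 7) (var 4) + get 2 (var 10) (var 8) (var 5)))) <|
  .seq closure <|
  .forLt 9 6 (.ite meets (.seq (.forLt 10 1 (.put 2 (var 10) (var 9) (var 0) (col 10)))
    (.put 3 (var 9) (var 0) zero one)) .skip)

/-- Computes the table of a union node. -/
def merge : Cmd :=
  .forLt 7 6 (.forLt 8 6 (.ite (get 3 (var 7) (var 4) zero * get 3 (var 8) (var 5) zero) pair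
    .skip))

end Code

/-- A table entry. -/
def slot (n : ℕ) (s : Store) (q p : ℕ) : Fin n → ℕ := fun v => s.arr 2 v q p

/-- The labelled graph in the memory, with a given colouring. -/
def paint (n : ℕ) (s : Store) (χ : Fin n → ℕ) : Colored (Fin n) := { view n s with col := χ }

theorem paint_congr {n : ℕ} {s s' : Store} (h5 : s'.arr 5 = s.arr 5) (h6 : s'.arr 6 = s.arr 6)
    (χ : Fin n → ℕ) : paint n s' χ = paint n s χ := by
  simp only [paint, view, h5, h6]

theorem view_eq_paint {n : ℕ} {s : Store} {χ : Fin n → ℕ} (h : ∀ v : Fin n, s.arr 10 v 0 0 = χ v) :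
    view n s = paint n s χ := by
  simp only [paint, view, h]

/-- The table `p` holds representatives for the colourings in `P`. -/
structure Filled (n c N p : ℕ) (P : (Fin n → ℕ) → Prop) (s : Store) : Prop where
  sound : ∀ q < N, s.arr 3 q p 0 ≠ 0 →
    P (slot n s q p) ∧ (paint n s (slot n s q p)).Meets c (n + 1) q
  covered : ∀ χ, P χ → ∀ q < N, (paint n s χ).Meets c (n + 1) q → s.arr 3 q p 0 ≠ 0

theorem Filled.congr {n c N p : ℕ} {P P' : (Fin n → ℕ) → Prop} {s s' : Store}
    (h : Filled n c N p P s) (hP : ∀ χ, P χ ↔ P' χ) (h2 : s'.arr 2 = s.arr 2)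
    (h3 : s'.arr 3 = s.arr 3) (h5 : s'.arr 5 = s.arr 5) (h6 : s'.arr 6 = s.arr 6) :
    Filled n c N p P' s' where
  sound q hq hv := by
    have := h.sound q hq (by rwa [h3] at hv)
    have e : slot n s' q p = slot n s q p := by funext v; simp only [slot, h2]
    rw [paint_congr h5 h6, e, ← hP]
    exact this
  covered χ hχ q hq hm := by
    rw [h3]
    exact h.covered χ ((hP χ).mpr hχ) q hq (by rwa [paint_congr h5 h6] at hm)

/-- The two stores agree on all tables except possibly the table `p`. -/
def SameTables (p : ℕ) (s s' : Store) : Prop :=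
  (∀ i j l, l ≠ p → s'.arr 2 i j l = s.arr 2 i j l) ∧
    ∀ i j l, j ≠ p → s'.arr 3 i j l = s.arr 3 i j l

theorem SameTables.refl (p : ℕ) (s : Store) : SameTables p s s :=
    ⟨fun _ _ _ _ => rfl, fun _ _ _ _ => rfl⟩

theorem SameTables.trans {p : ℕ} {s s' s'' : Store} (h : SameTables p s s')
    (h' : SameTables p s' s'') : SameTables p s s'' :=
  ⟨fun i j l hl => (h'.1 i j l hl).trans (h.1 i j l hl),
    fun i j l hl => (h'.2 i j l hl).trans (h.2 i j l hl)⟩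

/-! ### Filling the table of a union node. -/

section

variable {ρ : ℕ → ℕ} {n c : ℕ} {s : Store}

open Code RAM.Expr

theorem Powers.congr (h : Powers n c s) {s' : Store} (h8 : s'.arr 8 = s.arr 8)
    (h9 : s'.arr 9 = s.arr 9) : Powers n c s' :=
  ⟨fun e he => by rw [h8, h.base e he], fun i hi => by rw [h9, h.two i hi]⟩

theorem HasReach.congr (h : HasReach n s) {s' : Store} (h7 : s'.arr 7 = s.arr 7)
    (hv : view n s' = view n s) : HasReach n s' := fun u v => by rw [h7, hv]; exact h u v

/-- The sum colouring is written into the slot of every state it meets. An older entry may be lost,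
but its replacement meets the same state, so the table stays sound, and every state met by a
colouring treated so far keeps a valid slot. -/
theorem pair_spec (h : Sizes ρ n c) (hP : Powers n c s) {p p₁ p₂ q₁ q₂ : ℕ} (h0 : s.reg 0 = p)
    (h4 : s.reg 4 = p₁) (h5 : s.reg 5 = p₂) (h7 : s.reg 7 = q₁) (h8 : s.reg 8 = q₂)
    {χ : Fin n → ℕ} (hχ : ∀ v, χ v = slot n s q₁ p₁ v + slot n s q₂ p₂ v)
    (hX : (paint n s χ).Proper c) {P : (Fin n → ℕ) → Prop} (hs : Filled n c (ρ 6) p P s) :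
    Filled n c (ρ 6) p (fun χ' => P χ' ∨ χ' = χ) (pair.eval ρ s) ∧
      SameTables p s (pair.eval ρ s) := by
  classical
  have hcap := h.vertices_le
  have hn := h.par1
  rw [pair, Cmd.eval, Cmd.eval]
  set s₁ := Cmd.eval ρ (.forLt 10 1 (.put 10 (var 10) zero zero
    (get 2 (var 10) (var 7) (var 4) + get 2 (var 10) (var 8) (var 5)))) s with hs₁
  have hA₁ : ∀ A, A ≠ 10 → s₁.arr A = s.arr A := fun A hA =>
    Cmd.frame_arr (by simp [Cmd.arrs, hA])
  have hr₁ : ∀ r, r ≠ 10 → s₁.reg r = s.reg r := fun r hr =>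
    Cmd.frame_reg (by simp [Cmd.regs, hr])
  have hcol : ∀ v : Fin n, s₁.arr 10 v 0 0 = χ v := by
    intro v
    rw [hs₁, Cmd.eval_for_put (ρ := ρ) 10 1 10 (var 10) zero zero _ s 0 0 0
      (fun t => if ht : t < n then χ ⟨t, ht⟩ else 0)]
    · rw [if_pos ⟨by rw [hn]; exact ⟨Nat.zero_le _, by omega⟩, rfl, rfl⟩]
      simp
    · intro t s' ht hr hA _
      rw [hn] at ht
      have := hX.col ⟨t, ht⟩
      have e := hχ ⟨t, ht⟩
      simp only [paint, slot] at this e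
      refine ⟨by simp, rfl, rfl, ?_⟩
      simp [hr, hA, h4, h5, h7, h8, ht, e]
      omega
  set s₂ := closure.eval ρ s₁ with hs₂
  have hA₂ : ∀ A, A ≠ 10 → A ≠ 7 → s₂.arr A = s.arr A := fun A hA hA' =>
    (Cmd.frame_arr (by simpa [closure_arrs] using hA')).trans (hA₁ A hA)
  have hR₂ : HasReach n s₂ := closure_spec h s₁
  have hcol₂ : ∀ v : Fin n, s₂.arr 10 v 0 0 = χ v := fun v => by
    rw [← hcol v, hs₂, Cmd.frame_arr (by decide)]
  have hv₂ : view n s₂ = paint n s χ := by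
    rw [view_eq_paint hcol₂, paint_congr (hA₂ 5 (by decide) (by decide))
      (hA₂ 6 (by decide) (by decide))]
  have hP₂ : Powers n c s₂ := hP.congr (hA₂ 8 (by decide) (by decide))
      (hA₂ 9 (by decide) (by decide))
  have h0₂ : s₂.reg 0 = p := by
    rw [hs₂, Cmd.frame_reg (by decide), hr₁ 0 (by decide), h0]
  -- After `k` rounds precisely the states below `k` that are met hold the new colouring, and all
  -- other slots are as before. The components were computed before this loop, since they do not
  -- depend on the state.
  have key := Cmd.eval_for_frame (ρ := ρ) 9 6 (.ite meets
      (.seq (.forLt 10 1 (.put 2 (var 10) (var 9)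
    (var 0) (col 10))) (.put 3 (var 9) (var 0) zero one)) .skip) s₂
    (fun k s' => SameTables p s₂ s' ∧ ∀ q < ρ 6, if q < k ∧ (paint n s χ).Meets c (n + 1) q then
      s'.arr 3 q p 0 ≠ 0 ∧ slot n s' q p = χ else
      s'.arr 3 q p 0 = s₂.arr 3 q p 0 ∧ slot n s' q p = slot n s₂ q p)
    ⟨SameTables.refl _ _, fun q _ => by rw [if_neg (by omega)]; exact ⟨rfl, rfl⟩⟩ ?_
  · set s₃ := Cmd.eval ρ (.forLt 9 6 (.ite meets (.seq (.forLt 10 1 (.put 2 (var 10) (var 9)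
      (var 0) (col 10))) (.put 3 (var 9) (var 0) zero one)) .skip)) s₂ with hs₃
    obtain ⟨hsame, key⟩ := key
    have hA₃ : ∀ A, A ≠ 10 → A ≠ 7 → A ≠ 2 → A ≠ 3 → s₃.arr A = s.arr A := fun A h1 h2 h3 h4 =>
      (Cmd.frame_arr (by simp [Cmd.arrs, h3, h4])).trans (hA₂ A h1 h2)
    have e2 := hA₂ 2 (by decide) (by decide)
    have e3 := hA₂ 3 (by decide) (by decide)
    have hslot : ∀ q, slot n s₂ q p = slot n s q p := fun q => by funext v; simp only [slot, e2]
    have hpaint : ∀ χ, paint n s₃ χ = paint n s χ := paint_congr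
      (hA₃ 5 (by decide) (by decide) (by decide) (by decide))
      (hA₃ 6 (by decide) (by decide) (by decide) (by decide))
    refine ⟨⟨fun q hq hv => ?_, fun χ' hχ' q hq hm => ?_⟩, ?_⟩
    · have := key q hq
      rw [hpaint]
      split_ifs at this with hif
      · rw [this.2]
        exact ⟨.inr rfl, hif.2⟩
      · rw [this.1, e3] at hv
        rw [this.2, hslot]
        exact (hs.sound q hq hv).imp_left .inl
    · rw [hpaint] at hm
      have := key q hq
      split_ifs at this with hif
      · exact this.1
      · rw [this.1, e3]
        rcases hχ' with hχ' | rfl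
        · exact hs.covered _ hχ' q hq hm
        · exact absurd ⟨hq, hm⟩ hif
    · simpa only [SameTables, e2, e3] using hsame
  · rintro k s' hk hr hA ⟨hsame, hs'⟩
    set s₄ := s'.setReg 9 k with hs₄
    have hv₄ : view n s₄ = paint n s χ := (view_congr (hA 10 (by decide)) (hA 5 (by decide))
      (hA 6 (by decide))).trans hv₂
    have hm : meets.Holds ρ s₄ ↔ (paint n s χ).Meets c (n + 1) k := by
      rw [holds_meets (ρ := ρ) (s := s₄) (hR₂.congr (hA 7 (by decide)) (hv₄.trans hv₂.symm)) h
        (hP₂.congr (hA 8 (by decide)) (hA 9 (by decide))) (by rwa [hv₄]), hv₄]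
      simp [hs₄]
    have h0₄ : s₄.reg 0 = p := by
      simp only [hs₄, Store.setReg_reg]
      rw [if_neg (by decide), hr 0 (by decide), h0₂]
    by_cases hmk : (paint n s χ).Meets c (n + 1) k
    · rw [Cmd.eval_ite_pos (hm.mpr hmk), Cmd.eval]
      set s₅ := Cmd.eval ρ (.forLt 10 1 (.put 2 (var 10) (var 9) (var 0) (col 10))) s₄ with hs₅
      have h2₅ : ∀ i j l, s₅.arr 2 i j l = if (0 ≤ i ∧ i < 0 + ρ 1) ∧ j = k ∧ l = p then
          s₄.arr 10 i 0 0 else s₄.arr 2 i j l := by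
        intro i j l
        rw [hs₅, Cmd.eval_for_put (ρ := ρ) 10 1 2 (var 10) (var 9) (var 0) (col 10) s₄ 0 k p
          (fun t => s₄.arr 10 t 0 0)]
        · rfl
        · intro t s'' ht hr hA _
          refine ⟨by simp, ?_, ?_, ?_⟩
          · simp [hr 9 (by decide), hs₄]
          · simp [hr 0 (by decide), h0₄]
          · simp [col, zero, hA 10 (by decide)]
      have h9₅ : s₅.reg 9 = k := by rw [hs₅, Cmd.frame_reg (by decide)]; simp [hs₄]
      have h0₅ : s₅.reg 0 = p := by rw [hs₅, Cmd.frame_reg (by decide), h0₄]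
      have h3₅ : s₅.arr 3 = s'.arr 3 := Cmd.frame_arr (by decide)
      have e2 : (Cmd.eval ρ (.put 3 (var 9) (var 0) zero one) s₅).arr 2 = s₅.arr 2 :=
        Cmd.frame_arr (by decide)
      have e3 : ∀ i j l, (Cmd.eval ρ (.put 3 (var 9) (var 0) zero one) s₅).arr 3 i j l =
          if i = k ∧ j = p ∧ l = 0 then 1 else s'.arr 3 i j l := by
        intro i j l
        simp [Cmd.eval, h9₅, h0₅, zero, one, h3₅]
      refine ⟨⟨fun i j l hl => ?_, fun i j l hl => ?_⟩, fun q hq => ?_⟩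
      · rw [e2, h2₅, if_neg (fun h => hl h.2.2)]
        exact hsame.1 i j l hl
      · rw [e3, if_neg (fun h => hl h.2.1)]
        exact hsame.2 i j l hl
      · have := hs' q hq
        rw [e3]
        by_cases hqk : q = k
        · subst hqk
          rw [if_pos ⟨by omega, hmk⟩, if_pos ⟨rfl, rfl, rfl⟩]
          refine ⟨one_ne_zero, funext fun v => ?_⟩
          rw [slot, e2, h2₅, if_pos ⟨⟨by omega, by rw [hn]; omega⟩, rfl, rfl⟩]
          change s'.arr 10 v 0 0 = _
          rw [hA 10 (by decide), hcol₂]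
        · have e : slot n (Cmd.eval ρ (.put 3 (var 9) (var 0) zero one) s₅) q p = slot n s' q p :=
              by
            funext v
            simp only [slot, e2]
            rw [h2₅, if_neg (fun h => hqk h.2.1)]
            rfl
          rw [e, if_neg (fun h : q = k ∧ _ => hqk h.1), if_congr (and_congr_left fun _ =>
            (by omega : q < k + 1 ↔ q < k)) rfl rfl]
          exact this
    · rw [Cmd.eval_ite_neg (fun h => hmk (hm.mp h)), Cmd.eval]
      refine ⟨hsame, fun q hq => ?_⟩
      have := hs' q hq
      by_cases hqk : q = k
      · subst hqk
        rw [if_neg (fun h => by omega)] at this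
        rw [if_neg (fun h => hmk h.2)]
        exact this
      · rw [if_congr (and_congr_left fun _ => (by omega : q < k + 1 ↔ q < k)) rfl rfl]
        exact this

/-- The colourings in the table `p`. -/
def Item (n N : ℕ) (s : Store) (p : ℕ) (χ : Fin n → ℕ) : Prop :=
  ∃ q < N, s.arr 3 q p 0 ≠ 0 ∧ χ = slot n s q p

/-- The table `p` differs from the source tables, so these stay fixed while pairs of their entries
are treated in lexicographic order. Initially no slot of `p` is valid, and the claim holds for the
empty set of pairs. -/
theorem merge_spec (h : Sizes ρ n c) (hP : Powers n c s) {p p₁ p₂ : ℕ} (h0 : s.reg 0 = p)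
    (h4 : s.reg 4 = p₁) (h5 : s.reg 5 = p₂) (hp₁ : p₁ ≠ p) (hp₂ : p₂ ≠ p)
    (hX : ∀ χ₁ χ₂, Item n (ρ 6) s p₁ χ₁ → Item n (ρ 6) s p₂ χ₂ →
      (paint n s fun v => χ₁ v + χ₂ v).Proper c) (he : ∀ q, s.arr 3 q p 0 = 0) :
    Filled n c (ρ 6) p (fun χ => ∃ χ₁ χ₂, Item n (ρ 6) s p₁ χ₁ ∧ Item n (ρ 6) s p₂ χ₂ ∧
      χ = fun v => χ₁ v + χ₂ v) (merge.eval ρ s) ∧ SameTables p s (merge.eval ρ s) := by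
  have slot_eq : ∀ {s' : Store}, SameTables p s s' → ∀ q p', p' ≠ p →
      slot n s' q p' = slot n s q p' := by
    intro s' hs' q p' hp
    funext v
    exact hs'.1 _ _ _ hp
  have key := Cmd.eval_for_frame (ρ := ρ) 7 6 (.forLt 8 6 (.ite (get 3 (var 7) (var 4) zero *
    get 3 (var 8) (var 5) zero) pair .skip)) s
    (fun k s' => SameTables p s s' ∧ Filled n c (ρ 6) p (fun χ => ∃ q₁ < k, ∃ q₂ < ρ 6,
      s.arr 3 q₁ p₁ 0 ≠ 0 ∧ s.arr 3 q₂ p₂ 0 ≠ 0 ∧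
        χ = fun v => slot n s q₁ p₁ v + slot n s q₂ p₂ v) s')
    ⟨SameTables.refl _ _, fun q _ hq => absurd (he q) hq,
      fun χ ⟨_, h, _⟩ => absurd h (Nat.not_lt_zero _)⟩ ?_
  · refine ⟨key.2.congr (fun χ => ?_) rfl rfl rfl rfl, key.1⟩
    constructor
    · rintro ⟨q₁, hq₁, q₂, hq₂, hv₁, hv₂, rfl⟩
      exact ⟨_, _, ⟨q₁, hq₁, hv₁, rfl⟩, ⟨q₂, hq₂, hv₂, rfl⟩, rfl⟩
    · rintro ⟨_, _, ⟨q₁, hq₁, hv₁, rfl⟩, ⟨q₂, hq₂, hv₂, rfl⟩, rfl⟩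
      exact ⟨q₁, hq₁, q₂, hq₂, hv₁, hv₂, rfl⟩
  · rintro k s₁ hk hr₁ hA₁ ⟨hsame₁, hf₁⟩
    -- The pairs treated so far are those with a smaller first slot, and those with first slot `k`
    -- and second slot below `j`.
    have key := Cmd.eval_for_frame (ρ := ρ) 8 6 (.ite (get 3 (var 7) (var 4) zero *
      get 3 (var 8) (var 5) zero) pair .skip) (s₁.setReg 7 k)
      (fun j s' => SameTables p s s' ∧ Filled n c (ρ 6) p (fun χ =>
        (∃ q₁ < k, ∃ q₂ < ρ 6, s.arr 3 q₁ p₁ 0 ≠ 0 ∧ s.arr 3 q₂ p₂ 0 ≠ 0 ∧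
          χ = fun v => slot n s q₁ p₁ v + slot n s q₂ p₂ v) ∨
        ∃ q₂ < j, s.arr 3 k p₁ 0 ≠ 0 ∧ s.arr 3 q₂ p₂ 0 ≠ 0 ∧
          χ = fun v => slot n s k p₁ v + slot n s q₂ p₂ v) s')
      ⟨hsame₁, hf₁.congr (fun χ => ⟨.inl, ?_⟩) rfl rfl rfl rfl⟩ ?_
    · refine ⟨key.1, key.2.congr (fun χ => ?_) rfl rfl rfl rfl⟩
      constructor
      · rintro (⟨q₁, hq₁, hh⟩ | hh)
        · exact ⟨q₁, by omega, hh⟩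
        · exact ⟨k, by omega, hh⟩
      · rintro ⟨q₁, hq₁, hh⟩
        by_cases hk : q₁ = k
        · subst hk; exact .inr hh
        · exact .inl ⟨q₁, by omega, hh⟩
    · rintro (hh | ⟨q₂, hq₂, -⟩)
      · exact hh
      · omega
    · rintro j s₂ hj hr₂ hA₂ ⟨hsame₂, hf₂⟩
      have hr : ∀ r, r ∉ (Cmd.forLt 7 6 (.forLt 8 6 (.ite (get 3 (var 7) (var 4) zero *
          get 3 (var 8) (var 5) zero) pair .skip))).regs → s₂.reg r = s.reg r := by
        intro r hr
        rw [hr₂ r (fun h => hr (List.mem_cons_of_mem _ h)), Store.setReg_reg,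
          if_neg (fun e => hr (by rw [e]; exact List.mem_cons_self)), hr₁ r hr]
      have hA : ∀ A, A ∉ pair.arrs → s₂.arr A = s.arr A := by
        intro A hA
        have e : ∀ A, A ∉ pair.arrs → A ∉ (Cmd.forLt 7 6
            (.forLt 8 6 (.ite (get 3 (var 7) (var 4) zero *
          get 3 (var 8) (var 5) zero) pair .skip))).arrs := by decide
        rw [hA₂ A (e A hA)]
        exact hA₁ A (e A hA)
      set s₃ := s₂.setReg 8 j with hs₃
      have r4 : s₃.reg 4 = p₁ := by simp [hs₃, hr 4 (by decide), h4]
      have r5 : s₃.reg 5 = p₂ := by simp [hs₃, hr 5 (by decide), h5]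
      have r0 : s₃.reg 0 = p := by simp [hs₃, hr 0 (by decide), h0]
      have r7 : s₃.reg 7 = k := by simp [hs₃, hr₂ 7 (by decide)]
      have r8 : s₃.reg 8 = j := by simp [hs₃]
      have hcond : (get 3 (var 7) (var 4) zero * get 3 (var 8) (var 5) zero).Holds ρ s₃ ↔
          s.arr 3 k p₁ 0 ≠ 0 ∧ s.arr 3 j p₂ 0 ≠ 0 := by
        rw [holds_mul h.cap_pos]
        simp only [Holds, val_get, val_var, r4, r5, r7, r8, zero, val_lit, Fin.isValue,
          Fin.val_zero]
        rw [← hsame₂.2 k p₁ 0 hp₁, ← hsame₂.2 j p₂ 0 hp₂]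
        rfl
      by_cases hc : s.arr 3 k p₁ 0 ≠ 0 ∧ s.arr 3 j p₂ 0 ≠ 0
      · rw [Cmd.eval_ite_pos (hcond.mpr hc)]
        have hpaint : ∀ χ, paint n s₃ χ = paint n s χ :=
          paint_congr (hA 5 (by decide)) (hA 6 (by decide))
        have := pair_spec (s := s₃) h (hP.congr (hA 8 (by decide)) (hA 9 (by decide))) r0 r4 r5 r7
            r8
          (χ := fun v => slot n s k p₁ v + slot n s j p₂ v) (fun v => by
            change _ = slot n s₂ k p₁ v + slot n s₂ j p₂ v
            rw [slot_eq hsame₂ k p₁ hp₁, slot_eq hsame₂ j p₂ hp₂])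
          (by
            rw [hpaint]
            exact hX _ _ ⟨k, hk, hc.1, rfl⟩ ⟨j, hj, hc.2, rfl⟩)
          (hf₂.congr (fun _ => Iff.rfl) rfl rfl rfl rfl)
        refine ⟨hsame₂.trans this.2, this.1.congr (fun χ => ?_) rfl rfl rfl rfl⟩
        constructor
        · rintro ((hh | ⟨q₂, hq₂, hh⟩) | rfl)
          · exact .inl hh
          · exact .inr ⟨q₂, by omega, hh⟩
          · exact .inr ⟨j, by omega, hc.1, hc.2, rfl⟩
        · rintro (hh | ⟨q₂, hq₂, h1, h2, rfl⟩)
          · exact .inl (.inl hh)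
          · by_cases hq : q₂ = j
            · subst hq; exact .inr rfl
            · exact .inl (.inr ⟨q₂, by omega, h1, h2, rfl⟩)
      · rw [Cmd.eval_ite_neg (fun h => hc (hcond.mp h)), Cmd.eval]
        refine ⟨hsame₂, hf₂.congr (fun χ => ?_) rfl rfl rfl rfl⟩
        refine or_congr_right ⟨fun ⟨q₂, hq₂, hh⟩ => ⟨q₂, by omega, hh⟩, fun ⟨q₂, hq₂, hh⟩ => ?_⟩
        by_cases hq : q₂ = j
        · subst hq; exact absurd ⟨hh.1, hh.2.1⟩ hc
        · exact ⟨q₂, by omega, hh⟩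

end

/-! ## The nodes of the expression -/

namespace Code

open RAM.Expr

/-- The slots 0 and 1 are mere storage places for the two colourings of a single vertex: later nodes
use the set of stored colourings, not the states under which they stand. -/
def vertexNode : Cmd :=
  .seq (.put 5 (var 2) zero zero (var 3)) <|
  .seq (.put 4 (var 2) (var 0) zero one) <|
  .seq (.put 2 (var 2) zero (var 0) one) <|
  .seq (.put 2 (var 2) one (var 0) two) <|
  .seq (.put 3 zero (var 0) zero one) <|
  .seq (.put 3 one (var 0) zero one) <|
  .seq (.put 1 (var 6) zero zero (var 0)) <|
  .set 6 (var 6 + one)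

/-- The numbers of the two operand tables are replaced on the stack by the number of the current
node, whose table is still empty. -/
def unionNode : Cmd :=
  .seq (.set 6 (var 6 - one)) <|
  .seq (.set 5 (get 1 (var 6) zero zero)) <|
  .seq (.set 4 (get 1 (var 6 - one) zero zero)) <|
  .seq (.put 1 (var 6 - one) zero zero (var 0)) <|
  .seq (.forLt 10 1 (.put 4 (var 10) (var 0) zero
    (get 4 (var 10) (var 4) zero + get 4 (var 10) (var 5) zero)))
  merge

/-- Whether the vertex in the register `x` belongs to the table `4` and has the label in the
register `y`. -/
def labelled (x y : ℕ) : Expr := get 4 (var x) (var 4) zero * eq (lab x) (var y)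

/-- Only the labels in memory change. The table below remains complete by `Complete.relabel`, so its
number simply stays on top of the stack; `joinNode` treats the adjacency likewise. -/
def relabelNode : Cmd :=
  .seq (.set 4 (get 1 (var 6 - one) zero zero)) <|
  .forLt 10 1 (.put 5 (var 10) zero zero
    (labelled 10 2 * var 3 + Expr.not (labelled 10 2) * lab 10))

def joinNode : Cmd :=
  .seq (.set 4 (get 1 (var 6 - one) zero zero)) <|
  .forLt 20 1 (.forLt 21 1 (.put 6 (var 20) (var 21) zero
    (lt zero (adj 20 21 + (labelled 20 2 * labelled 21 3 + labelled 20 3 * labelled 21 2)))))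

/-- The three words of the current node begin at this index. -/
def position : Expr := var 0 + var 0 + var 0

/-- The offsets begin with 3 because the input starts with three words for the numbers of vertices,
labels and nodes. -/
def node : Cmd :=
  .seq (.set 1 (get 0 (position + lit 3) zero zero)) <|
  .seq (.set 2 (get 0 (position + lit 4) zero zero)) <|
  .seq (.set 3 (get 0 (position + lit 5) zero zero)) <|
  .ite (var 1) (.ite (var 1 - one) (.ite (var 1 - two) joinNode relabelNode) unionNode) vertexNode

end Code

open CExpr

/-- The table `p` belongs to the expression `t`. -/
structure Table {n c : ℕ} (N : ℕ) (t : CExpr (Fin n) c) (p : ℕ) (s : Store) : Prop where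
  complete : t.Complete (Item n N s p)
  vertices : ∀ v : Fin n, s.arr 4 v p 0 = if v ∈ t.leaves then 1 else 0

/-- The labelled graph in the memory contains the one represented by `t`. -/
structure Graph {n c : ℕ} (t : CExpr (Fin n) c) (s : Store) : Prop where
  lab : ∀ v ∈ t.leaves, s.arr 5 v 0 0 = t.labelNum v
  adj : ∀ u ∈ t.leaves, ∀ v ∈ t.leaves, s.arr 6 u v 0 ≠ 0 ↔ t.Adj u v

/-- The evaluation of the subexpression `t` at the nodes from `a` on can begin, with stack height
`d`. -/
structure Ready (ρ : ℕ → ℕ) {n c : ℕ} (t : CExpr (Fin n) c) (a d : ℕ) (s : Store) : Prop where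
  powers : Powers n c s
  code : ∀ i < 3 * t.size, s.arr 0 (3 * a + 3 + i) 0 0 = t.code.getD i 0
  height : s.reg 6 = d
  height_le : d ≤ a
  le : a + t.size ≤ ρ 3
  colour : ∀ i j l, a ≤ l → s.arr 2 i j l = 0
  valid : ∀ i j, a ≤ j → s.arr 3 i j 0 = 0
  vertices : ∀ i j, a ≤ j → s.arr 4 i j 0 = 0
  lab_le : ∀ v : Fin n, s.arr 5 v 0 0 ≤ c
  isolated : ∀ u ∈ t.leaves, ∀ v : Fin n, s.arr 6 u v 0 = 0 ∧ s.arr 6 v u 0 = 0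

/-- The evaluation of the subexpression `t` at the nodes from `a` on leads from `s` to `s'`. -/
structure Done (ρ : ℕ → ℕ) {n c : ℕ} (t : CExpr (Fin n) c) (a d : ℕ) (s s' : Store) : Prop where
  height : s'.reg 6 = d + 1
  le_top : a ≤ s'.arr 1 d 0 0
  top_lt : s'.arr 1 d 0 0 < a + t.size
  table : Table (ρ 6) t (s'.arr 1 d 0 0) s'
  graph : Graph t s'
  lab_le : ∀ v : Fin n, s'.arr 5 v 0 0 ≤ c
  stack : ∀ i < d, s'.arr 1 i 0 0 = s.arr 1 i 0 0
  input : s'.arr 0 = s.arr 0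
  base : s'.arr 8 = s.arr 8
  two : s'.arr 9 = s.arr 9
  colour : ∀ i j l, l < a ∨ a + t.size ≤ l → s'.arr 2 i j l = s.arr 2 i j l
  valid : ∀ i j, j < a ∨ a + t.size ≤ j → s'.arr 3 i j 0 = s.arr 3 i j 0
  vertices : ∀ i j, j < a ∨ a + t.size ≤ j → s'.arr 4 i j 0 = s.arr 4 i j 0
  lab : ∀ v : Fin n, v ∉ t.leaves → s'.arr 5 v 0 0 = s.arr 5 v 0 0
  adj : ∀ u v : Fin n, ¬ (u ∈ t.leaves ∧ v ∈ t.leaves) → (s'.arr 6 u v 0 ≠ 0 ↔ s.arr 6 u v 0 ≠ 0)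

theorem length_code {n c : ℕ} (t : CExpr (Fin n) c) : t.code.length = 3 * t.size := by
  induction t with
  | vertex v i => rfl
  | union s t hs ht => simp [CExpr.code, CExpr.size, hs, ht]; omega
  | relabel i j h t ht => simp [CExpr.code, CExpr.size, ht]; omega
  | join i j h t ht => simp [CExpr.code, CExpr.size, ht]; omega

theorem iter_add (f : ℕ → Store → Store) (a b : ℕ) (s : Store) :
    Cmd.iter f (a + b) s = Cmd.iter (fun i => f (a + i)) b (Cmd.iter f a s) := by
  induction b with
  | zero => rfl
  | succ b ih => rw [← Nat.add_assoc, Cmd.iter, Cmd.iter, ih]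

/-! ### Evaluation of leaves, relabelling nodes and joining nodes. -/

section

variable {ρ : ℕ → ℕ} {n c : ℕ} {s : Store}

open Code RAM.Expr

theorem Graph.same {t : CExpr (Fin n) c} (h : Graph t s) {χ : Fin n → ℕ} (hχ : t.IsColoring χ) :
    Colored.Same (paint n s χ) (t.colored χ) where
  col := rfl
  lab v hv := h.lab v ((hχ v).2.mp hv)
  adj u v hu hv := h.adj u ((hχ u).2.mp hu) v ((hχ v).2.mp hv)

theorem labelNum_lt (t : CExpr (Fin n) c) {v : Fin n} (hv : v ∈ t.leaves) : t.labelNum v < c := by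
  obtain ⟨l, hl⟩ := Option.ne_none_iff_exists'.mp
    (fun h => label_eq_none.mp h hv : t.label v ≠ none)
  simp [labelNum, hl]

theorem Graph.proper {t : CExpr (Fin n) c} (h : Graph t s) {χ : Fin n → ℕ} (hχ : t.IsColoring χ) :
    (paint n s χ).Proper c where
  col u := (hχ u).1
  lab u hu := by
    have hu := (hχ u).2.mp hu
    exact (h.lab u hu).trans_lt (labelNum_lt t hu)

theorem node_eval (h : Sizes ρ n c) {p o x y : ℕ} (hp : p < ρ 3) (ho : s.arr 0 (3 * p + 3) 0 0 = o)
    (hx : s.arr 0 (3 * p + 4) 0 0 = x) (hy : s.arr 0 (3 * p + 5) 0 0 = y) :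
    ∃ s₁ : Store, s₁.arr = s.arr ∧ s₁.reg 0 = p ∧ s₁.reg 2 = x ∧ s₁.reg 3 = y ∧
      s₁.reg 6 = s.reg 6 ∧ node.eval ρ (s.setReg 0 p) = (if o ≠ 0 then if o - 1 ≠ 0 then
        if o - 2 ≠ 0 then joinNode.eval ρ s₁ else relabelNode.eval ρ s₁ else unionNode.eval ρ s₁
        else vertexNode.eval ρ s₁) := by
  have := h.nodes_le
  have e : ∀ (s' : Store) (k : Fin 8), s'.reg 0 = p →
      (position + lit k).val ρ s' = 3 * p + k := by
    intro s' k h0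
    have := k.2
    simp only [position, val_add, val_var, h0, val_lit]
    omega
  refine ⟨(((s.setReg 0 p).setReg 1 o).setReg 2 x).setReg 3 y, rfl, rfl, rfl, rfl, rfl, ?_⟩
  rw [node, Cmd.eval, Cmd.eval, Cmd.eval, Cmd.eval, Cmd.eval, Cmd.eval]
  simp only [val_get, zero, val_lit]
  rw [e _ _ rfl]
  simp only [Store.setReg_arr, Fin.isValue]
  change Cmd.eval ρ _ (((s.setReg 0 p).setReg 1 (s.arr 0 (3 * p + 3) 0 0)).setReg 2 _ |>.setReg 3
    _) = _
  rw [ho, e _ _ rfl, e _ _ rfl]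
  change Cmd.eval ρ _ (((s.setReg 0 p).setReg 1 o).setReg 2 (s.arr 0 (3 * p + 4) 0 0) |>.setReg 3
    (s.arr 0 (3 * p + 5) 0 0)) = _
  rw [hx, hy]
  rfl

theorem vertex_step (h : Sizes ρ n c) {v : Fin n} {i : Fin c} {a d : ℕ}
    (hs : Ready ρ (vertex v i) a d s) : Done ρ (vertex v i) a d s (node.eval ρ (s.setReg 0 a)) := by
  have hc := hs.code
  have hle := hs.le
  simp only [CExpr.size, CExpr.code] at hc hle
  have hd := hs.height_le
  have hn := h.nodes_le
  obtain ⟨s₁, ha, h0, h2, h3, h6, e⟩ := node_eval h (p := a) (by omega) (hc 0 (by omega))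
    (hc 1 (by omega)) (hc 2 (by omega))
  rw [e]
  simp only [List.getD_cons_zero, List.getD_cons_succ, ne_eq, not_true_eq_false, if_false] at h2 h3 ⊢
  have h6 := h6.trans hs.height
  have hcap := h.vertices_le
  have h6' : min (d + 1) (ρ 0) = d + 1 := by omega
  -- Both colourings of the vertex need a slot. There are enough since `n` is positive and the
  -- exponent is not 0.
  have two_le : 2 ≤ ρ 6 := by
    have := h.pos
    rw [h.par6]
    calc 2 ≤ n + 1 := by omega
      _ = (n + 1) ^ 1 := (pow_one _).symm
      _ ≤ _ := Nat.pow_le_pow_right (by omega) (by have := Nat.one_le_two_pow (n := c); omega)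
  set s' := vertexNode.eval ρ s₁ with hs'
  have a0 : s'.arr 0 = s.arr 0 := (Cmd.frame_arr (by decide)).trans (by rw [ha])
  have a6 : s'.arr 6 = s.arr 6 := (Cmd.frame_arr (by decide)).trans (by rw [ha])
  have a8 : s'.arr 8 = s.arr 8 := (Cmd.frame_arr (by decide)).trans (by rw [ha])
  have a9 : s'.arr 9 = s.arr 9 := (Cmd.frame_arr (by decide)).trans (by rw [ha])
  have r6 : s'.reg 6 = d + 1 := by
    simp [hs', vertexNode, Cmd.eval, h6, one, h6']
  have a1 : ∀ j, s'.arr 1 j 0 0 = if j = d then a else s.arr 1 j 0 0 := by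
    intro j; simp [hs', vertexNode, Cmd.eval, h6, h0, zero, ha]
  have a2 : ∀ i j l, s'.arr 2 i j l = if i = v ∧ j = 1 ∧ l = a then 2 else
      if i = v ∧ j = 0 ∧ l = a then 1 else s.arr 2 i j l := by
    intro i j l; simp [hs', vertexNode, Cmd.eval, h2, h0, zero, one, two, ha]
  have a3 : ∀ i j, s'.arr 3 i j 0 = if i = 1 ∧ j = a then 1 else
      if i = 0 ∧ j = a then 1 else s.arr 3 i j 0 := by
    intro i j; simp [hs', vertexNode, Cmd.eval, h0, zero, one, ha]
  have a4 : ∀ i j, s'.arr 4 i j 0 = if i = v ∧ j = a then 1 else s.arr 4 i j 0 := by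
    intro i j; simp [hs', vertexNode, Cmd.eval, h0, h2, zero, one, ha]
  have a5 : ∀ j, s'.arr 5 j 0 0 = if j = v then (i : ℕ) else s.arr 5 j 0 0 := by
    intro j; simp [hs', vertexNode, Cmd.eval, h2, h3, zero, ha]
  refine ⟨r6, ?_, ?_, ⟨?_, ?_⟩, ⟨?_, ?_⟩, ?_, ?_, a0, a8, a9, ?_, ?_, ?_, ?_, ?_⟩
  · simp [a1]
  · simp [a1, CExpr.size]
  · rw [a1, if_pos rfl]
    refine complete_vertex v i fun χ => ?_
    have slot0 : slot n s' 0 a = fun u => if u = v then 1 else 0 := by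
      funext u
      simp [slot, a2, hs.colour, Fin.val_inj]
    have slot1 : slot n s' 1 a = fun u => if u = v then 2 else 0 := by
      funext u
      simp [slot, a2, hs.colour, Fin.val_inj]
    constructor
    · rintro ⟨q, hq, hv, rfl⟩
      rw [a3, hs.valid _ _ le_rfl] at hv
      rcases (by by_contra hh; simp_all : q = 0 ∨ q = 1) with rfl | rfl
      · exact .inl slot0
      · exact .inr slot1
    · rintro (rfl | rfl)
      · exact ⟨0, by omega, by simp [a3], slot0.symm⟩
      · exact ⟨1, by omega, by simp [a3], slot1.symm⟩
  · intro u
    rw [a1, if_pos rfl, a4]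
    simp [leaves, Fin.val_inj, hs.vertices]
  · intro u hu
    simp only [leaves, List.mem_singleton] at hu
    subst hu
    simp [a5, labelNum, label]
  · intro u hu w hw
    simp only [leaves, List.mem_singleton] at hu hw
    subst hu hw
    simp [a6, CExpr.Adj, hs.isolated _ (List.mem_singleton_self _)]
  · intro u
    rw [a5]
    have := hs.lab_le u
    split_ifs <;> omega
  · intro j hj
    rw [a1, if_neg (by omega)]
  · intro i j l hl
    simp only [CExpr.size] at hl
    rw [a2, if_neg (by omega), if_neg (by omega)]
  · intro i l hl
    simp only [CExpr.size] at hl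
    rw [a3, if_neg (by omega), if_neg (by omega)]
  · intro i l hl
    simp only [CExpr.size] at hl
    rw [a4, if_neg (by omega)]
  · intro u hu
    simp only [leaves, List.mem_singleton] at hu
    rw [a5, if_neg (fun h => hu (Fin.ext h))]
  · intro u w _
    rw [a6]

theorem labelled_iff (h : Sizes ρ n c) {t : CExpr (Fin n) c} {p x y l : ℕ} {u : Fin n}
    (hm : ∀ v : Fin n, s.arr 4 v p 0 = if v ∈ t.leaves then 1 else 0) (h4 : s.reg 4 = p)
    (hx : s.reg x = u) (hy : s.reg y = l) :
    (labelled x y).Holds ρ s ↔ u ∈ t.leaves ∧ s.arr 5 u 0 0 = l := by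
  rw [labelled, holds_mul h.cap_pos, holds_eq]
  simp [Holds, Code.lab, zero, h4, hx, hy, hm]

theorem val_eq_ite {e : Expr} (he : e.val ρ s ≤ 1) [Decidable (e.Holds ρ s)] :
    e.val ρ s = if e.Holds ρ s then 1 else 0 := by
  unfold Holds at *
  split_ifs <;> omega

theorem labelled_le {t : CExpr (Fin n) c} {p x y : ℕ} {u : Fin n}
    (hm : ∀ v : Fin n, s.arr 4 v p 0 = if v ∈ t.leaves then 1 else 0) (h4 : s.reg 4 = p)
    (hx : s.reg x = u) : (labelled x y).val ρ s ≤ 1 := by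
  simp only [labelled, val_mul, val_get, val_var, h4, hx, hm, zero, val_lit, val_eq, Fin.isValue,
    Fin.val_zero]
  have le_one : ∀ (P : Prop) [Decidable P], (if P then 1 else 0) ≤ 1 := fun P _ => by
    split_ifs <;> omega
  exact (min_le_left _ _).trans (Nat.mul_le_mul (le_one _) (le_one _))

/-- Labels are shared by the whole memory, so the change is restricted to vertices recorded for the
table on top of the stack. As no new table is created, `Done` only locates that table among the
nodes of the subexpression, not at its root. -/
theorem relabel_step (h : Sizes ρ n c) {i j : Fin c} (hij : i ≠ j) {t : CExpr (Fin n) c} {a d : ℕ}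
    (hs : Ready ρ (relabel i j hij t) a d s) {s' : Store} (ht : Done ρ t a d s s') :
    Done ρ (relabel i j hij t) a d s (node.eval ρ (s'.setReg 0 (a + t.size))) := by
  classical
  have hc := hs.code
  have hle := hs.le
  have hlen := length_code t
  simp only [CExpr.size, CExpr.code] at hc hle
  have hd := hs.height_le
  have hn := h.nodes_le
  have hcap := h.vertices_le
  have code : ∀ k < 3, s'.arr 0 (3 * (a + t.size) + (3 + k)) 0 0 = [2, (i : ℕ), (j : ℕ)].getD k 0 :=
      by
    intro k hk
    rw [ht.input]
    have := hc (3 * t.size + k) (by omega)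
    rw [List.getD_append_right _ _ _ _ (by omega), hlen, Nat.add_sub_cancel_left] at this
    rw [← this]
    congr 1
    omega
  obtain ⟨s₁, ha, h0, h2, h3, h6, e⟩ := node_eval (s := s') h (p := a + t.size) (by omega)
    (code 0 (by omega)) (code 1 (by omega)) (code 2 (by omega))
  rw [e]
  simp only [List.getD_cons_zero, List.getD_cons_succ, ne_eq] at h2 h3 ⊢
  rw [if_pos (by decide), if_pos (by decide), if_neg (by decide)]
  have h6 := h6.trans ht.height
  rw [relabelNode, Cmd.eval]
  set s₂ := Cmd.eval ρ (.set 4 (get 1 (var 6 - one) zero zero)) s₁ with hs₂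
  have b : s₂.arr = s'.arr := ha
  set p := s'.arr 1 d 0 0 with hp
  have r4 : s₂.reg 4 = p := by simp [hs₂, Cmd.eval, h6, one, zero, ha, hp]
  have r2 : s₂.reg 2 = i := by simp [hs₂, Cmd.eval, h2]
  have r3 : s₂.reg 3 = j := by simp [hs₂, Cmd.eval, h3]
  have r6 : s₂.reg 6 = d + 1 := by simp [hs₂, Cmd.eval, h6]
  set s₃ := Cmd.eval ρ (.forLt 10 1 (.put 5 (var 10) zero zero
    (labelled 10 2 * var 3 + Expr.not (labelled 10 2) * lab 10))) s₂ with hs₃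
  have a5 : ∀ u : Fin n, s₃.arr 5 u 0 0 = if u ∈ t.leaves ∧ s'.arr 5 u 0 0 = i then (j : ℕ) else
      s'.arr 5 u 0 0 := by
    intro u
    rw [hs₃, Cmd.eval_for_put (ρ := ρ) 10 1 5 (var 10) zero zero _ s₂ 0 0 0
      (fun k => if hk : k < n then if (⟨k, hk⟩ : Fin n) ∈ t.leaves ∧ s'.arr 5 k 0 0 = i then (j : ℕ)
        else s'.arr 5 k 0 0 else 0)]
    · rw [h.par1, if_pos ⟨by omega, rfl, rfl⟩]
      simp
    · intro k s₄ hk hr hA h5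
      rw [h.par1] at hk
      refine ⟨by simp, rfl, rfl, ?_⟩
      have hm : ∀ v : Fin n, (s₄.setReg 10 k).arr 4 v p 0 = if v ∈ t.leaves then 1 else 0 := by
        intro v
        rw [Store.setReg_arr, hA 4 (by decide), b]
        exact ht.table.vertices v
      have g4 : (s₄.setReg 10 k).reg 4 = p := by simp [hr 4, r4]
      have h5k : (s₄.setReg 10 k).arr 5 k 0 0 = s'.arr 5 k 0 0 := by
        rw [Store.setReg_arr, h5, if_neg (by omega), b]
      have hl := labelled_iff (ρ := ρ) (s := s₄.setReg 10 k) h (x := 10) (y := 2) (l := i)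
        (u := ⟨k, hk⟩) hm g4 (by simp) (by simp [hr 2, r2])
      have hl1 := labelled_le (ρ := ρ) (s := s₄.setReg 10 k) (x := 10) (y := 2)
        (u := ⟨k, hk⟩) hm g4 (by simp)
      have hv : (lab 10).val ρ (s₄.setReg 10 k) = s'.arr 5 k 0 0 := by
        simp [lab, zero, h5, b]
      have h3v : (s₄.setReg 10 k).reg 3 = j := by simp [hr 3, r3]
      have hll := ht.lab_le ⟨k, hk⟩
      have hj := j.2
      have hdig := h.digits_le
      have h2c : c < 2 ^ c := Nat.lt_two_pow_self
      rw [val_add, val_mul, val_mul, val_eq_ite hl1, Expr.not, val_eq, val_eq_ite hl1, val_var, h3v,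
        hv,
        dif_pos hk]
      simp only [h5k] at hl
      simp only at hll
      by_cases hh : (⟨k, hk⟩ : Fin n) ∈ t.leaves ∧ s'.arr 5 k 0 0 = i
      · rw [if_pos (hl.mpr hh), if_pos hh]
        simp
        omega
      · rw [if_neg (fun h => hh (hl.mp h)), if_neg hh]
        simp
        omega
  have hA : ∀ A, A ≠ 5 → s₃.arr A = s'.arr A := fun A hA =>
    (Cmd.frame_arr (by simp [Cmd.arrs, hA])).trans (by rw [b])
  have r6' : s₃.reg 6 = d + 1 := (Cmd.frame_reg (by decide)).trans r6
  have item : Item n (ρ 6) s₃ p = Item n (ρ 6) s' p := by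
    funext χ
    have e : ∀ q, slot n s₃ q p = slot n s' q p := fun q => by
      funext v; simp only [slot, hA 2 (by decide)]
    simp only [Item, hA 3 (by decide), e]
  refine ⟨r6', ?_, ?_, ⟨?_, ?_⟩, ⟨?_, ?_⟩, ?_, ?_, (hA 0 (by decide)).trans ht.input,
    (hA 8 (by decide)).trans ht.base, (hA 9 (by decide)).trans ht.two, ?_, ?_, ?_, ?_, ?_⟩
  · rw [hA 1 (by decide)]; exact ht.le_top
  · rw [hA 1 (by decide)]; have := ht.top_lt; simp only [CExpr.size]; omega
  · rw [hA 1 (by decide), item]; exact ht.table.complete.relabel i j hij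
  · intro v; rw [hA 1 (by decide), hA 4 (by decide)]; exact ht.table.vertices v
  · intro v hv
    have hv : v ∈ t.leaves := hv
    rw [a5, ht.graph.lab v hv]
    obtain ⟨l, hl⟩ := Option.ne_none_iff_exists'.mp
      (fun h => label_eq_none.mp h hv : t.label v ≠ none)
    simp only [labelNum, label, hl, Option.map_some, Option.getD_some, hv, true_and, Fin.val_inj]
    split_ifs <;> rfl
  · intro u hu v hv
    rw [hA 6 (by decide)]
    exact ht.graph.adj u hu v hv
  · intro v
    rw [a5]
    have := ht.lab_le v
    split_ifs <;> omega
  · intro k hk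
    rw [hA 1 (by decide)]; exact ht.stack k hk
  · intro k k' l hl
    simp only [CExpr.size] at hl
    rw [hA 2 (by decide)]; exact ht.colour k k' l (by omega)
  · intro k l hl
    simp only [CExpr.size] at hl
    rw [hA 3 (by decide)]; exact ht.valid k l (by omega)
  · intro k l hl
    simp only [CExpr.size] at hl
    rw [hA 4 (by decide)]; exact ht.vertices k l (by omega)
  · intro v hv
    have hv : v ∉ t.leaves := hv
    rw [a5, if_neg (fun h => hv h.1)]
    exact ht.lab v hv
  · intro u v huv
    rw [hA 6 (by decide)]
    exact ht.adj u v huv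

theorem join_step (h : Sizes ρ n c) {i j : Fin c} (hij : i ≠ j) {t : CExpr (Fin n) c} {a d : ℕ}
    (hs : Ready ρ (join i j hij t) a d s) {s' : Store} (ht : Done ρ t a d s s') :
    Done ρ (join i j hij t) a d s (node.eval ρ (s'.setReg 0 (a + t.size))) := by
  classical
  have hc := hs.code
  have hle := hs.le
  have hlen := length_code t
  simp only [CExpr.size, CExpr.code] at hc hle
  have hd := hs.height_le
  have hn := h.nodes_le
  have hcap := h.vertices_le
  have code : ∀ k < 3, s'.arr 0 (3 * (a + t.size) + (3 + k)) 0 0 = [3, (i : ℕ), (j : ℕ)].getD k 0 :=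
      by
    intro k hk
    rw [ht.input]
    have := hc (3 * t.size + k) (by omega)
    rw [List.getD_append_right _ _ _ _ (by omega), hlen, Nat.add_sub_cancel_left] at this
    rw [← this]
    congr 1
    omega
  obtain ⟨s₁, ha, h0, h2, h3, h6, e⟩ := node_eval (s := s') h (p := a + t.size) (by omega)
    (code 0 (by omega)) (code 1 (by omega)) (code 2 (by omega))
  rw [e]
  simp only [List.getD_cons_zero, List.getD_cons_succ, ne_eq] at h2 h3 ⊢
  rw [if_pos (by decide), if_pos (by decide), if_pos (by decide)]
  have h6 := h6.trans ht.height
  rw [joinNode, Cmd.eval]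
  set s₂ := Cmd.eval ρ (.set 4 (get 1 (var 6 - one) zero zero)) s₁ with hs₂
  have b : s₂.arr = s'.arr := ha
  set p := s'.arr 1 d 0 0 with hp
  have r4 : s₂.reg 4 = p := by simp [hs₂, Cmd.eval, h6, one, zero, ha, hp]
  have r2 : s₂.reg 2 = i := by simp [hs₂, Cmd.eval, h2]
  have r3 : s₂.reg 3 = j := by simp [hs₂, Cmd.eval, h3]
  have r6 : s₂.reg 6 = d + 1 := by simp [hs₂, Cmd.eval, h6]
  set s₃ := Cmd.eval ρ (.forLt 20 1 (.forLt 21 1 (.put 6 (var 20) (var 21) zero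
    (lt zero (adj 20 21 + (labelled 20 2 * labelled 21 3 + labelled 20 3 * labelled 21 2))))))
      s₂ with hs₃
  have a6 : ∀ u v : Fin n, s₃.arr 6 u v 0 ≠ 0 ↔ s'.arr 6 u v 0 ≠ 0 ∨
      ((u ∈ t.leaves ∧ s'.arr 5 u 0 0 = i) ∧ (v ∈ t.leaves ∧ s'.arr 5 v 0 0 = j)) ∨
      ((u ∈ t.leaves ∧ s'.arr 5 u 0 0 = j) ∧ (v ∈ t.leaves ∧ s'.arr 5 v 0 0 = i)) := by
    intro u v
    rw [hs₃, Cmd.eval_for_for_put (ρ := ρ) 20 21 1 1 6 zero _ s₂ 0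
      (fun k l => if ∃ (hk : k < n) (hl : l < n), s'.arr 6 k l 0 ≠ 0 ∨
        (((⟨k, hk⟩ : Fin n) ∈ t.leaves ∧ s'.arr 5 k 0 0 = i) ∧
          ((⟨l, hl⟩ : Fin n) ∈ t.leaves ∧ s'.arr 5 l 0 0 = j)) ∨
        (((⟨k, hk⟩ : Fin n) ∈ t.leaves ∧ s'.arr 5 k 0 0 = j) ∧
          ((⟨l, hl⟩ : Fin n) ∈ t.leaves ∧ s'.arr 5 l 0 0 = i)) then 1 else 0) (by decide)]
    · rw [h.par1, if_pos ⟨u.2, v.2, rfl⟩]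
      simp only [u.2, v.2, exists_true_left, Fin.eta, ne_eq, ite_eq_right_iff, one_ne_zero,
        imp_false,
        not_not]
    · intro k l s₄ hk hl hr hx hy hA h6
      rw [h.par1] at hk hl
      refine ⟨rfl, ?_⟩
      have hm : ∀ v : Fin n, s₄.arr 4 v p 0 = if v ∈ t.leaves then 1 else 0 := by
        intro v
        rw [hA 4 (by decide), b]
        exact ht.table.vertices v
      have g4 : s₄.reg 4 = p := by rw [hr 4 (by decide) (by decide), r4]
      have g2 : s₄.reg 2 = i := by rw [hr 2 (by decide) (by decide), r2]
      have g3 : s₄.reg 3 = j := by rw [hr 3 (by decide) (by decide), r3]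
      have h5 : s₄.arr 5 = s'.arr 5 := by rw [hA 5 (by decide), b]
      have l1 := labelled_iff (ρ := ρ) h (x := 20) (u := ⟨k, hk⟩) hm g4 hx g2
      have l2 := labelled_iff (ρ := ρ) h (x := 20) (u := ⟨k, hk⟩) hm g4 hx g3
      have l3 := labelled_iff (ρ := ρ) h (x := 21) (u := ⟨l, hl⟩) hm g4 hy g2
      have l4 := labelled_iff (ρ := ρ) h (x := 21) (u := ⟨l, hl⟩) hm g4 hy g3
      have hadj : (adj 20 21).Holds ρ s₄ ↔ s'.arr 6 k l 0 ≠ 0 := by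
        simp [Holds, adj, zero, hx, hy, h6 k l 0 (.inl ⟨rfl, rfl⟩), b]
      have key : (adj 20 21 + (labelled 20 2 * labelled 21 3 + labelled 20 3 * labelled 21 2)).Holds
          ρ s₄
          ↔ (adj 20 21).Holds ρ s₄ ∨ ((labelled 20 2).Holds ρ s₄ ∧ (labelled 21 3).Holds ρ s₄) ∨
            ((labelled 20 3).Holds ρ s₄ ∧ (labelled 21 2).Holds ρ s₄) := by
        rw [holds_add h.cap_pos, holds_add h.cap_pos, holds_mul h.cap_pos, holds_mul h.cap_pos]
      rw [l1, l2, l3, l4, hadj] at key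
      rw [val_lt]
      refine if_congr ?_ rfl rfl
      simp only [hk, hl, exists_true_left]
      rw [h5] at key
      rw [← key, Holds, Nat.pos_iff_ne_zero.symm]
      rfl
  have hA : ∀ A, A ≠ 6 → s₃.arr A = s'.arr A := fun A hA =>
    (Cmd.frame_arr (by simp [Cmd.arrs, hA])).trans (by rw [b])
  have r6' : s₃.reg 6 = d + 1 := (Cmd.frame_reg (by decide)).trans r6
  have item : Item n (ρ 6) s₃ p = Item n (ρ 6) s' p := by
    funext χ
    have e : ∀ q, slot n s₃ q p = slot n s' q p := fun q => by
      funext v; simp only [slot, hA 2 (by decide)]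
    simp only [Item, hA 3 (by decide), e]
  refine ⟨r6', ?_, ?_, ⟨?_, ?_⟩, ⟨?_, ?_⟩, ?_, ?_, (hA 0 (by decide)).trans ht.input,
    (hA 8 (by decide)).trans ht.base, (hA 9 (by decide)).trans ht.two, ?_, ?_, ?_, ?_, ?_⟩
  · rw [hA 1 (by decide)]; exact ht.le_top
  · rw [hA 1 (by decide)]; have := ht.top_lt; simp only [CExpr.size]; omega
  · rw [hA 1 (by decide), item]; exact ht.table.complete.join i j hij
  · intro v; rw [hA 1 (by decide), hA 4 (by decide)]; exact ht.table.vertices v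
  · intro v hv
    rw [hA 5 (by decide)]
    exact ht.graph.lab v hv
  · intro u hu v hv
    have hu : u ∈ t.leaves := hu
    have hv : v ∈ t.leaves := hv
    rw [a6, ht.graph.adj u hu v hv, ht.graph.lab u hu, ht.graph.lab v hv]
    simp only [CExpr.Adj, Joins, label_eq_some_iff hu, label_eq_some_iff hv, hu, hv, true_and]
  · intro v
    rw [hA 5 (by decide)]
    exact ht.lab_le v
  · intro k hk
    rw [hA 1 (by decide)]; exact ht.stack k hk
  · intro k k' l hl
    simp only [CExpr.size] at hl
    rw [hA 2 (by decide)]; exact ht.colour k k' l (by omega)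
  · intro k l hl
    simp only [CExpr.size] at hl
    rw [hA 3 (by decide)]; exact ht.valid k l (by omega)
  · intro k l hl
    simp only [CExpr.size] at hl
    rw [hA 4 (by decide)]; exact ht.vertices k l (by omega)
  · intro v hv
    rw [hA 5 (by decide)]
    exact ht.lab v hv
  · intro u v huv
    have huv : ¬ (u ∈ t.leaves ∧ v ∈ t.leaves) := huv
    rw [a6, ← ht.adj u v huv]
    tauto

end

/-! ### Evaluation of union nodes and of the whole expression. -/

section

variable {ρ : ℕ → ℕ} {n c : ℕ} {s : Store}

open CExpr Code RAM.Expr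

theorem unionNode_spec (h : Sizes ρ n c) (hP : Powers n c s) {p p₁ p₂ d : ℕ} (h0 : s.reg 0 = p)
    (h6 : s.reg 6 = d + 2) (h₁ : s.arr 1 d 0 0 = p₁) (h₂ : s.arr 1 (d + 1) 0 0 = p₂) (hp₁ : p₁ ≠ p)
    (hp₂ : p₂ ≠ p)
    (hX : ∀ χ₁ χ₂, Item n (ρ 6) s p₁ χ₁ → Item n (ρ 6) s p₂ χ₂ →
      (paint n s fun v => χ₁ v + χ₂ v).Proper c) (he : ∀ q, s.arr 3 q p 0 = 0) :
    (unionNode.eval ρ s).reg 6 = d + 1 ∧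
    (∀ i, (unionNode.eval ρ s).arr 1 i 0 0 = if i = d then p else s.arr 1 i 0 0) ∧
    (∀ i j, (unionNode.eval ρ s).arr 4 i j 0 = if i < n ∧ j = p then
      min (s.arr 4 i p₁ 0 + s.arr 4 i p₂ 0) (ρ 0) else s.arr 4 i j 0) ∧
    Filled n c (ρ 6) p (fun χ => ∃ χ₁ χ₂, Item n (ρ 6) s p₁ χ₁ ∧ Item n (ρ 6) s p₂ χ₂ ∧
      χ = fun v => χ₁ v + χ₂ v) (unionNode.eval ρ s) ∧ SameTables p s (unionNode.eval ρ s) := by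
  set s₁ := (Cmd.put 1 (var 6 - one) zero zero (var 0)).eval ρ ((Cmd.set 4 (get 1 (var 6 - one) zero
    zero)).eval ρ ((Cmd.set 5 (get 1 (var 6) zero zero)).eval ρ
    ((Cmd.set 6 (var 6 - one)).eval ρ s))) with hs₁
  have r6 : s₁.reg 6 = d + 1 := by simp [hs₁, Cmd.eval, h6, one]
  have r5 : s₁.reg 5 = p₂ := by simp [hs₁, Cmd.eval, h6, one, zero, h₂]
  have r4 : s₁.reg 4 = p₁ := by simp [hs₁, Cmd.eval, h6, one, zero, h₁]
  have r0 : s₁.reg 0 = p := by simp [hs₁, Cmd.eval, h0]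
  have a1 : ∀ i, s₁.arr 1 i 0 0 = if i = d then p else s.arr 1 i 0 0 := by
    intro i; simp [hs₁, Cmd.eval, h6, one, zero, h0]
  have hA : ∀ A, A ≠ 1 → s₁.arr A = s.arr A := by
    intro A hA; ext i j l; simp [hs₁, Cmd.eval, hA]
  set s₂ := Cmd.eval ρ (.forLt 10 1 (.put 4 (var 10) (var 0) zero
    (get 4 (var 10) (var 4) zero + get 4 (var 10) (var 5) zero))) s₁ with hs₂
  have e : unionNode.eval ρ s = merge.eval ρ s₂ := rfl
  rw [e]
  have a4 : ∀ i j, s₂.arr 4 i j 0 = if i < n ∧ j = p then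
      min (s.arr 4 i p₁ 0 + s.arr 4 i p₂ 0) (ρ 0) else s.arr 4 i j 0 := by
    intro i j
    rw [hs₂, Cmd.eval_for_put (ρ := ρ) 10 1 4 (var 10) (var 0) zero _ s₁ 0 p 0
      (fun i => min (s.arr 4 i p₁ 0 + s.arr 4 i p₂ 0) (ρ 0)), h.par1, hA 4 (by decide)]
    · exact if_congr (by omega) rfl rfl
    · intro t s' ht hr hB h4
      refine ⟨by simp, by simp [hr 0, r0], rfl, ?_⟩
      simp only [val_add, val_get, val_var, zero, val_lit, Store.setReg_reg, Store.setReg_arr,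
        hr 4 (by decide), hr 5 (by decide), r4, r5, h4, if_true, Fin.isValue, Fin.val_zero]
      rw [if_neg (show (4 : ℕ) ≠ 10 by decide), if_neg (show (5 : ℕ) ≠ 10 by decide),
        if_neg (by omega), if_neg (by omega), hA 4 (by decide)]
  have hA₂ : ∀ A, A ≠ 1 → A ≠ 4 → s₂.arr A = s.arr A := fun A h1 h4 =>
    (Cmd.frame_arr (by simp [Cmd.arrs, h4])).trans (hA A h1)
  have e2 := hA₂ 2 (by decide) (by decide)
  have e3 := hA₂ 3 (by decide) (by decide)
  have item : ∀ p, Item n (ρ 6) s₂ p = Item n (ρ 6) s p := by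
    intro p
    funext χ
    have e : ∀ q, slot n s₂ q p = slot n s q p := fun q => by funext v; simp only [slot, e2]
    simp only [Item, e3, e]
  have key := merge_spec (s := s₂) h (hP.congr (hA₂ 8 (by decide) (by decide))
    (hA₂ 9 (by decide) (by decide))) (p := p) (p₁ := p₁) (p₂ := p₂)
    ((Cmd.frame_reg (by decide)).trans r0) ((Cmd.frame_reg (by decide)).trans r4)
    ((Cmd.frame_reg (by decide)).trans r5) hp₁ hp₂ (by
      intro χ₁ χ₂ hχ₁ hχ₂
      rw [item] at hχ₁ hχ₂
      rw [paint_congr (hA₂ 5 (by decide) (by decide)) (hA₂ 6 (by decide) (by decide))]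
      exact hX χ₁ χ₂ hχ₁ hχ₂) (by simpa only [e3] using he)
  refine ⟨?_, ?_, ?_, ?_, ?_⟩
  · rw [Cmd.frame_reg (by decide), hs₂, Cmd.frame_reg (by decide), r6]
  · intro i
    rw [Cmd.frame_arr (by decide), hs₂, Cmd.frame_arr (by decide), a1]
  · intro i j
    rw [Cmd.frame_arr (by decide), a4]
  · simpa only [item] using key.1
  · simpa only [SameTables, e2, e3] using key.2

theorem Ready.relabel {i j : Fin c} {hij : i ≠ j} {t : CExpr (Fin n) c} {a d : ℕ}
    (hs : Ready ρ (relabel i j hij t) a d s) : Ready ρ t a d s where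
  powers := hs.powers
  code k hk := by
    have hlen := length_code t
    have := hs.code k (by simp only [CExpr.size]; omega)
    rw [this, CExpr.code, List.getD_append _ _ _ _ (by omega)]
  height := hs.height
  height_le := hs.height_le
  le := by have := hs.le; simp only [CExpr.size] at this; omega
  colour := hs.colour
  valid := hs.valid
  vertices := hs.vertices
  lab_le := hs.lab_le
  isolated := hs.isolated

theorem Ready.join {i j : Fin c} {hij : i ≠ j} {t : CExpr (Fin n) c} {a d : ℕ}
    (hs : Ready ρ (join i j hij t) a d s) : Ready ρ t a d s where
  powers := hs.powers
  code k hk := by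
    have hlen := length_code t
    have := hs.code k (by simp only [CExpr.size]; omega)
    rw [this, CExpr.code, List.getD_append _ _ _ _ (by omega)]
  height := hs.height
  height_le := hs.height_le
  le := by have := hs.le; simp only [CExpr.size] at this; omega
  colour := hs.colour
  valid := hs.valid
  vertices := hs.vertices
  lab_le := hs.lab_le
  isolated := hs.isolated

theorem Ready.union_left {t₁ t₂ : CExpr (Fin n) c} {a d : ℕ}
    (hs : Ready ρ (union t₁ t₂) a d s) : Ready ρ t₁ a d s where
  powers := hs.powers
  code k hk := by
    have hlen := length_code t₁
    have hlen' := length_code t₂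
    have := hs.code k (by simp only [CExpr.size]; omega)
    rw [this, CExpr.code, List.getD_append _ _ _ _ (by rw [List.length_append]; omega),
      List.getD_append _ _ _ _ (by omega)]
  height := hs.height
  height_le := hs.height_le
  le := by have := hs.le; simp only [CExpr.size] at this; omega
  colour := hs.colour
  valid := hs.valid
  vertices := hs.vertices
  lab_le := hs.lab_le
  isolated u hu := hs.isolated u (List.mem_append_left _ hu)

theorem size_pos (t : CExpr (Fin n) c) : 0 < t.size := by
  cases t <;> simp [CExpr.size]

/-- The left operand has used only tables with the numbers of its own nodes and added edges only
among its own leaves. Thus the later tables are still empty, and the leaves on the right are still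
isolated because the leaves are distinct. -/
theorem Ready.union_right {t₁ t₂ : CExpr (Fin n) c} (hd : (union t₁ t₂).leaves.Nodup) {a d : ℕ}
    (hs : Ready ρ (union t₁ t₂) a d s) {s' : Store} (h₁ : Done ρ t₁ a d s s') :
    Ready ρ t₂ (a + t₁.size) (d + 1) s' where
  powers := hs.powers.congr h₁.base h₁.two
  code k hk := by
    have hlen := length_code t₁
    have hlen' := length_code t₂
    have := hs.code (3 * t₁.size + k) (by simp only [CExpr.size]; omega)
    rw [CExpr.code, List.getD_append _ _ _ _ (by rw [List.length_append]; omega),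
      List.getD_append_right _ _ _ _ (by omega), hlen, Nat.add_sub_cancel_left] at this
    rw [← this, h₁.input]
    congr 1
    omega
  height := h₁.height
  height_le := by have := hs.height_le; have := size_pos t₁; omega
  le := by have := hs.le; simp only [CExpr.size] at this; omega
  colour i j l hl := by rw [h₁.colour i j l (.inr hl), hs.colour i j l (by omega)]
  valid i j hj := by rw [h₁.valid i j (.inr hj), hs.valid i j (by omega)]
  vertices i j hj := by rw [h₁.vertices i j (.inr hj), hs.vertices i j (by omega)]
  lab_le := h₁.lab_le
  isolated u hu v := by
    have hu' : u ∉ t₁.leaves := fun h => List.disjoint_of_nodup_append hd h hu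
    have e := hs.isolated u (List.mem_append_right _ hu) v
    have e1 := h₁.adj u v (fun h => hu' h.1)
    have e2 := h₁.adj v u (fun h => hu' h.2)
    rw [e.1] at e1
    rw [e.2] at e2
    exact ⟨by_contra fun h => e1.mp h rfl, by_contra fun h => e2.mp h rfl⟩

theorem labelNum_union_left {t₁ t₂ : CExpr (Fin n) c} {v : Fin n} (hv : v ∈ t₁.leaves) :
    (union t₁ t₂).labelNum v = t₁.labelNum v := by
  obtain ⟨l, hl⟩ := Option.ne_none_iff_exists'.mp
    (fun h => label_eq_none.mp h hv : t₁.label v ≠ none)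
  simp [labelNum, label, hl]

theorem labelNum_union_right {t₁ t₂ : CExpr (Fin n) c} {v : Fin n} (hv : v ∉ t₁.leaves) :
    (union t₁ t₂).labelNum v = t₂.labelNum v := by
  simp [labelNum, label, label_eq_none.mpr hv]

/-- Each evaluation alters adjacency only within its own leaves, so the entries between the two
sides keep the value 0 that they had at the beginning. -/
theorem Graph.union {t₁ t₂ : CExpr (Fin n) c} (hd : (union t₁ t₂).leaves.Nodup) {a d : ℕ}
    (hs : Ready ρ (union t₁ t₂) a d s) {s₁ s₂ : Store} (h₁ : Done ρ t₁ a d s s₁)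
    (h₂ : Done ρ t₂ (a + t₁.size) (d + 1) s₁ s₂) : Graph (union t₁ t₂) s₂ := by
  have disj : ∀ v, v ∈ t₁.leaves → v ∉ t₂.leaves :=
      fun v h h' => List.disjoint_of_nodup_append hd h h'
  constructor
  · intro v hv
    rcases List.mem_append.mp hv with hv | hv
    · rw [h₂.lab v (disj v hv), h₁.graph.lab v hv, labelNum_union_left hv]
    · rw [h₂.graph.lab v hv, labelNum_union_right fun h => disj v h hv]
  · intro u hu v hv
    have cross : ∀ u v, u ∈ t₁.leaves → v ∈ t₂.leaves →
        ¬ (t₁.Adj u v ∨ t₂.Adj u v) ∧ ¬ (t₁.Adj v u ∨ t₂.Adj v u) := fun u v hu hv =>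
      ⟨fun h => h.elim (fun h => disj v h.mem.2 hv) fun h => disj u hu h.mem.1,
        fun h => h.elim (fun h => disj v h.mem.1 hv) fun h => disj u hu h.mem.2⟩
    have iso : ∀ u v, u ∈ t₁.leaves → v ∈ t₂.leaves → ¬ s₂.arr 6 u v 0 ≠ 0 ∧ ¬ s₂.arr 6 v u 0 ≠ 0 :=
        by
      intro u v hu hv
      rw [h₂.adj u v (fun h => disj u hu h.1), h₁.adj u v (fun h => disj v h.2 hv),
        h₂.adj v u (fun h => disj u hu h.2), h₁.adj v u (fun h => disj v h.1 hv)]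
      have := hs.isolated u (List.mem_append_left _ hu) v
      simp [this]
    rcases List.mem_append.mp hu with hu | hu <;> rcases List.mem_append.mp hv with hv | hv
    · rw [h₂.adj u v (fun h => disj u hu h.1), h₁.graph.adj u hu v hv]
      exact (or_iff_left fun h => disj u hu h.mem.1).symm
    · exact iff_of_false (iso u v hu hv).1 (cross u v hu hv).1
    · exact iff_of_false (iso v u hv hu).2 (cross v u hv hu).2
    · rw [h₂.graph.adj u hu v hv]
      exact (or_iff_right fun h => disj u h.mem.1 hu).symm

/-- The core is the completeness of the new table, which follows from `Complete.union` once one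
colouring per state is known to be enough. -/
theorem union_step (h : Sizes ρ n c) {t₁ t₂ : CExpr (Fin n) c} (hd : (union t₁ t₂).leaves.Nodup)
    {a d : ℕ} (hs : Ready ρ (union t₁ t₂) a d s) {s₁ s₂ : Store} (h₁ : Done ρ t₁ a d s s₁)
    (h₂ : Done ρ t₂ (a + t₁.size) (d + 1) s₁ s₂) :
    Done ρ (union t₁ t₂) a d s (node.eval ρ (s₂.setReg 0 (a + t₁.size + t₂.size))) := by
  have disj : ∀ v, v ∈ t₁.leaves → v ∉ t₂.leaves :=
      fun v h h' => List.disjoint_of_nodup_append hd h h'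
  have hle := hs.le
  have hlen₁ := length_code t₁
  have hlen₂ := length_code t₂
  simp only [CExpr.size] at hle
  have hcap := h.vertices_le
  set p := a + t₁.size + t₂.size with hp
  have code : ∀ k < 3, s₂.arr 0 (3 * p + (3 + k)) 0 0 = [1, 0, 0].getD k 0 := by
    intro k hk
    rw [h₂.input, h₁.input]
    have := hs.code (3 * t₁.size + 3 * t₂.size + k) (by simp only [CExpr.size]; omega)
    rw [CExpr.code, List.getD_append_right _ _ _ _ (by rw [List.length_append]; omega),
      List.length_append, hlen₁, hlen₂, Nat.add_sub_cancel_left] at this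
    rw [← this]
    congr 1
    omega
  obtain ⟨s₃, ha, h0, -, -, h6, e⟩ := node_eval (s := s₂) h (p := p) (by omega)
    (code 0 (by omega)) (code 1 (by omega)) (code 2 (by omega))
  rw [e]
  simp only [List.getD_cons_zero, ne_eq]
  rw [if_pos (by decide), if_neg (by decide)]
  have h6 := h6.trans h₂.height
  have hg := Graph.union hd hs h₁ h₂
  set p₁ := s₁.arr 1 d 0 0 with hp₁
  set p₂ := s₂.arr 1 (d + 1) 0 0 with hp₂
  have hp₁a := h₁.le_top
  have hp₁b := h₁.top_lt
  have hp₂a := h₂.le_top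
  have hp₂b := h₂.top_lt
  have item₁ : Item n (ρ 6) s₃ p₁ = Item n (ρ 6) s₁ p₁ := by
    funext χ
    have e : ∀ q, slot n s₃ q p₁ = slot n s₁ q p₁ := fun q => by
      funext v
      simp only [slot, ha]
      exact h₂.colour _ _ _ (.inl hp₁b)
    have e3 : ∀ q, s₃.arr 3 q p₁ 0 = s₁.arr 3 q p₁ 0 := fun q => by
      rw [ha]; exact h₂.valid _ _ (.inl hp₁b)
    simp only [Item, e, e3]
  have item₂ : Item n (ρ 6) s₃ p₂ = Item n (ρ 6) s₂ p₂ := by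
    funext χ
    have e : ∀ q, slot n s₃ q p₂ = slot n s₂ q p₂ := fun q => by
      funext v
      simp only [slot, ha]
    simp only [Item, e, ha]
  have c₁ := h₁.table.complete
  have c₂ := h₂.table.complete
  rw [← hp₁, ← item₁] at c₁
  rw [← hp₂, ← item₂] at c₂
  have hcolor : ∀ χ₁ χ₂, Item n (ρ 6) s₃ p₁ χ₁ → Item n (ρ 6) s₃ p₂ χ₂ →
      (union t₁ t₂).IsColoring fun v => χ₁ v + χ₂ v := by
    intro χ₁ χ₂ hχ₁ hχ₂ v
    have d₁ := c₁.coloring χ₁ hχ₁ v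
    have d₂ := c₂.coloring χ₂ hχ₂ v
    simp only [leaves, List.mem_append, ← d₁.2, ← d₂.2]
    have : χ₁ v = 0 ∨ χ₂ v = 0 := by
      by_contra hh
      push Not at hh
      exact disj v (d₁.2.mp hh.1) (d₂.2.mp hh.2)
    omega
  have hpaint : ∀ χ, paint n s₃ χ = paint n s₂ χ := paint_congr (by rw [ha]) (by rw [ha])
  obtain ⟨u6, u1, u4, uF, uS⟩ := unionNode_spec (s := s₃) h
    ((hs.powers.congr h₁.base h₁.two).congr (by rw [ha, h₂.base]) (by rw [ha, h₂.two]))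
    h0 h6 (p₁ := p₁) (p₂ := p₂) (by rw [ha, h₂.stack d (by omega)]) (by rw [ha]) (by omega)
      (by omega)
    (fun χ₁ χ₂ hχ₁ hχ₂ => by rw [hpaint]; exact hg.proper (hcolor χ₁ χ₂ hχ₁ hχ₂))
    (fun q => by
      rw [ha, h₂.valid _ _ (.inr le_rfl), h₁.valid _ _ (.inr (by omega)), hs.valid _ _ (by omega)])
  set s' := unionNode.eval ρ s₃ with hs'
  have hA : ∀ A, A ∉ unionNode.arrs → s'.arr A = s₂.arr A := fun A hA =>
    (Cmd.frame_arr hA).trans (by rw [ha])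
  have top : s'.arr 1 d 0 0 = p := by rw [u1, if_pos rfl]
  have hpaint' : ∀ χ, paint n s' χ = paint n s₂ χ :=
      paint_congr (hA 5 (by decide)) (hA 6 (by decide))
  have complete : (union t₁ t₂).Complete (Item n (ρ 6) s' p) := by
    refine Complete.union hd c₁ c₂ ?_ ?_
    · rintro _ ⟨q, hq, hv, rfl⟩
      exact (uF.sound q hq hv).1
    -- Encode the promises, thresholds and totals of the given sum by a state `q`. The sum meets
    -- `q`, so the slot `q` is valid; whatever sum is stored there also meets `q`, hence is
    -- admissible and has the same totals.
    · intro χ₁ χ₂ φ θ hχ₁ hχ₂ hφ hθ hok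
      have hc := hcolor χ₁ χ₂ hχ₁ hχ₂
      have same := hg.same hc
      obtain ⟨q, hq, hm, hrep⟩ := Colored.exists_meets (b := n + 1) (by simp) (hg.proper hc) hφ hθ
        (same.symm.ok hok)
      rw [← h.par6] at hq
      have hv := uF.covered _ ⟨χ₁, χ₂, hχ₁, hχ₂, rfl⟩ q hq (by rwa [hpaint'])
      obtain ⟨⟨χ₁', χ₂', hχ₁', hχ₂', e⟩, hm'⟩ := uF.sound q hq hv
      have hc' := hcolor χ₁' χ₂' hχ₁' hχ₂'
      rw [← e] at hc'
      rw [hpaint'] at hm'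
      obtain ⟨ok', tot'⟩ := hrep _ (hg.proper hc') hm'
      have same' := hg.same hc'
      exact ⟨_, ⟨q, hq, hv, rfl⟩, same'.ok ok', fun τ => by
        rw [← same'.total, tot', same.total]⟩
  refine ⟨u6, ?_, ?_, ⟨?_, ?_⟩, ⟨?_, ?_⟩, ?_, ?_, ?_, ?_, ?_, ?_, ?_, ?_, ?_, ?_⟩
  · omega
  · simp only [CExpr.size]; omega
  · rw [top]; exact complete
  · intro v
    rw [top, u4, if_pos ⟨v.2, rfl⟩, ha, h₂.vertices _ _ (.inl hp₁b), h₁.table.vertices v,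
      h₂.table.vertices v]
    have := disj v
    simp only [leaves, List.mem_append]
    by_cases hv : v ∈ t₁.leaves <;> by_cases hv' : v ∈ t₂.leaves <;> simp_all <;> omega
  · intro v hv
    rw [hA 5 (by decide), hg.lab v hv]
  · intro u hu v hv
    rw [hA 6 (by decide), hg.adj u hu v hv]
  · intro v
    rw [hA 5 (by decide)]
    exact h₂.lab_le v
  · intro i hi
    rw [u1, if_neg (by omega), ha, h₂.stack i (by omega), h₁.stack i hi]
  · rw [hA 0 (by decide), h₂.input, h₁.input]
  · rw [hA 8 (by decide), h₂.base, h₁.base]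
  · rw [hA 9 (by decide), h₂.two, h₁.two]
  · intro i j l hl
    simp only [CExpr.size] at hl
    rw [uS.1 i j l (by omega), ha, h₂.colour i j l (by omega), h₁.colour i j l (by omega)]
  · intro i j hj
    simp only [CExpr.size] at hj
    rw [uS.2 i j 0 (by omega), ha, h₂.valid i j (by omega), h₁.valid i j (by omega)]
  · intro i j hj
    simp only [CExpr.size] at hj
    rw [u4, if_neg (by omega), ha, h₂.vertices i j (by omega), h₁.vertices i j (by omega)]
  · intro v hv
    simp only [leaves, List.mem_append, not_or] at hv
    rw [hA 5 (by decide), h₂.lab v hv.2, h₁.lab v hv.1]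
  · intro u v huv
    simp only [leaves, List.mem_append] at huv
    rw [hA 6 (by decide), h₂.adj u v (by tauto), h₁.adj u v (by tauto)]

/-- The evaluation of an expression. -/
theorem nodes_spec (h : Sizes ρ n c) (t : CExpr (Fin n) c) : ∀ {a d : ℕ} {s : Store},
    t.leaves.Nodup → Ready ρ t a d s →
      Done ρ t a d s (Cmd.iter (fun i s => node.eval ρ (s.setReg 0 (a + i))) t.size s) := by
  induction t with
  | vertex v i => exact fun _ hs => vertex_step h hs
  | relabel i j hij t ih => exact fun hd hs => relabel_step h hij hs (ih hd hs.relabel)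
  | join i j hij t ih => exact fun hd hs => join_step h hij hs (ih hd hs.join)
  | union t₁ t₂ ih₁ ih₂ =>
    intro a d s hd hs
    have d₁ := ih₁ (List.Nodup.of_append_left hd) hs.union_left
    have d₂ := ih₂ (List.Nodup.of_append_right hd) (hs.union_right hd d₁)
    have := union_step h hd hs d₁ d₂
    simp only [CExpr.size]
    rw [Cmd.iter, iter_add]
    simpa only [Nat.add_assoc] using this

end

/-! ## The selection of the optima -/

namespace Code

open RAM.Expr

def powers : Cmd :=
  .seq (.put 8 zero zero zero one) <|
  .seq (.forLt 10 5 (.put 8 (var 10 + one) zero zero (get 8 (var 10) zero zero * (par 1 + one)))) <|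
  .seq (.put 9 zero zero zero one) <|
  .forLt 10 2 (.put 9 (var 10 + one) zero zero (get 9 (var 10) zero zero * two))

def isSafe : Expr := lt zero (var 11) * Expr.not (badCross size)

def isConnectedSafe : Expr :=
  isSafe * Expr.not (sum 20 1 (eq (col 20) two * lt (size 20) (var 11)))

/-- Loads the table entry in the register `9`; its number of inner vertices goes to the
register `11`. -/
def examine : Cmd :=
  .seq (.forLt 10 1 (.put 10 (var 10) zero zero (get 2 (var 10) (var 9) (var 4)))) <|
  .seq closure <|
  .set 11 (sum 20 1 (eq (col 20) two))

/-- Finds the smallest solution in the table whose number stands in the register `4`. Its size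
goes to the register `r`, and its characteristic vector to the output, beginning with the
index `o`. -/
def select (test : Expr) (r : ℕ) (o : Expr) : Cmd :=
  .seq (.set r (par 1 + one)) <|
  .forLt 9 6 (.ite (get 3 (var 9) (var 4) zero) (.seq examine <|
    .ite (test * lt (var 11) (var r))
      (.seq (.set r (var 11)) (.forLt 10 1 (.put 11 (o + var 10) zero zero (eq (col 10) two))))
        .skip)
    .skip)

/-- The whole algorithm. -/
def main : Cmd :=
  .seq powers <| .seq (.forLt 0 3 node) <| .seq (.set 4 (get 1 zero zero zero)) <|
  .seq (select isSafe 12 two) <| .seq (select isConnectedSafe 13 (two + par 1)) <|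
  .seq (.put 11 zero zero zero (var 12)) (.put 11 one zero zero (var 13))

end Code

/-! ### Correctness of the search for smallest solutions. -/

section

variable {ρ : ℕ → ℕ} {n c : ℕ} {s : Store}

open CExpr Code RAM.Expr

theorem powers_spec (h : Sizes ρ n c) (s : Store) : Powers n c (powers.eval ρ s) := by
  have hcap := h.vertices_le
  have hdig := h.digits_le
  have hst := h.states_le
  set s₁ := (Cmd.put 8 zero zero zero one).eval ρ s with hs₁
  set s₂ := (Cmd.forLt 10 5 (.put 8 (var 10 + one) zero zero
    (get 8 (var 10) zero zero * (par 1 + one)))).eval ρ s₁ with hs₂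
  set s₃ := (Cmd.put 9 zero zero zero one).eval ρ s₂ with hs₃
  have hc : c < 2 ^ c := Nat.lt_two_pow_self
  have two_le : ∀ {i}, i ≤ c → 2 ^ i ≤ 2 ^ c := fun hi => Nat.pow_le_pow_right (by omega) hi
  -- All powers in use are at most the number of states, so saturation does not spoil them.
  have base_le : ∀ {e}, e ≤ 3 * (2 * 2 ^ c) → (n + 1) ^ e ≤ ρ 0 := fun he =>
    (Nat.pow_le_pow_right (by omega) he).trans (h.par6 ▸ hst)
  have h8 : ∀ e ≤ 3 * (2 * 2 ^ c), s₂.arr 8 e 0 0 = (n + 1) ^ e := by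
    have := Cmd.eval_for (ρ := ρ) 10 5 (.put 8 (var 10 + one) zero zero
      (get 8 (var 10) zero zero * (par 1 + one))) s₁
      (fun k s' => ∀ e ≤ k, s'.arr 8 e 0 0 = (n + 1) ^ e) ?_ ?_
    · rw [h.par5] at this
      exact this
    · intro e he
      obtain rfl : e = 0 := by omega
      simp [hs₁, Cmd.eval, zero, one]
    · intro k s' hk hs' e he
      rw [h.par5] at hk
      have e1 : (var 10 + one).val ρ (s'.setReg 10 k) = k + 1 := by
        simp [one]; omega
      have e2 : (get 8 (var 10) zero zero * (par 1 + one)).val ρ (s'.setReg 10 k) =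
          (n + 1) ^ (k + 1) := by
        have := base_le (e := k + 1) (by omega)
        simp only [val_mul, val_get, val_var, val_add, val_par, one, zero, val_lit, h.par1,
          Store.setReg_reg, Store.setReg_arr, if_true, Fin.isValue, Fin.val_zero, Fin.val_one,
          hs' k le_rfl]
        rw [min_eq_left (by omega : n + 1 ≤ ρ 0), ← pow_succ, min_eq_left this]
      simp only [Cmd.eval, Store.setArr_arr, Store.setReg_arr, e1, zero, val_lit, Fin.isValue,
        Fin.val_zero, true_and, and_true]
      split_ifs with hif
      · rw [hif]; exact e2
      · exact hs' e (by omega)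
  have h9 := Cmd.eval_for (ρ := ρ) 10 2 (.put 9 (var 10 + one) zero zero
      (get 9 (var 10) zero zero * two)) s₃
      (fun k s' => ∀ e ≤ k, s'.arr 9 e 0 0 = 2 ^ e) ?_ ?_
  · rw [h.par2] at h9
    refine ⟨fun e he => ?_, h9⟩
    have : (powers.eval ρ s).arr 8 = s₂.arr 8 :=
      (Cmd.frame_arr (p := .forLt 10 2 (.put 9 (var 10 + one) zero zero
        (get 9 (var 10) zero zero * two))) (s := s₃) (by decide)).trans (Cmd.frame_arr (by decide))
    rw [this]
    exact h8 e he.le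
  · intro e he
    obtain rfl : e = 0 := by omega
    simp [hs₃, Cmd.eval, zero, one]
  · intro k s' hk hs' e he
    rw [h.par2] at hk
    have e1 : (var 10 + one).val ρ (s'.setReg 10 k) = k + 1 := by
      simp [one]; omega
    have e2 : (get 9 (var 10) zero zero * two).val ρ (s'.setReg 10 k) = 2 ^ (k + 1) := by
      have := two_le (i := k + 1) (by omega)
      simp only [val_mul, val_get, val_var, two, zero, val_lit,
        Store.setReg_reg, Store.setReg_arr, if_true, Fin.isValue, Fin.val_zero,
        hs' k le_rfl]
      change min (2 ^ k * 2) _ = _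
      rw [← pow_succ, min_eq_left (by omega)]
    simp only [Cmd.eval, Store.setArr_arr, Store.setReg_arr, e1, zero, val_lit, Fin.isValue,
      Fin.val_zero, true_and, and_true]
    split_ifs with hif
    · rw [hif]; exact e2
    · exact hs' e (by omega)

theorem isSafe_iff (h : Sizes ρ n c) (hR : HasReach n s) (h11 : s.reg 11 = (view n s).innerCard) :
    isSafe.Holds ρ s ↔ (view n s).Safe := by
  have hsize := holds_badCross (ρ := ρ) (s := s) h (f := Code.size) (g := (view n s).size) (by
    intro s' x u harr _ hx hx' _
    have hv : view n s' = view n s := view_congr (by rw [harr]) (by rw [harr]) (by rw [harr])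
    rw [val_size (hR.congr (by rw [harr]) hv) h hx (by omega), hv])
  rw [isSafe, holds_mul h.cap_pos, holds_lt, holds_not, hsize, val_var, h11]
  constructor
  · rintro ⟨h1, h2⟩
    refine ⟨h1, fun u v huv hu hv => ?_⟩
    by_contra hlt
    exact h2 ⟨u, v, huv, hu, hv, by omega⟩
  · rintro ⟨h1, h2⟩
    exact ⟨h1, fun ⟨u, v, huv, hu, hv, hlt⟩ => by have := h2 u v huv hu hv; omega⟩

theorem isConnectedSafe_iff (h : Sizes ρ n c) (hR : HasReach n s)
    (h11 : s.reg 11 = (view n s).innerCard) :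
    isConnectedSafe.Holds ρ s ↔ (view n s).Safe ∧ (view n s).InnerConnected := by
  rw [isConnectedSafe, holds_mul h.cap_pos, isSafe_iff h hR h11, holds_not, holds_sum h.cap_pos,
    h.par1]
  refine and_congr_right fun _ => ?_
  have key : ∀ u : Fin n, (eq (col 20) two * lt (Code.size 20) (var 11)).Holds ρ (s.setReg 20 u) ↔
      (view n s).col u = 2 ∧ (view n s).size u < (view n s).innerCard := by
    intro u
    rw [holds_mul h.cap_pos, holds_eq, holds_lt,
      val_size (s := s.setReg 20 u) (u := u) hR h (by simp) (by decide)]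
    simp [col, zero, two, view, h11]
  constructor
  · intro hh u hu
    by_contra hlt
    exact hh ⟨u, u.2, (key u).mpr ⟨hu, by omega⟩⟩
  · rintro hh ⟨u, hu, h1⟩
    obtain ⟨h2, h3⟩ := (key ⟨u, hu⟩).mp h1
    have := hh _ h2
    omega

theorem examine_spec (h : Sizes ρ n c) {q p : ℕ} (h9 : s.reg 9 = q) (h4 : s.reg 4 = p) :
    view n (examine.eval ρ s) = paint n s (slot n s q p) ∧ HasReach n (examine.eval ρ s) ∧
      (examine.eval ρ s).reg 11 = (paint n s (slot n s q p)).innerCard := by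
  classical
  set s₁ := (Cmd.forLt 10 1 (.put 10 (var 10) zero zero (get 2 (var 10) (var 9) (var 4)))).eval ρ s
    with hs₁
  set s₂ := closure.eval ρ s₁ with hs₂
  have e : examine.eval ρ s = s₂.setReg 11 ((sum 20 1 (eq (col 20) two)).val ρ s₂) := rfl
  have hcol : ∀ v : Fin n, s₂.arr 10 v 0 0 = slot n s q p v := by
    intro v
    rw [hs₂, Cmd.frame_arr (by decide), hs₁, Cmd.eval_for_put (ρ := ρ) 10 1 10 (var 10) zero zero _
      s 0 0 0
      (fun t => s.arr 2 t q p)]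
    · rw [h.par1, if_pos ⟨by omega, rfl, rfl⟩]
      rfl
    · intro t s' ht hr hA _
      refine ⟨by simp, rfl, rfl, ?_⟩
      simp [hr 9, hr 4, h9, h4, hA 2]
  have h5 : s₂.arr 5 = s.arr 5 := (Cmd.frame_arr (by decide)).trans (Cmd.frame_arr (by decide))
  have h6 : s₂.arr 6 = s.arr 6 := (Cmd.frame_arr (by decide)).trans (Cmd.frame_arr (by decide))
  have hv : view n s₂ = paint n s (slot n s q p) := by
    rw [view_eq_paint hcol, paint_congr h5 h6]
  have hR : HasReach n s₂ := closure_spec h s₁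
  rw [e]
  refine ⟨hv, hR, ?_⟩
  have := val_count (ρ := ρ) (s := s₂) h (x := 20) (e := eq (col 20) two)
    (fun v => (view n s₂).col v = 2) (fun t => by simp [col, zero, two, view]; congr)
  rw [Store.setReg_reg, if_pos rfl, this, hv]
  rfl

/-- The start value `n + 1` exceeds every cardinality and plays the role of infinity; it survives
only if no entry passes the test. The bound on `b` keeps the output indices below the cut-off, and
the last part lets two searches write to disjoint blocks of the output. -/
theorem select_spec (h : Sizes ρ n c) {p : ℕ} (h4 : s.reg 4 = p) {test : Expr} {r : ℕ} (hr : 12 ≤ r)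
    (hr' : r < 19) {o : Expr} {b : ℕ} (ho : ∀ s', o.val ρ s' = b) (hb : b ≤ n + 2)
    {T : (Fin n → ℕ) → Prop} (hT : ∀ χ s', Item n (ρ 6) s p χ → view n s' = paint n s χ →
      HasReach n s' →
      s'.reg 11 = (paint n s χ).innerCard → (test.Holds ρ s' ↔ T χ)) :
    (∀ χ, Item n (ρ 6) s p χ → T χ → ((select test r o).eval ρ s).reg r ≤ (paint n s χ).innerCard) ∧
    ((∃ χ, Item n (ρ 6) s p χ ∧ T χ ∧
      ((select test r o).eval ρ s).reg r = (paint n s χ).innerCard ∧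
      ∀ v : Fin n, ((select test r o).eval ρ s).arr 11 (b + v) 0 0 = if χ v = 2 then 1 else 0) ∨
      ((select test r o).eval ρ s).reg r = n + 1) ∧
    ∀ i, i < b ∨ b + n ≤ i → ((select test r o).eval ρ s).arr 11 i 0 0 = s.arr 11 i 0 0 := by
  have hcap := h.vertices_le
  set body : Cmd := .ite (get 3 (var 9) (var 4) zero) (.seq examine <|
    .ite (test * lt (var 11) (var r))
      (.seq (.set r (var 11)) (.forLt 10 1 (.put 11 (o + var 10) zero zero (eq (col 10) two))))
        .skip)
    .skip with hbody
  set s₁ := (Cmd.set r (par 1 + one)).eval ρ s with hs₁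
  have hsel : (select test r o).eval ρ s = (Cmd.forLt 9 6 body).eval ρ s₁ := rfl
  have harrs : (Cmd.forLt 9 6 body).arrs = [10, 7, 7, 11] := rfl
  have hregs : (Cmd.forLt 9 6 body).regs = [9, 10, 20, 21, 19, 20, 21, 11, r, 10] := rfl
  rw [hsel]
  have key := Cmd.eval_for_frame (ρ := ρ) 9 6 body s₁ (fun k s' =>
    (∀ q < k, s.arr 3 q p 0 ≠ 0 → T (slot n s q p) → s'.reg r ≤
      (paint n s (slot n s q p)).innerCard) ∧
    ((∃ q < k, s.arr 3 q p 0 ≠ 0 ∧ T (slot n s q p) ∧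
      s'.reg r = (paint n s (slot n s q p)).innerCard ∧
      ∀ v : Fin n, s'.arr 11 (b + v) 0 0 = if slot n s q p v = 2 then 1 else 0) ∨
      s'.reg r = n + 1) ∧
    ∀ i, i < b ∨ b + n ≤ i → s'.arr 11 i 0 0 = s.arr 11 i 0 0) ⟨?_, ?_, ?_⟩ ?_
  · obtain ⟨k1, k2, k3⟩ := key
    refine ⟨?_, ?_, k3⟩
    · rintro _ ⟨q, hq, hv, rfl⟩ ht
      exact k1 q hq hv ht
    · refine k2.imp_left ?_
      rintro ⟨q, hq, hv, hh⟩
      exact ⟨_, ⟨q, hq, hv, rfl⟩, hh⟩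
  · intro q hq; omega
  · right
    simp [hs₁, Cmd.eval, one, h.par1]
    omega
  · intro i _; rfl
  · rintro k s₂ hk hreg harr ⟨i1, i2, i3⟩
    rw [hregs] at hreg
    rw [harrs] at harr
    set s₃ := s₂.setReg 9 k with hs₃
    have r4 : s₃.reg 4 = p := by
      rw [hs₃, Store.setReg_reg, if_neg (by decide), hreg 4 (by simp; omega), hs₁]
      simp [Cmd.eval, h4, show 4 ≠ r by omega]
    have a2 : s₃.arr 2 = s.arr 2 := harr 2 (by decide)
    have a3 : s₃.arr 3 = s.arr 3 := harr 3 (by decide)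
    have hslot : slot n s₃ k p = slot n s k p := by funext v; simp only [slot, a2]
    have hpaint : ∀ χ, paint n s₃ χ = paint n s χ :=
      paint_congr (harr 5 (by decide)) (harr 6 (by decide))
    have hval : (get 3 (var 9) (var 4) zero).Holds ρ s₃ ↔ s.arr 3 k p 0 ≠ 0 := by
      simp only [Holds, val_get, val_var, r4, a3, zero, val_lit]
      simp [hs₃]
    by_cases hv : s.arr 3 k p 0 ≠ 0
    · rw [hbody, Cmd.eval_ite_pos (hval.mpr hv), Cmd.eval]
      obtain ⟨e1, e2, e3⟩ := examine_spec (s := s₃) h (q := k) (p := p) (by simp [hs₃]) r4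
      set s₄ := examine.eval ρ s₃ with hs₄
      rw [hslot, hpaint] at e1 e3
      have rr : s₄.reg r = s₂.reg r := by
        rw [hs₄, Cmd.frame_reg, hs₃, Store.setReg_reg, if_neg (by omega)]
        change r ∉ [10, 20, 21, 19, 20, 21, 11]
        simp
        omega
      have a11 : s₄.arr 11 = s₂.arr 11 := Cmd.frame_arr (by decide)
      have htest := hT _ s₄ ⟨k, hk, hv, rfl⟩ e1 e2 e3
      have hcond : (test * lt (var 11) (var r)).Holds ρ s₄ ↔ T (slot n s k p) ∧
          (paint n s (slot n s k p)).innerCard < s₂.reg r := by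
        rw [holds_mul h.cap_pos, htest, holds_lt, val_var, val_var, e3, rr]
      by_cases hc : T (slot n s k p) ∧ (paint n s (slot n s k p)).innerCard < s₂.reg r
      · rw [Cmd.eval_ite_pos (hcond.mpr hc), Cmd.eval]
        set s₅ := (Cmd.set r (var 11)).eval ρ s₄ with hs₅
        set s₆ := (Cmd.forLt 10 1 (.put 11 (o + var 10) zero zero (eq (col 10) two))).eval ρ s₅ with
          hs₆
        have r6 : s₆.reg r = (paint n s (slot n s k p)).innerCard := by
          rw [hs₆, Cmd.frame_reg (by simp [Cmd.regs]; omega), hs₅]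
          simp [Cmd.eval, e3]
        have hcol : ∀ v : Fin n, s₅.arr 10 v 0 0 = slot n s k p v :=
            fun v => congrFun (congrArg Colored.col e1) v
        have a11 : ∀ i, s₆.arr 11 i 0 0 = if b ≤ i ∧ i < b + n then
            if s₅.arr 10 (i - b) 0 0 = 2 then 1 else 0 else s₂.arr 11 i 0 0 := by
          intro i
          rw [hs₆, Cmd.eval_for_put (ρ := ρ) 10 1 11 (o + var 10) zero zero _ s₅ b 0 0
            (fun t => if s₅.arr 10 t 0 0 = 2 then 1 else 0), h.par1]
          · simp only [and_true]
            rw [show s₅.arr 11 = s₂.arr 11 from a11]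
          · intro t s' ht _ hA _
            rw [h.par1] at ht
            refine ⟨?_, rfl, rfl, ?_⟩
            · rw [val_add, ho]
              simp
              omega
            · simp [col, zero, two, hA 10]
        refine ⟨?_, .inl ⟨k, by omega, hv, hc.1, r6, ?_⟩, ?_⟩
        · intro q hq hvq htq
          rw [r6]
          by_cases hqk : q = k
          · rw [hqk]
          · have := i1 q (by omega) hvq htq
            omega
        · intro v
          rw [a11, if_pos (by omega), Nat.add_sub_cancel_left, hcol]
        · intro i hi
          rw [a11, if_neg (by omega), i3 i hi]
      · rw [Cmd.eval_ite_neg (fun h => hc (hcond.mp h)), Cmd.eval, rr, a11]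
        refine ⟨?_, i2.imp_left fun ⟨q, hq, hh⟩ => ⟨q, by omega, hh⟩, i3⟩
        intro q hq hvq htq
        by_cases hqk : q = k
        · rw [hqk] at htq ⊢
          by_contra hlt
          exact hc ⟨htq, by omega⟩
        · exact i1 q (by omega) hvq htq
    · rw [hbody, Cmd.eval_ite_neg (fun h => hv (hval.mp h)), Cmd.eval]
      have rr : s₃.reg r = s₂.reg r := by rw [hs₃, Store.setReg_reg, if_neg (by omega)]
      have a11 : s₃.arr 11 = s₂.arr 11 := rfl
      rw [rr, a11]
      refine ⟨?_, i2.imp_left fun ⟨q, hq, hh⟩ => ⟨q, by omega, hh⟩, i3⟩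
      intro q hq hvq htq
      by_cases hqk : q = k
      · exact absurd (hqk ▸ hvq) hv
      · exact i1 q (by omega) hvq htq

end

end SafeSet.RAM

/-! ### Optimality of the result. -/

namespace SafeSet

/-! ## Optimal solutions -/

/-- A connected component of `G` will do, as no edge leaves it. Hence the infima defining the two
numbers are genuine minima and not the default value 0. -/
theorem exists_isConnectedSafeSet {V : Type*} [Fintype V] [Nonempty V] (G : SimpleGraph V) :
    ∃ S, IsConnectedSafeSet G S := by
  classical
  set C := G.connectedComponentMk (Classical.arbitrary V)
  refine ⟨C.supp.toFinset, ⟨?_, ?_⟩, ?_⟩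
  · rw [Set.toFinset_nonempty]
    exact C.nonempty_supp
  · rintro C' D ⟨a, -, b, -, hab⟩
    have ha : (a : V) ∈ C.supp := by simpa using a.2
    have hb : (b : V) ∉ C.supp := by simpa using b.2
    exact absurd ((C.mem_supp_congr_adj hab).mp ha) hb
  · rw [Set.coe_toFinset]
    exact C.connected_toSimpleGraph

/-- Representatives `J` of the solutions `P`, up to their sizes, suffice for finding a minimum
solution. -/
theorem exists_optimal {V : Type*} {P J Q : Finset V → Prop} (hP : ∃ S, P S) {r N : ℕ}
    (hJ : ∀ S, J S → P S) (hrep : ∀ S, P S → ∃ S', J S' ∧ S'.card = S.card)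
    (hle : ∀ S, J S → r ≤ S.card) (hlt : ∀ S, J S → S.card < N)
    (hr : (∃ S, J S ∧ r = S.card ∧ Q S) ∨ r = N) :
    ∃ S, (P S ∧ S.card = sInf {k | ∃ S, P S ∧ S.card = k}) ∧
      r = sInf {k | ∃ S, P S ∧ S.card = k} ∧ Q S := by
  rcases hr with ⟨S, hS, rfl, hQ⟩ | rfl
  · have : S.card = sInf {k | ∃ S, P S ∧ S.card = k} := by
      refine le_antisymm ?_ (Nat.sInf_le ⟨S, hJ S hS, rfl⟩)
      refine le_csInf ⟨_, S, hJ S hS, rfl⟩ ?_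
      rintro k ⟨S', hS', rfl⟩
      obtain ⟨S'', h1, h2⟩ := hrep S' hS'
      exact h2 ▸ hle S'' h1
    exact ⟨S, ⟨hJ S hS, this⟩, this, hQ⟩
  · obtain ⟨S, hS⟩ := hP
    obtain ⟨S', hS', -⟩ := hrep S hS
    exact absurd (hle S' hS') (by have := hlt S' hS'; omega)

namespace RAM

section

variable {ρ : ℕ → ℕ} {n c : ℕ}

open CExpr Code RAM.Expr

theorem Graph.paint_eq {t : CExpr (Fin n) c} {s : Store} (h : Graph t s) (hl : ∀ v, v ∈ t.leaves)
    (χ : Fin n → ℕ) : paint n s χ = t.colored χ := by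
  have h1 : (fun v : Fin n => s.arr 5 v 0 0) = t.labelNum := funext fun v => h.lab v (hl v)
  have h2 : (fun u v : Fin n => s.arr 6 u v 0 ≠ 0) = t.Adj :=
    funext fun u => funext fun v => propext (h.adj u (hl u) v (hl v))
  simp only [paint, view, colored, ← h1, ← h2]

/-- The inner vertices. -/
def inner (χ : Fin n → ℕ) : Finset (Fin n) := {v | χ v = 2}

/-- The table at the root is complete, so by `exists_safe` it contains a solution of every size that
occurs, and the smallest solution in the table is a minimum one. -/
theorem main_spec {G : SimpleGraph (Fin n)} {T : CExpr (Fin n) c} (hT : T.Represents G)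
    (h : Sizes ρ n c) (h3 : ρ 3 = T.size) {s : Store} (hr : ∀ x, s.reg x = 0)
    (h0 : ∀ i < 3 * T.size, s.arr 0 (3 + i) 0 0 = T.code.getD i 0)
    (ha : ∀ A, A ≠ 0 → ∀ i j l, s.arr A i j l = 0) :
    HoldsOptima G fun i => (main.eval ρ s).arr 11 i 0 0 := by
  classical
  obtain ⟨hd, hl, hG⟩ := hT
  have hcap := h.vertices_le
  have hpos := h.pos
  have : Nonempty (Fin n) := ⟨⟨0, hpos⟩⟩
  set s₁ := powers.eval ρ s with hs₁
  have ha₁ : ∀ A, A ≠ 0 → A ≠ 8 → A ≠ 9 → ∀ i j l, s₁.arr A i j l = 0 := by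
    intro A h0 h8 h9 i j l
    rw [hs₁, Cmd.frame_arr, ha A h0]
    change A ∉ [8, 8, 9, 9]
    simp [h8, h9]
  have ready : Ready ρ T 0 0 s₁ := by
    refine ⟨powers_spec h s, ?_, ?_, le_rfl, ?_, ?_, ?_, ?_, ?_, ?_⟩
    · intro i hi
      rw [hs₁, Cmd.frame_arr (by decide), Nat.mul_zero, Nat.zero_add, h0 i hi]
    · rw [hs₁, Cmd.frame_reg (by decide), hr]
    · rw [h3, Nat.zero_add]
    · exact fun i j l _ => ha₁ 2 (by decide) (by decide) (by decide) i j l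
    · exact fun i j _ => ha₁ 3 (by decide) (by decide) (by decide) i j 0
    · exact fun i j _ => ha₁ 4 (by decide) (by decide) (by decide) i j 0
    · exact fun v => (ha₁ 5 (by decide) (by decide) (by decide) v 0 0).trans_le (Nat.zero_le _)
    · exact fun u _ v => ⟨ha₁ 6 (by decide) (by decide) (by decide) u v 0,
        ha₁ 6 (by decide) (by decide) (by decide) v u 0⟩
  have done := nodes_spec h T hd ready
  set s₂ := (Cmd.forLt 0 3 node).eval ρ s₁ with hs₂
  have e₂ : Cmd.iter (fun i s => node.eval ρ (s.setReg 0 (0 + i))) T.size s₁ = s₂ := by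
    rw [hs₂, Cmd.eval, h3]
    simp only [Nat.zero_add]
  rw [e₂] at done
  set p := s₂.arr 1 0 0 0 with hp
  have hpaint := done.graph.paint_eq hl
  have complete := done.table.complete
  rw [← hp] at complete
  set s₃ := (Cmd.set 4 (get 1 zero zero zero)).eval ρ s₂ with hs₃
  have r4 : s₃.reg 4 = p := by simp [hs₃, Cmd.eval, zero, hp]
  have item₃ : ∀ χ, Item n (ρ 6) s₃ p χ ↔ Item n (ρ 6) s₂ p χ := fun χ => Iff.rfl
  have paint₃ : ∀ χ, paint n s₃ χ = T.colored χ := hpaint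
  obtain ⟨m1, m2, m3⟩ := select_spec (s := s₃) h r4 (test := isSafe) (r := 12) le_rfl (by decide)
    (o := two) (b := 2) (fun _ => rfl) (by omega) (T := fun χ => (T.colored χ).Safe)
    (by
      intro χ s' _ hv hR h11
      rw [← hv] at h11
      rw [isSafe_iff h hR h11, hv, paint₃])
  set s₄ := (select isSafe 12 two).eval ρ s₃ with hs₄
  have a2 : s₄.arr 2 = s₃.arr 2 := Cmd.frame_arr (by decide)
  have a3 : s₄.arr 3 = s₃.arr 3 := Cmd.frame_arr (by decide)
  have item₄ : ∀ χ, Item n (ρ 6) s₄ p χ ↔ Item n (ρ 6) s₃ p χ := by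
    intro χ
    have e : ∀ q, slot n s₄ q p = slot n s₃ q p := fun q => by funext v; simp only [slot, a2]
    simp only [Item, a3, e]
  have paint₄ : ∀ χ, paint n s₄ χ = T.colored χ := fun χ =>
    (paint_congr (Cmd.frame_arr (by decide)) (Cmd.frame_arr (by decide)) χ).trans (paint₃ χ)
  obtain ⟨k1, k2, k3⟩ := select_spec (s := s₄) h
    ((Cmd.frame_reg (by decide)).trans r4) (test := isConnectedSafe) (r := 13) (by decide)
      (by decide)
    (o := two + par 1) (b := 2 + n) (fun _ => by
      simp only [val_add, val_par, h.par1, two, val_lit]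
      change min (2 + n) _ = _
      omega) (by omega)
    (T := fun χ => (T.colored χ).Safe ∧ (T.colored χ).InnerConnected)
    (by
      intro χ s' _ hv hR h11
      rw [← hv] at h11
      rw [isConnectedSafe_iff h hR h11, hv, paint₄])
  set s₅ := (select isConnectedSafe 13 (two + par 1)).eval ρ s₄ with hs₅
  -- The second search uses the register 13 and the output block that begins at `2 + n`, so both
  -- results of the first one survive.
  have r12 : s₅.reg 12 = s₄.reg 12 := Cmd.frame_reg (by decide)
  have out : ∀ i, (main.eval ρ s).arr 11 i 0 0 = if i = 1 then s₅.reg 13 else if i = 0 then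
      s₅.reg 12 else s₅.arr 11 i 0 0 := by
    intro i
    change ((Cmd.put 11 one zero zero (var 13)).eval ρ ((Cmd.put 11 zero zero zero (var 12)).eval ρ
      s₅)).arr 11 i 0 0 = _
    simp [Cmd.eval, zero, one]
  -- colourings and vertex sets
  have col_eq : ∀ χ, T.IsColoring χ → ∀ v, (T.colored χ).col v = if v ∈ inner χ then 2 else 1 := by
    intro χ hχ v
    obtain ⟨h1, h2⟩ := hχ v
    have := h2.mpr (hl v)
    simp only [colored, inner, Finset.mem_filter, Finset.mem_univ, true_and]
    split_ifs <;> omega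
  have hG' : ∀ χ u v, (T.colored χ).adj u v ↔ G.Adj u v := fun χ u v => (hG u v).symm
  have card_eq : ∀ χ, T.IsColoring χ → (T.colored χ).innerCard = (inner χ).card := fun χ hχ =>
    Colored.innerCard_eq (col_eq χ hχ)
  have paint_set : ∀ S : Finset (Fin n), T.IsColoring (fun v => if v ∈ S then 2 else 1) ∧
      ∀ v, (T.colored fun v => if v ∈ S then 2 else 1).col v = if v ∈ S then 2 else 1 := by
    intro S
    refine ⟨fun v => ?_, fun v => rfl⟩
    simp only [hl v, iff_true]
    split_ifs <;> simp
  have card_lt : ∀ S : Finset (Fin n), S.card < n + 1 := fun S => by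
    have := S.card_le_univ
    rw [Fintype.card_fin] at this
    omega
  obtain ⟨S, hS, hS', hSQ⟩ := exists_optimal (P := IsSafeSet G)
    (J := fun S => ∃ χ, Item n (ρ 6) s₃ p χ ∧ (T.colored χ).Safe ∧ S = inner χ)
    (Q := fun S => ∀ v : Fin n, s₄.arr 11 (2 + v) 0 0 = if v ∈ S then 1 else 0)
    ((exists_isConnectedSafeSet G).imp fun S hS => hS.1) (r := s₄.reg 12) (N := n + 1) (by
      rintro _ ⟨χ, hχ, hs, rfl⟩
      have hc := complete.coloring χ hχ
      exact (Colored.isSafeSet_iff (hG' χ) (col_eq χ hc)).mpr hs) (by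
      intro S hS
      obtain ⟨hc, hcol⟩ := paint_set S
      obtain ⟨χ', hχ', hs', he, -⟩ := complete.exists_safe hc
        ((Colored.isSafeSet_iff (hG' _) hcol).mp hS)
      refine ⟨_, ⟨χ', hχ', hs', rfl⟩, ?_⟩
      rw [← card_eq χ' (complete.coloring χ' hχ'), he, Colored.innerCard_eq hcol]) (by
      rintro _ ⟨χ, hχ, hs, rfl⟩
      rw [← card_eq χ (complete.coloring χ hχ), ← paint₃]
      exact m1 χ hχ hs) (fun S _ => card_lt S) (by
      refine m2.imp_left ?_
      rintro ⟨χ, hχ, hs, hr, ho⟩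
      refine ⟨inner χ, ⟨χ, hχ, hs, rfl⟩, ?_, fun v => ?_⟩
      · rw [hr, paint₃, card_eq χ (complete.coloring χ hχ)]
      · rw [ho]; simp [inner])
  obtain ⟨S', hC, hC', hCQ⟩ := exists_optimal (P := IsConnectedSafeSet G)
    (J := fun S => ∃ χ, Item n (ρ 6) s₃ p χ ∧
      ((T.colored χ).Safe ∧ (T.colored χ).InnerConnected) ∧ S = inner χ)
    (Q := fun S => ∀ v : Fin n, s₅.arr 11 (2 + n + v) 0 0 = if v ∈ S then 1 else 0)
    (exists_isConnectedSafeSet G) (r := s₅.reg 13) (N := n + 1) (by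
      rintro _ ⟨χ, hχ, hs, rfl⟩
      have hc := complete.coloring χ hχ
      exact (Colored.isConnectedSafeSet_iff (hG' χ) (col_eq χ hc)).mpr hs) (by
      intro S hS
      obtain ⟨hc, hcol⟩ := paint_set S
      have hs := (Colored.isConnectedSafeSet_iff (hG' _) hcol).mp hS
      obtain ⟨χ', hχ', hs', he, hconn⟩ := complete.exists_safe hc hs.1
      refine ⟨_, ⟨χ', hχ', ⟨hs', hconn hs.2⟩, rfl⟩, ?_⟩
      rw [← card_eq χ' (complete.coloring χ' hχ'), he, Colored.innerCard_eq hcol]) (by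
      rintro _ ⟨χ, hχ, hs, rfl⟩
      rw [← card_eq χ (complete.coloring χ hχ), ← paint₄]
      exact k1 χ ((item₄ χ).mpr hχ) hs) (fun S _ => card_lt S) (by
      refine k2.imp_left ?_
      rintro ⟨χ, hχ, hs, hr, ho⟩
      have hχ := (item₄ χ).mp hχ
      refine ⟨inner χ, ⟨χ, hχ, hs, rfl⟩, ?_, fun v => ?_⟩
      · rw [hr, paint₄, card_eq χ (complete.coloring χ hχ)]
      · rw [ho]; simp [inner])
  refine ⟨?_, ?_, S, S', hS, hC, fun v => ⟨?_, ?_⟩⟩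
  · refine (out 0).trans ?_
    rw [if_neg (by decide), if_pos rfl, r12, hS']
    rfl
  · refine (out 1).trans ?_
    rw [if_pos rfl, hC']
    rfl
  · refine (out (2 + v)).trans ?_
    rw [if_neg (by omega), if_neg (by omega), k3 _ (.inl (by omega)), hSQ]
  · refine (out (2 + n + v)).trans ?_
    rw [if_neg (by omega), if_neg (by omega), hCQ]

end

end RAM

end SafeSet

/-! ### Parameters, input and output on the machine. -/

namespace SafeSet.RAM

/-! ## Input and output -/

theorem State.eq_of {m m' : State} (h : ∀ r, m.reg r = m'.reg r) (h' : ∀ a, m.mem a = m'.mem a) :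
    m = m' := by
  cases m
  cases m'
  congr
  · exact funext h
  · exact funext h'

/-- Computes a power in the register `a`. -/
def powerLoop (a b k u : ℕ) : Program := .loop k (.seq (.op .mul a a b) (.op .sub k k u))

theorem Runs.powerLoop {W : ℕ} {m : State} {a b k u x y e : ℕ} (hab : a ≠ b) (hak : a ≠ k)
    (hau : a ≠ u) (hkb : k ≠ b) (hku : k ≠ u) (ha : m.reg a = x) (hb : m.reg b = y) (hy : 0 < y)
    (hk : m.reg k = e) (hu : m.reg u = 1) (hW : x * y ^ e ≤ W) (he : e ≤ W) :
    Runs W (powerLoop a b k u) m (e * 3 + 1) ((m.setReg a (x * y ^ e)).setReg k 0) := by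
  obtain ⟨m', r, -, rfl⟩ := Runs.loop (W := W) (r := k) (B := 2)
    (p := .seq (.op .mul a a b) (.op .sub k k u))
    (fun q m' => q ≤ e ∧ m' = (m.setReg a (x * y ^ (e - q))).setReg k q)
    (by rintro q _ ⟨-, rfl⟩; simp)
    (by
      rintro q _ ⟨hq, rfl⟩
      have hpow : x * y ^ (e - q) ≤ W :=
        (Nat.mul_le_mul_left _ (Nat.pow_le_pow_right hy (by omega))).trans hW
      have hmul : x * y ^ (e - (q + 1)) * y = x * y ^ (e - q) := by
        rw [mul_assoc, ← pow_succ, show e - (q + 1) + 1 = e - q by omega]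
      refine ⟨_, (Runs.op ?_).seq (Runs.op ?_), by omega, State.eq_of (fun r => ?_) fun _ => rfl⟩
      · simp [Op.eval, hak, hkb.symm, hab.symm, hb, hmul, hpow]
      · simp [Op.eval, hak.symm]
        omega
      · simp only [Op.eval, State.setReg_reg, hak, hak.symm, hkb.symm, hab.symm, hku.symm, hau.symm,
          hb, hu, if_true, if_false, hmul]
        split_ifs <;> simp_all)
    e m (by
      refine ⟨le_rfl, State.eq_of (fun r => ?_) fun _ => rfl⟩
      simp only [State.setReg_reg, Nat.sub_self, pow_zero, mul_one]
      split_ifs with h1 h2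
      · rw [h1, hk]
      · rw [h2, ha]
      · rfl)
  exact r

/-- Copies the first words of the memory to the array `0`. -/
def inputLoop : Program := .loop (hd 0) <|
  .seq (.op .sub (hd 0) (hd 0) (sp 2)) <| .seq (.load (hd 1) (hd 0)) <|
  .seq (.op .mul (hd 2) (hd 0) (hd 3)) <| .seq (.op .add (hd 2) (hd 2) (sp 1)) <|
  .store (hd 2) (hd 1)

/-- The array region begins at `base ≥ L`, so writing never destroys an input word that is still to
be read. The stride 16 is the number of interleaved arrays. -/
theorem Runs.inputLoop {W : ℕ} {m : State} {L base : ℕ} (h0 : m.reg (hd 0) = L)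
    (h3 : m.reg (hd 3) = 16) (h1 : m.reg (sp 2) = 1) (hb : m.reg (sp 1) = base) (hL : L ≤ base)
    (hW : L * 16 + base ≤ W) : ∃ m', Runs W inputLoop m (L * 6 + 1) m' ∧
      (∀ r, (∀ h, r ≠ hd h) → m'.reg r = m.reg r) ∧ (∀ i < L, m'.mem (i * 16 + base) = m.mem i) ∧
      ∀ a, (∀ i < L, a ≠ i * 16 + base) → m'.mem a = m.mem a := by
  obtain ⟨m', r, -, -, h1, -, h2, h3⟩ := Runs.loop (W := W) (r := hd 0) (B := 5)
    (p := .seq (.op .sub (hd 0) (hd 0) (sp 2)) <| .seq (.load (hd 1) (hd 0)) <|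
      .seq (.op .mul (hd 2) (hd 0) (hd 3)) <| .seq (.op .add (hd 2) (hd 2) (sp 1)) <|
      .store (hd 2) (hd 1))
    (fun q m' => m'.reg (hd 0) = q ∧ q ≤ L ∧ (∀ r, (∀ h, r ≠ hd h) → m'.reg r = m.reg r) ∧
      m'.reg (hd 3) = 16 ∧ (∀ i, q ≤ i → i < L → m'.mem (i * 16 + base) = m.mem i) ∧
      ∀ a, (∀ i, q ≤ i → i < L → a ≠ i * 16 + base) → m'.mem a = m.mem a)
    (fun _ _ h => h.1)
    (by
      rintro q m₁ ⟨e0, hq, er, e3, e4, e5⟩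
      have u1 := (er (sp 2) (by simp)).trans h1
      have u2 := (er (sp 1) (by simp)).trans hb
      refine ⟨_, (Runs.op ?_).seq <| Runs.load.seq <| (Runs.op ?_).seq <| (Runs.op ?_).seq
        Runs.store, ?_, by omega, ?_, ?_, ?_, ?_⟩
      · simp [Op.eval, e0]; omega
      · simp [Op.eval, e0, e3, u1]; omega
      · simp [Op.eval, e0, e3, u1, u2]; omega
      · simp [Op.eval, e0, u1]
      · intro r hr
        simp [hr, er r hr]
      · simp [e3]
      · intro i hi hiL
        simp only [State.setReg_reg, State.setMem_mem, Op.eval, hd_inj, e0, e3, u1, u2, sp_ne_hd,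
          if_true, if_false, State.setReg_mem, Nat.add_sub_cancel, OfNat.ofNat_ne_zero, one_ne_zero,
          OfNat.ofNat_ne_one, Nat.reduceEqDiff]
        split_ifs with hif
        · rw [e5 q fun j hj hjL => by omega, show i = q by omega]
        · exact e4 i (by omega) hiL
      · intro a ha
        simp only [State.setReg_reg, State.setMem_mem, Op.eval, hd_inj, e0, e3, u1, u2, sp_ne_hd,
          if_true, if_false, State.setReg_mem, Nat.add_sub_cancel, OfNat.ofNat_ne_zero, one_ne_zero,
          OfNat.ofNat_ne_one, Nat.reduceEqDiff]
        rw [if_neg (ha q le_rfl (by omega))]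
        exact e5 a fun i hi => ha i (by omega))
    L m ⟨h0, le_rfl, fun _ _ => rfl, h3, fun i hi hi' => by omega, fun _ _ => rfl⟩
  exact ⟨m', r, h1, fun i => h2 i (Nat.zero_le i), fun a ha => h3 a fun i _ => ha i⟩

/-- Copies a part of the array `11` to the first words of the memory. -/
def outputLoop : Program := .loop (hd 0) <|
  .seq (.op .sub (hd 0) (hd 0) (sp 2)) <| .seq (.op .mul (hd 1) (hd 0) (hd 2)) <|
  .seq (.op .add (hd 1) (hd 1) (hd 3)) <| .seq (.op .add (hd 1) (hd 1) (sp 1)) <|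
  .seq (.load (hd 1) (hd 1)) (.store (hd 0) (hd 1))

/-- Sources lie in the region from `base` on and destinations lie below `L ≤ base`. The offset 11 is
the number of the output array. -/
theorem Runs.outputLoop {W : ℕ} {m : State} {L base : ℕ} (h0 : m.reg (hd 0) = L)
    (h2 : m.reg (hd 2) = 16) (h3 : m.reg (hd 3) = 11) (h1 : m.reg (sp 2) = 1)
    (hb : m.reg (sp 1) = base) (hL : L ≤ base) (hW : L * 16 + 11 + base ≤ W) :
    ∃ m', Runs W outputLoop m (L * 7 + 1) m' ∧ ∀ i < L, m'.mem i = m.mem (i * 16 + 11 + base) := by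
  obtain ⟨m', r, -, -, -, -, -, h1, -⟩ := Runs.loop (W := W) (r := hd 0) (B := 6)
    (p := .seq (.op .sub (hd 0) (hd 0) (sp 2)) <| .seq (.op .mul (hd 1) (hd 0) (hd 2)) <|
      .seq (.op .add (hd 1) (hd 1) (hd 3)) <| .seq (.op .add (hd 1) (hd 1) (sp 1)) <|
      .seq (.load (hd 1) (hd 1)) (.store (hd 0) (hd 1)))
    (fun q m' => m'.reg (hd 0) = q ∧ q ≤ L ∧ (m'.reg (hd 2) = 16 ∧ m'.reg (hd 3) = 11) ∧
      m'.reg (sp 2) = 1 ∧ m'.reg (sp 1) = base ∧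
      (∀ i, q ≤ i → i < L → m'.mem i = m.mem (i * 16 + 11 + base)) ∧
      ∀ a, L ≤ a → m'.mem a = m.mem a)
    (fun _ _ h => h.1)
    (by
      rintro q m₁ ⟨e0, hq, ⟨e2, e3⟩, u1, u2, e4, e5⟩
      refine ⟨_, (Runs.op ?_).seq <| (Runs.op ?_).seq <| (Runs.op ?_).seq <| (Runs.op ?_).seq <|
        Runs.load.seq Runs.store, ?_, by omega, ?_, ?_, ?_, ?_, ?_⟩
      · simp [Op.eval, e0]; omega
      · simp [Op.eval, e0, e2, u1]; omega
      · simp [Op.eval, e0, e2, e3, u1]; omega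
      · simp [Op.eval, e0, e2, e3, u1, u2]; omega
      · simp [Op.eval, e0, u1]
      · simp [e2, e3]
      · simp [u1]
      · simp [u2]
      · intro i hi hiL
        simp only [State.setReg_reg, State.setMem_mem, Op.eval, hd_inj, e0, e2, e3, u1, u2,
          sp_ne_hd,
          if_true, if_false, State.setReg_mem, Nat.add_sub_cancel, OfNat.ofNat_ne_zero, one_ne_zero,
          OfNat.ofNat_ne_one, zero_ne_one]
        split_ifs with hif
        · rw [e5 _ (by omega), hif]
        · exact e4 i (by omega) hiL
      · intro a ha
        simp only [State.setReg_reg, State.setMem_mem, Op.eval, hd_inj, e0, e2, e3, u1, u2,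
          sp_ne_hd,
          if_true, if_false, State.setReg_mem, Nat.add_sub_cancel, OfNat.ofNat_ne_zero, one_ne_zero,
          OfNat.ofNat_ne_one, zero_ne_one]
        rw [if_neg (by omega)]
        exact e5 a ha)
    L m ⟨h0, le_rfl, ⟨h2, h3⟩, h1, hb, fun i hi hi' => by omega, fun _ _ => rfl⟩
  exact ⟨m', r, fun i => h1 i (Nat.zero_le i)⟩

/-- The largest number for the arrays. -/
def capacity (n c N : ℕ) : ℕ := (n + 1) ^ (3 * (2 * 2 ^ c)) + (3 * N + 2 * n + 3) + 8

/-- The values of the parameters. -/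
def params (n c N : ℕ) : ℕ → ℕ
  | 0 => capacity n c N
  | 1 => n
  | 2 => c
  | 3 => N
  | 4 => 2 * 2 ^ c
  | 5 => 3 * (2 * 2 ^ c)
  | 6 => (n + 1) ^ (3 * (2 * 2 ^ c))
  | _ => 0

theorem params_sizes {n c N : ℕ} (hn : 0 < n) : Sizes (params n c N) n c where
  pos := hn
  par1 := rfl
  par2 := rfl
  par4 := rfl
  par5 := rfl
  par6 := rfl
  vertices_le := by simp only [params, capacity]; omega
  nodes_le := by simp only [params, capacity]; omega
  digits_le := by
    have h : 3 * (2 * 2 ^ c) < 2 ^ (3 * (2 * 2 ^ c)) := Nat.lt_two_pow_self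
    have h' : 2 ^ (3 * (2 * 2 ^ c)) ≤ (n + 1) ^ (3 * (2 * 2 ^ c)) :=
        Nat.pow_le_pow_left (by omega) _
    simp only [params, capacity]
    omega
  states_le := by simp only [params, capacity]; omega

theorem params_le {n c N : ℕ} (hn : 0 < n) (k : ℕ) : params n c N k ≤ params n c N 0 := by
  have h := (params_sizes (c := c) (N := N) hn).digits_le
  have hc : c < 2 ^ c := Nat.lt_two_pow_self
  simp only [params] at h
  unfold params
  split <;> simp only [capacity] at * <;> omega

/-- Computes the parameters and copies the input. -/
def setup : Program :=
  .seq (.const (sp 2) 1) <| .seq (.load (pr 1) (hd 0)) <| .seq (.load (pr 2) (sp 2)) <|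
  .seq (.const (hd 1) 2) <| .seq (.load (pr 3) (hd 1)) <| .seq (.copy (pr 4) (hd 1)) <|
  .seq (.copy (hd 2) (pr 2)) <| .seq (powerLoop (pr 4) (hd 1) (hd 2) (sp 2)) <|
  .seq (.op .add (pr 5) (pr 4) (pr 4)) <| .seq (.op .add (pr 5) (pr 5) (pr 4)) <|
  .seq (.op .add (hd 3) (pr 1) (sp 2)) <| .seq (.copy (hd 2) (pr 5)) <| .seq (.const (pr 6) 1) <|
  .seq (powerLoop (pr 6) (hd 3) (hd 2) (sp 2)) <|
  .seq (.op .add (hd 0) (pr 3) (pr 3)) <| .seq (.op .add (hd 0) (hd 0) (pr 3)) <|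
  .seq (.const (hd 1) 3) <| .seq (.op .add (hd 0) (hd 0) (hd 1)) <|
  .seq (.op .add (sp 1) (hd 0) (pr 1)) <| .seq (.op .add (sp 1) (sp 1) (pr 1)) <|
  .seq (.const (hd 1) 8) <| .seq (.op .add (pr 0) (pr 6) (sp 1)) <|
  .seq (.op .add (pr 0) (pr 0) (hd 1)) <| .seq (.op .add (sp 0) (pr 0) (sp 2)) <|
  .seq (.const (hd 3) 16) inputLoop

/-- The store that contains the input words. -/
def inputStore (x : List ℕ) : Store where
  reg _ := 0
  arr k i j l := if k = 0 ∧ j = 0 ∧ l = 0 then x.getD i 0 else 0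

/-- The array region starts at `3 * N + 2 * n + 3`, which is past both the `3 * N + 3` input words
and the `2 * n + 2` output words. All cells beyond the input are 0 initially, so every array except
the input array starts out empty. -/
theorem setup_spec {W n c N : ℕ} (hn : 0 < n) {code : List ℕ} (hcode : code.length = 3 * N)
    (hx : ∀ k ∈ code, k ≤ capacity n c N) (hF : Fits W (params n c N) (3 * N + 2 * n + 3)) :
    ∃ m, Runs W setup (initial (n :: c :: N :: code))
      (3 * c + 3 * (3 * (2 * 2 ^ c)) + 6 * (3 * N + 3) + 40) m ∧
      Sim (params n c N) (3 * N + 2 * n + 3) (inputStore (n :: c :: N :: code)) m := by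
  set x := n :: c :: N :: code with hxdef
  set E := 3 * (2 * 2 ^ c) with hE
  have hP := params_sizes (c := c) (N := N) hn
  have hcap0 : capacity n c N = (n + 1) ^ E + (3 * N + 2 * n + 3) + 8 := rfl
  have hdig := hP.digits_le
  have hdig : E ≤ capacity n c N := hdig
  have hc : c < 2 ^ c := Nat.lt_two_pow_self
  have h16 : 16 * capacity n c N + 32 + (3 * N + 2 * n + 3) ≤ W := by
    have h1 := hF.le_word
    have h2 : (params n c N 0 + 1) ^ 1 ≤ (params n c N 0 + 1) ^ 3 :=
        Nat.pow_le_pow_right (by omega) (by omega)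
    have h3 : params n c N 0 = capacity n c N := rfl
    rw [h3, pow_one] at h2
    rw [h3] at h1
    omega
  have e0 : (initial x).mem 0 = n := rfl
  have e1 : (initial x).mem 1 = c := rfl
  have e2 : (initial x).mem 2 = N := rfl
  have er : ∀ r, (initial x).reg r = 0 := fun _ => rfl
  set mA := (((((((initial x).setReg (sp 2) 1).setReg (pr 1) n).setReg (pr 2) c).setReg (hd 1)
    2).setReg
    (pr 3) N).setReg (pr 4) 2).setReg (hd 2) c with hmA
  have rA : ∀ {p : Program} {B m'}, Runs W p mA B m' → Runs W (.seq (.const (sp 2) 1) <|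
      .seq (.load (pr 1) (hd 0)) <| .seq (.load (pr 2) (sp 2)) <|
      .seq (.const (hd 1) 2) <| .seq (.load (pr 3) (hd 1)) <| .seq (.copy (pr 4) (hd 1)) <|
      .seq (.copy (hd 2) (pr 2)) p) (initial x) (7 + B) m' := by
    intro p B m' h
    refine Runs.mono ((Runs.const ?_).seq <| Runs.load.seq <| Runs.load.seq <|
      (Runs.const ?_).seq <|
      Runs.load.seq <| Runs.copy.seq <| Runs.copy.seq (B' := B) (m'' := m') ?_) (by omega)
    · omega
    · omega
    · convert h using 1
      rw [hmA]
      simp [er, e0, e1, e2]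
  have rB := Runs.powerLoop (W := W) (m := mA) (a := pr 4) (b := hd 1) (k := hd 2) (u := sp 2)
    (x := 2) (y := 2) (e := c) (by simp) (by simp) (by simp) (by simp) (by simp) (by simp [hmA])
    (by simp [hmA]) (by omega) (by simp [hmA]) (by simp [hmA]) (by omega) (by omega)
  set mB := (mA.setReg (pr 4) (2 * 2 ^ c)).setReg (hd 2) 0 with hmB
  set mC := (((((mB.setReg (pr 5) (2 * 2 ^ c + 2 * 2 ^ c)).setReg (pr 5) E).setReg (hd 3)
    (n + 1)).setReg (hd 2) E)).setReg (pr 6) 1 with hmC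
  have b4 : mB.reg (pr 4) = 2 * 2 ^ c := by simp [hmB]
  have b1 : mB.reg (pr 1) = n := by simp [hmB, hmA]
  have bs : mB.reg (sp 2) = 1 := by simp [hmB, hmA]
  have rC : ∀ {p : Program} {B m'}, Runs W p mC B m' → Runs W (
      .seq (.op .add (pr 5) (pr 4) (pr 4)) <| .seq (.op .add (pr 5) (pr 5) (pr 4)) <|
      .seq (.op .add (hd 3) (pr 1) (sp 2)) <| .seq (.copy (hd 2) (pr 5)) <|
      .seq (.const (pr 6) 1) p) mB (5 + B) m' := by
    intro p B m' h
    refine Runs.mono ((Runs.op ?_).seq <| (Runs.op ?_).seq <| (Runs.op ?_).seq <| Runs.copy.seq <|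
      (Runs.const ?_).seq (B' := B) (m'' := m') ?_) (by omega)
    · simp only [Op.eval, b4]; omega
    · simp [Op.eval, b4]; omega
    · simp [Op.eval, b1, bs]; omega
    · omega
    · convert h using 1
      rw [hmC]
      simp [Op.eval, b1, bs, b4, show 2 * 2 ^ c + 2 * 2 ^ c + 2 * 2 ^ c = E by omega]
  have rD := Runs.powerLoop (W := W) (m := mC) (a := pr 6) (b := hd 3) (k := hd 2) (u := sp 2)
    (x := 1) (y := n + 1) (e := E) (by simp) (by simp) (by simp) (by simp) (by simp) (by simp [hmC])
    (by simp [hmC]) (by omega) (by simp [hmC]) (by simp [hmC, bs]) (by omega) (by omega)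
  set mD := (mC.setReg (pr 6) (1 * (n + 1) ^ E)).setReg (hd 2) 0 with hmD
  have d1 : mD.reg (pr 1) = n := by simp [hmD, hmC, b1]
  have d3 : mD.reg (pr 3) = N := by simp [hmD, hmC, hmB, hmA]
  have d6 : mD.reg (pr 6) = (n + 1) ^ E := by simp [hmD]
  have ds : mD.reg (sp 2) = 1 := by simp [hmD, hmC, bs]
  set mE := (((((((((((mD.setReg (hd 0) (N + N)).setReg (hd 0) (N + N + N)).setReg (hd 1) 3).setReg
    (hd 0) (3 * N + 3)).setReg (sp 1) (3 * N + 3 + n)).setReg (sp 1) (3 * N + 2 * n + 3)).setReg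
      (hd 1)
    8).setReg (pr 0) ((n + 1) ^ E + (3 * N + 2 * n + 3))).setReg (pr 0) (capacity n c N)).setReg
      (sp 0)
    (capacity n c N + 1)).setReg (hd 3) 16) with hmE
  have rE : ∀ {p : Program} {B m'}, Runs W p mE B m' → Runs W (
      .seq (.op .add (hd 0) (pr 3) (pr 3)) <| .seq (.op .add (hd 0) (hd 0) (pr 3)) <|
      .seq (.const (hd 1) 3) <| .seq (.op .add (hd 0) (hd 0) (hd 1)) <|
      .seq (.op .add (sp 1) (hd 0) (pr 1)) <| .seq (.op .add (sp 1) (sp 1) (pr 1)) <|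
      .seq (.const (hd 1) 8) <| .seq (.op .add (pr 0) (pr 6) (sp 1)) <|
      .seq (.op .add (pr 0) (pr 0) (hd 1)) <| .seq (.op .add (sp 0) (pr 0) (sp 2)) <|
      .seq (.const (hd 3) 16) p) mD (11 + B) m' := by
    intro p B m' h
    have f1 : N + N + N + 3 = 3 * N + 3 := by omega
    have f2 : 3 * N + 3 + n + n = 3 * N + 2 * n + 3 := by omega
    refine Runs.mono ((Runs.op ?_).seq <| (Runs.op ?_).seq <| (Runs.const ?_).seq <|
      (Runs.op ?_).seq <| (Runs.op ?_).seq <| (Runs.op ?_).seq <| (Runs.const ?_).seq <|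
      (Runs.op ?_).seq <| (Runs.op ?_).seq <| (Runs.op ?_).seq <|
      (Runs.const ?_).seq (B' := B) (m'' := m') ?_) (by omega)
    case refine_12 =>
      convert h using 1
      rw [hmE]
      simp only [State.setReg_reg, Op.eval, hd_inj, sp_inj, hd_ne_pr, hd_ne_sp, pr_ne_hd,
        pr_ne_sp, sp_ne_hd, sp_ne_pr, if_true, if_false, d1, d3, d6, ds, f1, f2, ← hcap0,
        one_ne_zero, OfNat.ofNat_ne_one, zero_ne_one]
    all_goals first
      | omega
      | (simp [Op.eval, d1, d3, d6, ds]; omega)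
  obtain ⟨m, rF, hreg, hmem, hmem'⟩ := Runs.inputLoop (W := W) (m := mE) (L := 3 * N + 3)
    (base := 3 * N + 2 * n + 3) (by simp [hmE]) (by simp [hmE]) (by simp [hmE, ds]) (by simp [hmE])
    (by omega) (by omega)
  refine ⟨m, Runs.mono (rA (rB.seq (rC (rD.seq (rE rF))))) (by omega), ?_⟩
  have memE : mE.mem = (initial x).mem := rfl
  have hlen : x.length = 3 * N + 3 := by simp [hxdef, hcode]
  have hget : ∀ i, x.getD i 0 ≤ capacity n c N := by
    intro i
    have hle : ∀ k ∈ x, k ≤ capacity n c N := by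
      intro k hk
      have h2 := params_le (n := n) (c := c) (N := N) hn 2
      have h2 : c ≤ capacity n c N := h2
      simp only [hxdef, List.mem_cons] at hk
      rcases hk with rfl | rfl | rfl | hk
      · omega
      · exact h2
      · omega
      · exact hx k hk
    by_cases hi : i < x.length
    · rw [List.getD_eq_getElem _ _ hi]
      exact hle _ (List.getElem_mem hi)
    · rw [List.getD_eq_default _ _ (by omega)]
      omega
  constructor
  · intro y
    rw [hreg _ (by simp)]
    simp [hmE, hmD, hmC, hmB, hmA, er, inputStore]
  · intro k
    rw [hreg _ (by simp)]
    match k with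
    | 0 => simp [hmE, params]
    | 1 => simp [hmE, d1, params]
    | 2 => simp [hmE, hmD, hmC, hmB, hmA, params]
    | 3 => simp [hmE, d3, params]
    | 4 => simp [hmE, hmD, hmC, b4, params]
    | 5 => simp [hmE, hmD, hmC, params, hE]
    | 6 => simp [hmE, d6, params, hE]
    | k + 7 => simp [hmE, hmD, hmC, hmB, hmA, er, params]
  · rw [hreg _ (by simp)]
    simp [hmE, params]
  · rw [hreg _ (by simp)]
    simp [hmE]
  · rw [hreg _ (by simp)]
    simp [hmE, ds]
  · intro k i j l hi hj hl
    have addr0 : ∀ i, addr (params n c N) (3 * N + 2 * n + 3) 0 i 0 0 =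
        i * 16 + (3 * N + 2 * n + 3) := by
      intro i; simp [addr]
    have outside : (∀ i' < 3 * N + 3, ¬ (k = 0 ∧ i = i' ∧ j = 0 ∧ l = 0)) →
        m.mem (addr (params n c N) (3 * N + 2 * n + 3) k i j l) = 0 := by
      intro hne
      rw [hmem' _ fun i' hi' he => ?_]
      · change x.getD _ 0 = 0
        rw [List.getD_eq_default]
        unfold addr
        omega
      · have h3 : params n c N 0 = capacity n c N := rfl
        rw [← addr0, addr_inj hi hj (by omega) (Nat.zero_le _)] at he
        exact hne i' hi' he
    simp only [inputStore]
    split_ifs with hif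
    · obtain ⟨rfl, rfl, rfl⟩ := hif
      by_cases hiL : i < 3 * N + 3
      · rw [addr0, hmem i hiL]
        rfl
      · rw [outside fun i' hi' h => by omega, List.getD_eq_default _ _ (by omega)]
    · exact outside fun i' _ h => hif ⟨h.1, h.2.2⟩
  · intro y
    exact Nat.zero_le _
  · intro k i j l
    simp only [inputStore]
    split_ifs
    · exact hget i
    · exact Nat.zero_le _

/-- Copies the results to the beginning of the memory. -/
def finish : Program :=
  .seq (.const (hd 1) 2) <| .seq (.op .add (hd 0) (pr 1) (pr 1)) <|
  .seq (.op .add (hd 0) (hd 0) (hd 1)) <| .seq (.const (hd 2) 16) <|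
    .seq (.const (hd 3) 11) outputLoop

theorem finish_spec {W base : ℕ} {ρ : ℕ → ℕ} {s : Store} {m : State} (hs : Sim ρ base s m)
    (hF : Fits W ρ base) (hb : 2 * ρ 1 + 2 ≤ base) (hle : 2 * ρ 1 + 4 ≤ ρ 0) :
    ∃ m', Runs W finish m (14 * ρ 1 + 20) m' ∧ ∀ i < 2 * ρ 1 + 2, m'.mem i = s.arr 11 i 0 0 := by
  have h16 : 16 * (ρ 0 + 1) + 16 + base ≤ W := by
    have h1 := hF.le_word
    have h2 : (ρ 0 + 1) ^ 1 ≤ (ρ 0 + 1) ^ 3 := Nat.pow_le_pow_right (by omega) (by omega)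
    rw [pow_one] at h2
    omega
  set mA := ((((m.setReg (hd 1) 2).setReg (hd 0) (ρ 1 + ρ 1)).setReg (hd 0) (2 * ρ 1 + 2)).setReg
    (hd 2) 16).setReg (hd 3) 11 with hmA
  obtain ⟨m', r, hm'⟩ := Runs.outputLoop (W := W) (m := mA) (L := 2 * ρ 1 + 2) (base := base)
    (by simp [hmA]) (by simp [hmA]) (by simp [hmA]) (by simp [hmA, hs.one])
      (by simp [hmA, hs.region])
    hb (by omega)
  refine ⟨m', Runs.mono ((Runs.const ?_).seq <| (Runs.op ?_).seq <| (Runs.op ?_).seq <|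
    (Runs.const ?_).seq <| (Runs.const ?_).seq (B' := (2 * ρ 1 + 2) * 7 + 1) (m'' := m') ?_)
      (by omega),
    fun i hi => ?_⟩
  case refine_6 =>
    convert r using 1
    rw [hmA]
    simp [Op.eval, hs.par, show ρ 1 + ρ 1 + 2 = 2 * ρ 1 + 2 by omega]
  case refine_7 =>
    rw [hm' i hi, ← hs.mem 11 i 0 0 (by omega) (Nat.zero_le _) (Nat.zero_le _)]
    change m.mem _ = _
    simp [addr]
  all_goals first
    | omega
    | (simp [Op.eval, hs.par]; omega)

/-- The program. -/
def program : Program := .seq setup (.seq (Code.main.compile 0) finish)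

open CExpr

theorem mem_code_le {n c : ℕ} (t : CExpr (Fin n) c) {k : ℕ} (hk : k ∈ t.code) :
    k ≤ 3 ∨ k < n ∨ k < c := by
  induction t with
  | vertex v i =>
    simp only [CExpr.code, List.mem_cons, List.not_mem_nil, or_false] at hk
    have := v.2
    have := i.2
    omega
  | union s t hs ht =>
    simp only [CExpr.code, List.mem_append, List.mem_cons, List.not_mem_nil, or_false] at hk
    rcases hk with (hk | hk) | hk
    · exact hs hk
    · exact ht hk
    · omega
  | relabel i j _ t ht =>
    simp only [CExpr.code, List.mem_append, List.mem_cons, List.not_mem_nil, or_false] at hk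
    rcases hk with hk | hk
    · exact ht hk
    · have := i.2
      have := j.2
      omega
  | join i j _ t ht =>
    simp only [CExpr.code, List.mem_append, List.mem_cons, List.not_mem_nil, or_false] at hk
    rcases hk with hk | hk
    · exact ht hk
    · have := i.2
      have := j.2
      omega

/-- An expression has a leaf, so `n` is positive; for `n = 0` the bound would be 0. -/
theorem exists_mem_leaves {V : Type*} {c : ℕ} (t : CExpr V c) : ∃ v, v ∈ t.leaves := by
  induction t with
  | vertex v i => exact ⟨v, List.mem_singleton_self v⟩
  | union s t hs ht => exact hs.imp fun v hv => List.mem_append_left _ hv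
  | relabel i j _ t ht => exact ht
  | join i j _ t ht => exact ht

theorem HoldsOptima.congr {n : ℕ} {G : SimpleGraph (Fin n)} {f g : ℕ → ℕ} (h : HoldsOptima G f)
    (hfg : ∀ i < 2 * n + 2, g i = f i) : HoldsOptima G g := by
  obtain ⟨h0, h1, S, S', hS, hS', hv⟩ := h
  refine ⟨(hfg 0 (by omega)).trans h0, (hfg 1 (by omega)).trans h1, S, S', hS, hS', fun v => ?_⟩
  rw [hfg _ (by omega), hfg _ (by omega)]
  exact hv v

theorem program_spec {n c : ℕ} {G : SimpleGraph (Fin n)} {T : CExpr (Fin n) c}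
    (hT : T.Represents G) {W : ℕ} (hF : Fits W (params n c T.size) (3 * T.size + 2 * n + 3)) :
    ∃ m, Runs W program (initial T.input) ((3 * c + 3 * (3 * (2 * 2 ^ c)) + 6 * (3 * T.size + 3) +
      40) +
      (Code.main.cost (params n c T.size) + (14 * n + 20))) m ∧ HoldsOptima G m.mem := by
  obtain ⟨v, -⟩ := exists_mem_leaves T
  have hn : 0 < n := v.pos
  have hP := params_sizes (c := c) (N := T.size) hn
  have hcode : ∀ k ∈ T.code, k ≤ capacity n c T.size := by
    intro k hk
    have h2 : c ≤ capacity n c T.size := params_le (c := c) hn 2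
    have h1 : n ≤ capacity n c T.size := params_le (c := c) hn 1
    have h0 : 8 ≤ capacity n c T.size := hF.eight_le
    have := mem_code_le T hk
    omega
  obtain ⟨m₁, r₁, s₁⟩ := setup_spec (W := W) hn (length_code T) hcode hF
  obtain ⟨m₂, r₂, s₂, -⟩ := Code.main.compile_spec hF 0 _ m₁ s₁
  obtain ⟨m₃, r₃, h₃⟩ := finish_spec s₂ hF (by rw [hP.par1]; omega) (by
    rw [hP.par1]; exact hP.vertices_le)
  refine ⟨m₃, r₁.seq (r₂.seq r₃), ?_⟩
  refine HoldsOptima.congr (main_spec hT hP rfl (s := inputStore T.input) (fun _ => rfl) ?_ ?_) h₃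
  · intro i _
    rw [Nat.add_comm]
    rfl
  · intro A hA i j l
    exact if_neg fun h => hA h.1

/-! ### The exponent of time and word size. -/

section

variable {n c K : ℕ}

/-- A bound for the constant factors of the parameters. -/
def factor (c K : ℕ) : ℕ := 2 ^ (3 * (2 * 2 ^ c)) + 3 * (2 * 2 ^ c) + c + 3 * K + 13

/-- The capacity and the number of states are of order `n ^ (6 * 2 ^ c)` because `n + 1 ≤ 2 * n`;
the numbers of vertices and nodes are linear in `n`; the others depend on `c` only. -/
theorem params_bound {N : ℕ} (hn : 0 < n) (hN : N ≤ K * n) (k : ℕ) :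
    params n c N k ≤ factor c K * ((n ^ (3 * (2 * 2 ^ c))) ^ (k == 0 || k == 6).toNat *
      n ^ (k == 1 || k == 3).toNat) := by
  set E := 3 * (2 * 2 ^ c) with hE
  have hpow : (n + 1) ^ E ≤ 2 ^ E * n ^ E := by
    rw [← mul_pow]
    exact Nat.pow_le_pow_left (by omega) _
  have hnE : n ≤ n ^ E := Nat.le_self_pow (by positivity) n
  have hle : 1 ≤ n ^ E := Nat.one_le_pow _ _ hn
  have hK : K * n ≤ K * n ^ E := Nat.mul_le_mul_left _ hnE
  have hdist : factor c K * n ^ E = 2 ^ E * n ^ E + E * n ^ E + c * n ^ E + 3 * (K * n ^ E) +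
      13 * n ^ E := by simp only [factor]; ring
  have hdist' : factor c K * n = 2 ^ E * n + E * n + c * n + 3 * (K * n) + 13 * n := by
    simp only [factor]; ring
  have hf : factor c K = 2 ^ E + E + c + 3 * K + 13 := rfl
  generalize 2 ^ E = p at hf
  match k with
  | 0 => simp [params, capacity, ← hE]; omega
  | 1 => simp [params]; omega
  | 2 => simp [params, hf]; omega
  | 3 => simp [params]; omega
  | 4 => simp [params, hf]; omega
  | 5 => simp [params, hf, ← hE]; omega
  | 6 => simp [params, ← hE]; omega
  | k + 7 => simp [params]

theorem main_cost_le {N : ℕ} (hn : 0 < n) (hN : N ≤ K * n) :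
    Code.main.cost (params n c N) ≤ Code.main.coef (fun _ => factor c K) * n ^ (28 * 2 ^ c + 1) :=
      by
  have h := Cmd.cost_le (P := fun k => k == 0 || k == 6) (Q := fun k => k == 1 || k == 3)
    (x := n ^ (3 * (2 * 2 ^ c))) (y := n) (κ := fun _ => factor c K) (Nat.one_le_pow _ _ hn) hn
    (params_bound (c := c) hn hN) Code.main
  -- Two loops run over the slots of the operand tables and one over the states tested for the sum.
  have h1 : Code.main.depth (fun k => k == 0 || k == 6) = 3 := by decide
  -- The loop over the nodes and the four loops of the reachability computation.
  have h2 : Code.main.depth (fun k => k == 1 || k == 3) = 5 := by decide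
  rw [h1, h2, ← pow_mul, ← pow_add] at h
  -- What remains is `18 * 2 ^ c + 5 ≤ 28 * 2 ^ c + 1`, which holds because `2 ^ c` is at least 1.
  refine h.trans (Nat.mul_le_mul_left _ (Nat.pow_le_pow_right hn ?_))
  have := Nat.one_le_two_pow (n := c)
  omega

/-- The largest numbers are addresses, of the order of the cube of the capacity, i.e. `n ^ (18 * 2 ^
c)`. Hence the time bound can serve as word bound as well. -/
theorem word_le {N : ℕ} (hn : 0 < n) (hN : N ≤ K * n) :
    (params n c N 0 + 1) ^ 3 * 16 + 16 + (3 * N + 2 * n + 3) ≤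
      (16 * (factor c K + 1) ^ 3 + 16 + 3 * K + 5) * n ^ (28 * 2 ^ c + 1) := by
  set E := 3 * (2 * 2 ^ c) with hE
  have h0 := params_bound (c := c) hn hN 0
  simp only [beq_self_eq_true, Bool.true_or, Bool.toNat_true, pow_one, ← hE] at h0
  have hle : 1 ≤ n ^ E := Nat.one_le_pow _ _ hn
  have h1 : params n c N 0 + 1 ≤ (factor c K + 1) * n ^ E := by
    have : n ^ ((0 : ℕ) == 1 || (0 : ℕ) == 3).toNat = 1 := rfl
    rw [this, mul_one] at h0
    rw [Nat.add_mul, one_mul]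
    omega
  have h2 : (params n c N 0 + 1) ^ 3 ≤ (factor c K + 1) ^ 3 * n ^ (28 * 2 ^ c + 1) := by
    refine (Nat.pow_le_pow_left h1 3).trans ?_
    rw [mul_pow, ← pow_mul]
    exact Nat.mul_le_mul_left _ (Nat.pow_le_pow_right hn (by omega))
  have h3 : n ≤ n ^ (28 * 2 ^ c + 1) := Nat.le_self_pow (by omega) n
  have h4 : K * n ≤ K * n ^ (28 * 2 ^ c + 1) := Nat.mul_le_mul_left _ h3
  have h5 : (16 * (factor c K + 1) ^ 3 + 16 + 3 * K + 5) * n ^ (28 * 2 ^ c + 1) =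
      16 * ((factor c K + 1) ^ 3 * n ^ (28 * 2 ^ c + 1)) + 16 * n ^ (28 * 2 ^ c + 1) +
        3 * (K * n ^ (28 * 2 ^ c + 1)) + 5 * n ^ (28 * 2 ^ c + 1) := by ring
  omega

end

theorem program_computes (c K : ℕ) :
    ∃ A : ℕ, ∀ (n : ℕ) (G : SimpleGraph (Fin n)) (T : CExpr (Fin n) c),
      T.Represents G → T.size ≤ K * n →
        ComputesWithin program T.input (A * n ^ (28 * 2 ^ c + 1)) (A * n ^ (28 * 2 ^ c + 1))
          (HoldsOptima G) := by
  -- The three summands pay for the time of the compiled algorithm, for the word size, and for the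
  -- time of input and output.
  refine ⟨Code.main.coef (fun _ => factor c K) +
    (16 * (factor c K + 1) ^ 3 + 16 + 3 * K + 5) + (3 * c + 3 * (3 * (2 * 2 ^ c)) + 18 * K + 100),
      ?_⟩
  intro n G T hT hsize
  obtain ⟨v, -⟩ := exists_mem_leaves T
  have hn : 0 < n := v.pos
  set M := n ^ (28 * 2 ^ c + 1) with hM
  have hcost := main_cost_le (c := c) hn hsize
  have hword := word_le (c := c) hn hsize
  have hnM : n ≤ M := Nat.le_self_pow (by omega) n
  have hKM : K * n ≤ K * M := Nat.mul_le_mul_left _ hnM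
  have hcM : (3 * c + 3 * (3 * (2 * 2 ^ c))) * 1 ≤ (3 * c + 3 * (3 * (2 * 2 ^ c))) * M :=
    Nat.mul_le_mul_left _ (by omega)
  rw [← hM] at hcost hword
  have hA : (Code.main.coef (fun _ => factor c K) + (16 * (factor c K + 1) ^ 3 + 16 + 3 * K + 5) +
      (3 * c + 3 * (3 * (2 * 2 ^ c)) + 18 * K + 100)) * M = Code.main.coef (fun _ => factor c K) * M
        +
      (16 * (factor c K + 1) ^ 3 + 16 + 3 * K + 5) * M +
      ((3 * c + 3 * (3 * (2 * 2 ^ c))) * M + 18 * (K * M) + 100 * M) := by ring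
  have hF : Fits ((Code.main.coef (fun _ => factor c K) +
      (16 * (factor c K + 1) ^ 3 + 16 + 3 * K + 5) +
      (3 * c + 3 * (3 * (2 * 2 ^ c)) + 18 * K + 100)) * M) (params n c T.size)
      (3 * T.size + 2 * n + 3) := by
    refine ⟨?_, params_le hn, ?_⟩
    · simp only [params, capacity]; omega
    · rw [hA]; omega
  have hcube : (params n c T.size 0 + 1) ^ 1 ≤ (params n c T.size 0 + 1) ^ 3 :=
    Nat.pow_le_pow_right (by omega) (by omega)
  rw [pow_one] at hcube
  obtain ⟨m, ⟨t, ht, hexec⟩, hm⟩ := program_spec hT hF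
  refine ⟨fun k hk => ?_, t, m, ?_, hexec, hm⟩
  · have hle : k ≤ params n c T.size 0 := by
      have h1 := params_le (c := c) (N := T.size) hn 1
      have h2 := params_le (c := c) (N := T.size) hn 2
      have h3 := params_le (c := c) (N := T.size) hn 3
      have h8 := hF.eight_le
      simp only [CExpr.input, List.mem_cons] at hk
      rcases hk with rfl | rfl | rfl | hk
      · exact h1
      · exact h2
      · exact h3
      · have := mem_code_le T hk
        have h1 : n ≤ _ := h1
        have h2 : c ≤ _ := h2
        omega
    rw [hA]
    omega
  · rw [hA]
    omega

end SafeSet.RAM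

/-- One program solves the problem for all inputs. The factor `A` hidden in the `O`-notation depends
only on the number `c` of labels and on the factor `K` in the linear bound on the number of nodes
of the given expression; numbers are limited to the time bound, i.e. to `O(log n)` bits. -/
theorem theorem4 :
    ∃ P : SafeSet.RAM.Program, ∀ c K : ℕ, ∃ A : ℕ,
      ∀ (n : ℕ) (G : SimpleGraph (Fin n)) (T : SafeSet.CExpr (Fin n) c),
        T.Represents G → T.Irredundant → T.size ≤ K * n →
          SafeSet.RAM.ComputesWithin P T.input
            (A * n ^ (28 * 2 ^ c + 1)) (A * n ^ (28 * 2 ^ c + 1))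
            (SafeSet.HoldsOptima G) :=
  ⟨SafeSet.RAM.program, fun c K =>
    (SafeSet.RAM.program_computes c K).imp fun _ hA n G T hT _ => hA n G T hT⟩
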